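/- **Setting.** For positive integers $d,k,m$ with $k\mid d$ put $n=k\cdot 2^{d/k}$. For an invertible $B\in\mathbb R^{d\times d}$ let $\sigma_{\max}(B),\sigma_{\min}(B)$ be its extreme singular values, $\kappa(B)=\sigma_{\max}(B)/\sigma_{\min}(B)$, and $\lambda_{1,\mathrm{bin}}(B)=\min\{\|Bz-Bz'\|_2 : z\ne z'\in\{-1,1\}^d\}$. The problem $\mathsf{BinaryBDD}_{d,\alpha}$ is: given $B$ and $t=Bz+e$ with $z\in\{-1,1\}^d$ and $\|e\|_2\le\alpha\,\lambda_{1,\mathrm{bin}}(B)$, find $z$. Let $G_{\mathsf{sparse}}\in\mathbb R^{d\times n}$ be block diagonal with $k$ equal blocks of size $(d/k)\times 2^{d/k}$ whose columns are all vectors of $\{-1,1\}^{d/k}$, and let $G_{\mathsf{partite}}\in\mathbb R^{k\times n}$ be block diagonal with $k$ blocks equal to the all-ones row of length $2^{d/k}$. Given $R\in\mathbb R^{(m-k)\times d}$ and $\gamma>0$, the $k$-sparse regression instance of the reduction is $$X=\begin{pmatrix}RBG_{\mathsf{sparse}}\\ \gamma G_{\mathsf{partite}}\end{pmatrix}\in\mathbb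 R^{m\times n},\qquad y=\begin{pmatrix}Rt\\ \gamma\mathbf 1\end{pmatrix}\in\mathbb R^m .$$ A Lasso estimate with parameter $\lambda>0$ is any minimiser $\hat\theta$ of $\frac1{2m}\|y-X\theta\|_2^2+\lambda\|\theta\|_1$; a thresholded Lasso estimate $\hat\theta_{\mathsf{TL}}$ is obtained from it by keeping $k$ entries of largest absolute value and setting the others to $0$. The decoded vector is $G_{\mathsf{sparse}}\,\mathrm{round}(\hat\theta_{\mathsf{TL}})$, where $\mathrm{round}$ is entrywise rounding to the nearest integer. Running time is the number of steps of a real random access machine (unit-cost arithmetic, square root and comparison of reals, and independent standard Gaussian samples). **Theorem.** There are two fixed programs, $\mathsf{pre}$ (randomized, with input $d,k,m,B,t$) and $\mathsf{post}$ (deterministic, with input $d,k,m$ and a vector of $\mathbb R^n$), such that the following holds. 1. There are universal constants $C,c,a>0$ such that for all positive $d,k,m$ with $k\mid d$ and $m\ge 17d$, all invertible $B\in\mathbb R^{d\times d}$ and all $$\alpha\le C\cdot\frac{k}{d^5\,\kappa(B)^2}$$ there are scalars $\lambda>0$ and $\gamma$ with $10\sqrt3\,\sigma_{\max}(B)\sqrt{d(m-k)/k}\le\gamma\le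 20\sqrt3\,\sigma_{\max}(B)\sqrt{d(m-k)/k}$ for which: (i) on input $(B,t)$, for every $t$, $\mathsf{pre}$ outputs $(X,y,\lambda)$, where the entries of $R$ are its i.i.d. $\mathcal N(0,1)$ samples; (ii) if a Lasso solver takes time $T(m,n)$ on $m\times n$ instances, then $\mathsf{pre}$, one call of the solver, and $\mathsf{post}$ applied to its answer together always take time at most $(m+k\cdot2^{d/k})^a+T(m,n)$; in particular the algorithm runs in time $\mathrm{poly}(m,k\cdot 2^{d/k})$ if the Lasso solver does; (iii) for every $\mathsf{BinaryBDD}_{d,\alpha}$ instance $(B,t=Bz+e)$, with probability at least $1-e^{-cm}$ over $R$, for every Lasso estimate $\hat\theta$ on $(X,y,\lambda)$ one has $G_{\mathsf{sparse}}\,\mathrm{round}(\hat\theta_{\mathsf{TL}})=z$ for every thresholding $\hat\theta_{\mathsf{TL}}$ of $\hat\theta$, and $\mathsf{post}$ on input $\hat\theta$ outputs $z$. 2. With the same programs, there are universal constants $C',c',a'>0$ such that for $d=10k$, $m=100d$, all invertible $B$ and all $\alpha\le C'/(d^4\kappa(B)^2)$, the same conclusions hold with time bound $d^{a'}+T(m,n)$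 and success probability at least $1-e^{-c'd}$. -/

import Mathlib

open MeasureTheory ProbabilityTheory Matrix

noncomputable section

namespace BDDLasso

/-! ### Binary bounded distance decoding -/

/-- The Euclidean norm of a vector given by its coordinates. -/
def l2norm {ι : Type*} [Fintype ι] (v : ι → ℝ) : ℝ := ‖WithLp.toLp 2 v‖

/-- `z ∈ {-1, 1}^d`. -/
def IsSign {d : ℕ} (z : Fin d → ℝ) : Prop := ∀ i, z i = 1 ∨ z i = -1

/-- The binary minimum distance: the least distance of two different points of `B {-1, 1}^d`. -/
def lambdaBin {d : ℕ} (B : Matrix (Fin d) (Fin d) ℝ) : ℝ :=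
  sInf {r : ℝ | ∃ z z' : Fin d → ℝ, IsSign z ∧ IsSign z' ∧ z ≠ z' ∧ r = l2norm (B *ᵥ z - B *ᵥ z')}

/-- The largest singular value. -/
def sigmaMax {d : ℕ} (B : Matrix (Fin d) (Fin d) ℝ) : ℝ :=
  (Matrix.toEuclideanLin B).singularValues 0

/-- The smallest singular value. -/
def sigmaMin {d : ℕ} (B : Matrix (Fin d) (Fin d) ℝ) : ℝ :=
  (Matrix.toEuclideanLin B).singularValues (d - 1)

/-- The condition number. -/
def cond {d : ℕ} (B : Matrix (Fin d) (Fin d) ℝ) : ℝ := sigmaMax B / sigmaMin B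

/-! ### The gadget matrices and the regression instance

The columns are numbered `0, …, n - 1` with `n = k * 2 ^ (d / k)`, and the `b`-th block of columns
consists of those `j` with `j / 2 ^ (d / k) = b`. -/

/-- Block diagonal with `k` equal blocks of size `(d / k) × 2 ^ (d / k)`; the columns of a block are
all the vectors of `{-1, 1}^(d / k)`, in the order of the binary expansions of their numbers. -/
def gSparse (d k : ℕ) : Matrix (Fin d) (Fin (k * 2 ^ (d / k))) ℝ := fun i j =>
  if (i : ℕ) / (d / k) = (j : ℕ) / 2 ^ (d / k) then
    (if ((j : ℕ) % 2 ^ (d / k)).testBit ((i : ℕ) % (d / k)) then 1 else -1)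
  else 0

/-- Block diagonal with `k` equal blocks, each being the all-ones row of length `2 ^ (d / k)`. -/
def gPartite (d k : ℕ) : Matrix (Fin k) (Fin (k * 2 ^ (d / k))) ℝ := fun b j =>
  if (b : ℕ) = (j : ℕ) / 2 ^ (d / k) then 1 else 0

/-- The design matrix with top block `R B G_sparse` and bottom block `γ G_partite`. -/
def design (d k m : ℕ) (B : Matrix (Fin d) (Fin d) ℝ) (R : Matrix (Fin (m - k)) (Fin d) ℝ) (γ : ℝ) :
    Matrix (Fin (m - k) ⊕ Fin k) (Fin (k * 2 ^ (d / k))) ℝ :=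
  Matrix.fromRows (R * B * gSparse d k) (γ • gPartite d k)

/-- The response vector with top part `R t` and bottom part `γ 1`. -/
def response (d k m : ℕ) (t : Fin d → ℝ) (R : Matrix (Fin (m - k)) (Fin d) ℝ) (γ : ℝ) :
    Fin (m - k) ⊕ Fin k → ℝ :=
  Sum.elim (R *ᵥ t) (fun _ => γ)

/-! ### Thresholded Lasso -/

/-- The Lasso objective `‖y - X θ‖₂² / (2m) + lam ‖θ‖₁`, where `m` is the number of rows of `X`. -/
def lassoObjective {ι κ : Type*} [Fintype ι] [Fintype κ] (X : Matrix ι κ ℝ) (y : ι → ℝ) (lam : ℝ)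
    (θ : κ → ℝ) : ℝ :=
  1 / (2 * (Fintype.card ι : ℝ)) * l2norm (y - X *ᵥ θ) ^ 2 + lam * ∑ j, |θ j|

/-- `θ` is a Lasso estimate (a global minimiser) for `(X, y)` with regularization parameter `lam`. -/
def IsLasso {ι κ : Type*} [Fintype ι] [Fintype κ] (X : Matrix ι κ ℝ) (y : ι → ℝ) (lam : ℝ)
    (θ : κ → ℝ) : Prop :=
  ∀ θ' : κ → ℝ, lassoObjective X y lam θ ≤ lassoObjective X y lam θ'

/-- `θTL` is `θ` truncated to `k` entries of largest absolute value (ties broken arbitrarily). -/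
def IsTruncation {n : ℕ} (k : ℕ) (θ θTL : Fin n → ℝ) : Prop :=
  ∃ S : Finset (Fin n), S.card = k ∧ (∀ i ∈ S, ∀ j, j ∉ S → |θ j| ≤ |θ i|) ∧
    ∀ j, θTL j = if j ∈ S then θ j else 0

/-- Decoding of a regression vector: round entrywise to the nearest integer, multiply by
`G_sparse`. -/
def decode (d k : ℕ) (θ : Fin (k * 2 ^ (d / k)) → ℝ) : Fin d → ℝ :=
  gSparse d k *ᵥ fun j => (round (θ j) : ℝ)

/-! ### A real random access machine with Gaussian samples

A machine has registers holding natural numbers, a memory of real cells addressed by triples of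
natural numbers (array name, row, column), and a tape of real random samples that is read
sequentially. Programs are finite, with only the four arithmetic operations, square root and
comparison on reals (no rounding), and only addition, truncated subtraction and halving on the
registers. Each operation costs one unit of time. The only loops are `for` loops, so every program
terminates; the number of executed steps is what is counted. -/

/-- Expressions over the registers. -/
inductive NExp : Type
  | lit (c : ℕ)
  | reg (x : ℕ)
  | add (e f : NExp)
  | sub (e f : NExp)
  | half (e : NExp)

/-- Real expressions. -/
inductive RExp : Type
  | nat (e : NExp)
  | get (a : ℕ) (i j : NExp)
  | add (e f : RExp)
  | sub (e f : RExp)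
  | mul (e f : RExp)
  | div (e f : RExp)
  | sqrt (e : RExp)

/-- Programs. -/
inductive Cmd : Type
  /-- do nothing -/
  | skip
  /-- assign to register `x` -/
  | setReg (x : ℕ) (e : NExp)
  /-- assign to the cell `(i, j)` of array `a` -/
  | setMem (a : ℕ) (i j : NExp) (e : RExp)
  /-- move the next random sample to the cell `(i, j)` of array `a` -/
  | sample (a : ℕ) (i j : NExp)
  /-- sequential composition -/
  | seq (p q : Cmd)
  /-- if `e ≤ f` then `p` else `q` -/
  | ifLe (e f : RExp) (p q : Cmd)
  /-- for `x = 0, …, N - 1` do `p`, where `N` is the value of `e` on entry -/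
  | loop (x : ℕ) (e : NExp) (p : Cmd)

structure State : Type where
  reg : ℕ → ℕ
  mem : ℕ → ℕ → ℕ → ℝ
  /-- number of samples read so far -/
  pos : ℕ
  /-- number of steps executed so far -/
  time : ℕ

def NExp.eval (s : State) : NExp → ℕ
  | .lit c => c
  | .reg x => s.reg x
  | .add e f => e.eval s + f.eval s
  | .sub e f => e.eval s - f.eval s
  | .half e => e.eval s / 2

/-- Number of steps needed for an evaluation. -/
def NExp.size : NExp → ℕ
  | .lit _ => 1
  | .reg _ => 1
  | .add e f => e.size + f.size + 1
  | .sub e f => e.size + f.size + 1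
  | .half e => e.size + 1

def RExp.eval (s : State) : RExp → ℝ
  | .nat e => (e.eval s : ℝ)
  | .get a i j => s.mem a (i.eval s) (j.eval s)
  | .add e f => e.eval s + f.eval s
  | .sub e f => e.eval s - f.eval s
  | .mul e f => e.eval s * f.eval s
  | .div e f => e.eval s / f.eval s
  | .sqrt e => Real.sqrt (e.eval s)

/-- Number of steps needed for an evaluation. -/
def RExp.size : RExp → ℕ
  | .nat e => e.size + 1
  | .get _ i j => i.size + j.size + 1
  | .add e f => e.size + f.size + 1
  | .sub e f => e.size + f.size + 1
  | .mul e f => e.size + f.size + 1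
  | .div e f => e.size + f.size + 1
  | .sqrt e => e.size + 1

def State.tick (s : State) (c : ℕ) : State := { s with time := s.time + c }

def State.setReg (s : State) (x v : ℕ) : State := { s with reg := Function.update s.reg x v }

def State.setMem (s : State) (a i j : ℕ) (v : ℝ) : State :=
  { s with mem := fun a' i' j' => if a' = a ∧ i' = i ∧ j' = j then v else s.mem a' i' j' }

open Classical in
/-- The final state of a program run from a given state with sample tape `ω`. -/
def Cmd.run (ω : ℕ → ℝ) : Cmd → State → State
  | .skip, s => s.tick 1
  | .setReg x e, s => (s.setReg x (e.eval s)).tick (e.size + 1)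
  | .setMem a i j e, s =>
      (s.setMem a (i.eval s) (j.eval s) (e.eval s)).tick (i.size + j.size + e.size + 1)
  | .sample a i j, s =>
      { s.setMem a (i.eval s) (j.eval s) (ω s.pos) with
        pos := s.pos + 1, time := s.time + (i.size + j.size + 1) }
  | .seq p q, s => q.run ω (p.run ω s)
  | .ifLe e f p q, s =>
      if e.eval s ≤ f.eval s then p.run ω (s.tick (e.size + f.size + 1))
      else q.run ω (s.tick (e.size + f.size + 1))
  | .loop x e p, s =>
      Nat.rec (s.tick (e.size + 1)) (fun i s' => p.run ω ((s'.setReg x i).tick 1)) (e.eval s)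

/-- The law of a tape of independent standard Gaussian samples. -/
def gaussianTape : Measure (ℕ → ℝ) := Measure.infinitePi fun _ : ℕ => gaussianReal 0 1

/-- The matrix whose entries are the first samples of the tape, row by row. -/
def tapeMatrix (r d : ℕ) (ω : ℕ → ℝ) : Matrix (Fin r) (Fin d) ℝ := fun i j => ω (i * d + j)

/-- `d`, `k`, `m` in the registers `0`, `1`, `2`. -/
def paramRegs (d k m : ℕ) : ℕ → ℕ := fun x =>
  if x = 0 then d else if x = 1 then k else if x = 2 then m else 0

/-- Initial state of the preprocessing: parameters, `B` in array `0`, `t` in array `1`. -/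
def preInit (d k m : ℕ) (B : Matrix (Fin d) (Fin d) ℝ) (t : Fin d → ℝ) : State where
  reg := paramRegs d k m
  mem := fun a i j =>
    if hi : i < d then
      if a = 0 then (if hj : j < d then B ⟨i, hi⟩ ⟨j, hj⟩ else 0)
      else if a = 1 ∧ j = 0 then t ⟨i, hi⟩ else 0
    else 0
  pos := 0
  time := 0

/-- Initial state of the postprocessing: parameters and the regression vector in array `0`.
Neither `B` nor `t` is available. -/
def postInit (d k m : ℕ) {n : ℕ} (θ : Fin n → ℝ) : State where
  reg := paramRegs d k m
  mem := fun a i j => if hi : i < n then (if a = 0 ∧ j = 0 then θ ⟨i, hi⟩ else 0) else 0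
  pos := 0
  time := 0

/-- In state `s`, array `2` holds `X`, array `3` holds `y`, and array `4` holds `lam`. -/
def HoldsLassoInstance {p k n : ℕ} (s : State) (X : Matrix (Fin p ⊕ Fin k) (Fin n) ℝ)
    (y : Fin p ⊕ Fin k → ℝ) (lam : ℝ) : Prop :=
  (∀ r j, s.mem 2 (finSumFinEquiv r : Fin (p + k)) (j : Fin n) = X r j) ∧
  (∀ r, s.mem 3 (finSumFinEquiv r : Fin (p + k)) 0 = y r) ∧
  s.mem 4 0 0 = lam

/-- The output of the postprocessing (a deterministic program: the tape is zero), in array `1`. -/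
def postOutput (post : Cmd) (d k m : ℕ) {n : ℕ} (θ : Fin n → ℝ) : Fin d → ℝ := fun i =>
  (post.run (fun _ => 0) (postInit d k m θ)).mem 1 i 0

/-- Total time: preprocessing with tape `ω`, one call of a Lasso solver that takes time `T m n` on
`m × n` instances, postprocessing of its answer `θ`. -/
def totalTime (pre post : Cmd) (T : ℕ → ℕ → ℕ) (d k m : ℕ) (B : Matrix (Fin d) (Fin d) ℝ)
    (t : Fin d → ℝ) (ω : ℕ → ℝ) (θ : Fin (k * 2 ^ (d / k)) → ℝ) : ℕ :=
  (pre.run ω (preInit d k m B t)).time + T m (k * 2 ^ (d / k)) +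
    (post.run (fun _ => 0) (postInit d k m θ)).time

/-- With the basis `B`, the programs `pre` and `post`, with one call of a Lasso solver in between,
carry out the reduction to sparse regression and solve binary bounded distance decoding with
parameter `α`, in time at most `τ` and with failure probability at most `ε`:

* on every target `t`, `pre` produces the instance `(X, y)` of the reduction for some scalar `γ`
  of the prescribed size `Θ(σ_max(B) √(d m / k))`, where `R` has independent standard Gaussian
  entries, and a regularization parameter `lam > 0`;
* the total time is at most `τ`, whatever the samples and the answer of the Lasso solver are;
* if `t = B z + e` with `z ∈ {-1, 1}^d` and `‖e‖₂ ≤ α λ_bin(B)`, then, outside an event of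
  probability at most `ε`, for every Lasso estimate on that instance and every thresholding of it,
  decoding gives `z`, and `post` outputs `z`. -/
def SolvesViaLasso (pre post : Cmd) (T : ℕ → ℕ → ℕ) (d k m : ℕ) (B : Matrix (Fin d) (Fin d) ℝ)
    (α : ℝ) (τ : ℕ) (ε : ℝ) : Prop :=
  ∃ γ lam : ℝ,
    10 * √3 * sigmaMax B * √((d : ℝ) * ((m : ℝ) - k) / k) ≤ γ ∧
    γ ≤ 20 * √3 * sigmaMax B * √((d : ℝ) * ((m : ℝ) - k) / k) ∧
    0 < lam ∧
    (∀ (t : Fin d → ℝ) (ω : ℕ → ℝ),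
      HoldsLassoInstance (pre.run ω (preInit d k m B t))
        (design d k m B (tapeMatrix (m - k) d ω) γ)
        (response d k m t (tapeMatrix (m - k) d ω) γ) lam ∧
      ∀ θ, totalTime pre post T d k m B t ω θ ≤ τ) ∧
    ∀ z e : Fin d → ℝ, IsSign z → l2norm e ≤ α * lambdaBin B →
      gaussianTape {ω | ¬ ∀ θ, IsLasso (design d k m B (tapeMatrix (m - k) d ω) γ)
          (response d k m (B *ᵥ z + e) (tapeMatrix (m - k) d ω) γ) lam θ →
        (∀ θTL, IsTruncation k θ θTL → decode d k θTL = z) ∧ postOutput post d k m θ = z}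
      ≤ ENNReal.ofReal ε

end BDDLasso

end

noncomputable section

namespace BDDLasso

/-! ### Frame and cost of machine programs -/

/-! Encode z by the 0-1 vector θ* (`trueVector`) that marks, in each block, the column equal to the
corresponding part of z. Then G_sparse θ* = z, G_partite θ* = 1 and ‖θ*‖₁ = k. It suffices that
every Lasso estimate θ is within 1/2 of θ* in each coordinate (`IsLasso.abs_sub_trueVector_lt`): the
k largest entries are then the true support, and both decoders return z.

Put h = G_sparse θ - z, δ = 1 - G_partite θ, P = Σθ - k, and let ν be the negative mass of θ.
Comparing the objective at θ and θ* gives ‖R(e - Bh)‖² + γ²‖δ‖² + 2mλ(P + 2ν) ≤ ‖Re‖². The term P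
may be negative, but P = -Σδ, so |P| ≤ √k ‖δ‖, and the large γ absorbs it (`energy_bound`). Hence δ
and ν are small, and so is h, because R is well conditioned and ‖x‖² ≤ ‖B⁻¹‖_F² ‖Bx‖². The passage
from h to θ is combinatorial (`sum_abs_compl_le`). With N = d/k, a true column has scalar product N
with z and every other column at most N - 2, so positive mass off the support makes z·G_sparse θ
fall short of NΣθ. This bounds the mass off the support by (NP - z·h)/2 + 2Nν. On the support, the
block sums then force the entries to be near 1.

Chance enters only through `WellConditioned`, an event about R alone, proved by chi-square tails and
a union bound over a net of the sphere (`gaussianTape_not_wellConditioned`).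

The machine cannot compute singular values exactly. It finds σ_max up to a factor 2 from the trace
of a high power of BᵀB and repeated square roots (`sigmaEst`), and replaces σ_min⁻² by ‖B⁻¹‖_F²
(`invNormSq`), obtained by Gram–Schmidt and too large by at most a factor d. Correctness of the
programs follows from loop invariants and a frame rule. The running time follows from a syntactic
cost, polynomial in m + k 2^(d/k). -/

@[simp] theorem State.tick_reg (s : State) (c : ℕ) : (s.tick c).reg = s.reg := rfl
@[simp] theorem State.tick_mem (s : State) (c : ℕ) : (s.tick c).mem = s.mem := rfl
@[simp] theorem State.tick_pos (s : State) (c : ℕ) : (s.tick c).pos = s.pos := rfl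
@[simp] theorem State.tick_time (s : State) (c : ℕ) : (s.tick c).time = s.time + c := rfl
@[simp] theorem State.setReg_reg (s : State) (x v : ℕ) :
    (s.setReg x v).reg = Function.update s.reg x v := rfl
@[simp] theorem State.setReg_mem (s : State) (x v : ℕ) : (s.setReg x v).mem = s.mem := rfl
@[simp] theorem State.setReg_pos (s : State) (x v : ℕ) : (s.setReg x v).pos = s.pos := rfl
@[simp] theorem State.setReg_time (s : State) (x v : ℕ) : (s.setReg x v).time = s.time := rfl
@[simp] theorem State.setMem_reg (s : State) (a i j : ℕ) (v : ℝ) :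
    (s.setMem a i j v).reg = s.reg := rfl
@[simp] theorem State.setMem_time (s : State) (a i j : ℕ) (v : ℝ) :
    (s.setMem a i j v).time = s.time := rfl
theorem State.setMem_mem (s : State) (a i j : ℕ) (v : ℝ) (a' i' j' : ℕ) :
    (s.setMem a i j v).mem a' i' j' = if a' = a ∧ i' = i ∧ j' = j then v else s.mem a' i' j' := rfl

/-- The registers read by an expression. -/
def NExp.regs : NExp → List ℕ
  | .lit _ => []
  | .reg x => [x]
  | .add e f => e.regs ++ f.regs
  | .sub e f => e.regs ++ f.regs
  | .half e => e.regs

/-- A bound for the value of an expression over registers with values at most `L`. -/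
def NExp.bound (L : ℕ) : NExp → ℕ
  | .lit c => c
  | .reg _ => L
  | .add e f => e.bound L + f.bound L
  | .sub e _ => e.bound L
  | .half e => e.bound L

theorem NExp.eval_congr (e : NExp) {s s' : State} (h : ∀ r ∈ e.regs, s'.reg r = s.reg r) :
    e.eval s' = e.eval s := by
  induction e <;> simp_all [NExp.eval, NExp.regs]

theorem NExp.eval_le_bound (e : NExp) {s : State} {L : ℕ} (h : ∀ r ∈ e.regs, s.reg r ≤ L) :
    e.eval s ≤ e.bound L := by
  induction e with
  | lit c => simp [NExp.eval, NExp.bound]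
  | reg x => simpa [NExp.eval, NExp.bound, NExp.regs] using h
  | add e f he hf =>
    simp only [NExp.regs, List.mem_append] at h
    simp only [NExp.eval, NExp.bound]
    exact add_le_add (he fun r hr => h r (Or.inl hr)) (hf fun r hr => h r (Or.inr hr))
  | sub e f he hf =>
    simp only [NExp.regs, List.mem_append] at h
    simp only [NExp.eval, NExp.bound]
    exact (Nat.sub_le _ _).trans (he fun r hr => h r (Or.inl hr))
  | half e he =>
    simp only [NExp.eval, NExp.bound]
    exact (Nat.div_le_self _ _).trans (he h)

/-- Absorbs a constant into a power of L, so that time bounds keep the form L ^ a without a leading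
constant. -/
theorem le_two_pow_of_le {c L : ℕ} (hL : 2 ≤ L) : c ≤ L ^ c :=
  Nat.lt_two_pow_self.le.trans (Nat.pow_le_pow_left hL c)

theorem pow_add_pow_le {L a b : ℕ} (hL : 2 ≤ L) : L ^ a + L ^ b ≤ L ^ (a + b + 1) := by
  have h1 : L ^ a ≤ L ^ (a + b) := Nat.pow_le_pow_right (by omega) (by omega)
  have h2 : L ^ b ≤ L ^ (a + b) := Nat.pow_le_pow_right (by omega) (by omega)
  calc L ^ a + L ^ b ≤ L ^ (a + b) * 2 := by omega
    _ ≤ L ^ (a + b) * L := Nat.mul_le_mul_left _ hL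
    _ = L ^ (a + b + 1) := (pow_succ _ _).symm

theorem NExp.bound_le_pow (e : NExp) : ∃ a, ∀ L, 2 ≤ L → e.bound L ≤ L ^ a := by
  induction e with
  | lit c => exact ⟨c, fun L hL => le_two_pow_of_le hL⟩
  | reg x => exact ⟨1, fun L _ => by simp [NExp.bound]⟩
  | add e f he hf =>
    obtain ⟨a, ha⟩ := he
    obtain ⟨b, hb⟩ := hf
    exact ⟨a + b + 1, fun L hL => (add_le_add (ha L hL) (hb L hL)).trans (pow_add_pow_le hL)⟩
  | sub e f he hf => exact he
  | half e he => exact he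

/-- The registers written by a program. -/
def Cmd.regs : Cmd → List ℕ
  | .skip => []
  | .setReg x _ => [x]
  | .setMem _ _ _ _ => []
  | .sample _ _ _ => []
  | .seq p q => p.regs ++ q.regs
  | .ifLe _ _ p q => p.regs ++ q.regs
  | .loop x _ p => x :: p.regs

/-- The arrays written by a program. -/
def Cmd.arrs : Cmd → List ℕ
  | .skip => []
  | .setReg _ _ => []
  | .setMem a _ _ _ => [a]
  | .sample a _ _ => [a]
  | .seq p q => p.arrs ++ q.arrs
  | .ifLe _ _ p q => p.arrs ++ q.arrs
  | .loop _ _ p => p.arrs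

/-- The registers on which the numbers of iterations of the loops of a program depend. -/
def Cmd.loopRegs : Cmd → List ℕ
  | .skip => []
  | .setReg _ _ => []
  | .setMem _ _ _ _ => []
  | .sample _ _ _ => []
  | .seq p q => p.loopRegs ++ q.loopRegs
  | .ifLe _ _ p q => p.loopRegs ++ q.loopRegs
  | .loop _ e p => e.regs ++ p.loopRegs

/-- A bound for the running time if the registers controlling the loops are at most `L`. -/
def Cmd.cost (L : ℕ) : Cmd → ℕ
  | .skip => 1
  | .setReg _ e => e.size + 1
  | .setMem _ i j e => i.size + j.size + e.size + 1
  | .sample _ i j => i.size + j.size + 1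
  | .seq p q => p.cost L + q.cost L
  | .ifLe e f p q => (e.size + f.size + 1) + (p.cost L + q.cost L)
  | .loop _ e p => (e.size + 1) + e.bound L * (p.cost L + 1)

/-- The cost is a polynomial in L with coefficients fixed by the program. From L = 2 on, constants,
sums and products are absorbed into the exponent, which therefore does not depend on the input. -/
theorem Cmd.cost_le_pow (p : Cmd) : ∃ a, ∀ L, 2 ≤ L → p.cost L ≤ L ^ a := by
  induction p with
  | skip => exact ⟨0, fun L _ => by simp [Cmd.cost]⟩
  | setReg x e => exact ⟨_, fun L hL => le_two_pow_of_le hL⟩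
  | setMem a i j e => exact ⟨_, fun L hL => le_two_pow_of_le hL⟩
  | sample a i j => exact ⟨_, fun L hL => le_two_pow_of_le hL⟩
  | seq p q hp hq =>
    obtain ⟨a, ha⟩ := hp
    obtain ⟨b, hb⟩ := hq
    exact ⟨a + b + 1, fun L hL => (add_le_add (ha L hL) (hb L hL)).trans (pow_add_pow_le hL)⟩
  | ifLe e f p q hp hq =>
    obtain ⟨a, ha⟩ := hp
    obtain ⟨b, hb⟩ := hq
    refine ⟨(e.size + f.size + 1) + (a + b + 1) + 1, fun L hL => ?_⟩
    exact (add_le_add (le_two_pow_of_le hL)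
      ((add_le_add (ha L hL) (hb L hL)).trans (pow_add_pow_le hL))).trans (pow_add_pow_le hL)
  | loop x e p hp =>
    obtain ⟨a, ha⟩ := hp
    obtain ⟨b, hb⟩ := e.bound_le_pow
    refine ⟨(e.size + 1) + (b + (a + 0 + 1)) + 1, fun L hL => ?_⟩
    refine (add_le_add (le_two_pow_of_le hL) ?_).trans (pow_add_pow_le hL)
    rw [pow_add]
    exact Nat.mul_le_mul (hb L hL)
      ((add_le_add (ha L hL) (pow_zero L).ge).trans (pow_add_pow_le hL))

/-- Two states agree on the registers outside `rs` and on the arrays outside `as`. -/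
def Agree (rs as : List ℕ) (s s' : State) : Prop :=
  (∀ x, x ∉ rs → s'.reg x = s.reg x) ∧ ∀ a, a ∉ as → s'.mem a = s.mem a

theorem Agree.refl (rs as : List ℕ) (s : State) : Agree rs as s s :=
  ⟨fun _ _ => rfl, fun _ _ => rfl⟩

theorem Agree.trans {rs as : List ℕ} {s s' s'' : State} (h : Agree rs as s s')
    (h' : Agree rs as s' s'') : Agree rs as s s'' :=
  ⟨fun x hx => (h'.1 x hx).trans (h.1 x hx), fun a ha => (h'.2 a ha).trans (h.2 a ha)⟩

theorem Agree.mono {rs as rs' as' : List ℕ} {s s' : State} (h : Agree rs as s s')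
    (hr : rs ⊆ rs') (ha : as ⊆ as') : Agree rs' as' s s' :=
  ⟨fun x hx => h.1 x fun hx' => hx (hr hx'), fun a h' => h.2 a fun h'' => h' (ha h'')⟩

theorem Agree.setReg_tick {rs as : List ℕ} {s : State} {x v c : ℕ} (hx : x ∈ rs) :
    Agree rs as s ((s.setReg x v).tick c) :=
  ⟨fun y hy => by
    simp [Function.update_of_ne (fun h => hy (h ▸ hx) : y ≠ x)], fun _ _ => rfl⟩

theorem Agree.setMem {rs as : List ℕ} {s : State} {a i j : ℕ} {v : ℝ} (ha : a ∈ as) :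
    Agree rs as s (s.setMem a i j v) := by
  refine ⟨fun _ _ => rfl, fun b hb => ?_⟩
  have : b ≠ a := fun h => hb (h ▸ ha)
  funext i' j'
  simp [State.setMem_mem, this]

/-- Invariant rule. The number of rounds is evaluated once, on entry, so the induction is on a fixed
number even if the body changes the registers in `e`. -/
theorem Cmd.run_loop_of_eval_eq {ω : ℕ → ℝ} {x : ℕ} {e : NExp} {p : Cmd} {s : State}
    (I : ℕ → State → Prop) (h0 : I 0 (s.tick (e.size + 1)))
    (hs : ∀ i < e.eval s, ∀ s', I i s' → I (i + 1) (p.run ω ((s'.setReg x i).tick 1))) :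
    I (e.eval s) ((Cmd.loop x e p).run ω s) := by
  simp only [Cmd.run]
  generalize e.eval s = n at hs ⊢
  induction n with
  | zero => exact h0
  | succ n ih => exact hs n (Nat.lt_succ_self n) _ (ih fun i hi => hs i (hi.trans (Nat.lt_succ_self n)))

/-- Frame rule: a run changes only what the program text names as a target. Afterwards the
persistence of a register or an array reduces to a decidable list membership. -/
theorem Cmd.agree_run (p : Cmd) (ω : ℕ → ℝ) (s : State) : Agree p.regs p.arrs s (p.run ω s) := by
  induction p generalizing s with
  | skip => exact ⟨fun _ _ => rfl, fun _ _ => rfl⟩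
  | setReg x e => exact Agree.setReg_tick (by simp [Cmd.regs])
  | setMem a i j e =>
    have := Agree.setMem (rs := []) (s := s) (i := i.eval s) (j := j.eval s) (v := e.eval s)
      (List.mem_singleton_self a)
    exact this
  | sample a i j =>
    have := Agree.setMem (rs := []) (s := s) (i := i.eval s) (j := j.eval s) (v := ω s.pos)
      (List.mem_singleton_self a)
    exact this
  | seq p q hp hq =>
    exact ((hp s).mono (by simp [Cmd.regs]) (by simp [Cmd.arrs])).trans
      ((hq _).mono (by simp [Cmd.regs]) (by simp [Cmd.arrs]))
  | ifLe e f p q hp hq =>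
    simp only [Cmd.run]
    split_ifs
    · exact ((hp (s.tick _)).mono (by simp [Cmd.regs]) (by simp [Cmd.arrs]))
    · exact ((hq (s.tick _)).mono (by simp [Cmd.regs]) (by simp [Cmd.arrs]))
  | loop x e p hp =>
    refine Cmd.run_loop_of_eval_eq (fun _ s' => Agree (x :: p.regs) p.arrs s s')
      (Agree.refl _ _ _) fun i _ s' h => ?_
    exact (h.trans (Agree.setReg_tick (by simp))).trans ((hp _).mono (by simp) (by simp))

theorem Cmd.reg_run {p : Cmd} {ω : ℕ → ℝ} {s : State} {x : ℕ} (h : x ∉ p.regs) :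
    (p.run ω s).reg x = s.reg x := (p.agree_run ω s).1 x h

theorem Cmd.mem_run {p : Cmd} {ω : ℕ → ℝ} {s : State} {a : ℕ} (h : a ∉ p.arrs) :
    (p.run ω s).mem a = s.mem a := (p.agree_run ω s).2 a h

/-- Induction over the iterations of a loop, with the frame of the loop at hand. -/
theorem Cmd.run_loop_induct {ω : ℕ → ℝ} {x : ℕ} {e : NExp} {p : Cmd} {s : State} {n : ℕ}
    (hn : e.eval s = n) (I : ℕ → State → Prop) (h0 : I 0 (s.tick (e.size + 1)))
    (hs : ∀ i < n, ∀ s', Agree (x :: p.regs) p.arrs s s' → I i s' →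
      I (i + 1) (p.run ω ((s'.setReg x i).tick 1))) :
    I n ((Cmd.loop x e p).run ω s) := by
  subst hn
  refine (Cmd.run_loop_of_eval_eq (fun i s' => Agree (x :: p.regs) p.arrs s s' ∧ I i s')
    ⟨Agree.refl _ _ _, h0⟩ fun i hi s' h => ⟨?_, hs i hi s' h.1 h.2⟩).2
  exact (h.1.trans (Agree.setReg_tick (by simp))).trans ((p.agree_run ω _).mono (by simp) (by simp))

/-- If no register that controls a loop is ever written, all numbers of rounds can be bounded from
the initial state. A program that computes its own loop bounds must be cut into pieces before this
applies. -/
theorem Cmd.time_run_le (p : Cmd) (ω : ℕ → ℝ) (s : State) (L : ℕ)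
    (hd : ∀ r ∈ p.loopRegs, r ∉ p.regs) (hL : ∀ r ∈ p.loopRegs, s.reg r ≤ L) :
    (p.run ω s).time ≤ s.time + p.cost L := by
  induction p generalizing s with
  | skip => simp [Cmd.run, Cmd.cost]
  | setReg x e => simp [Cmd.run, Cmd.cost]
  | setMem a i j e => simp [Cmd.run, Cmd.cost]
  | sample a i j => simp [Cmd.run, Cmd.cost]
  | seq p q hp hq =>
    simp only [Cmd.loopRegs, Cmd.regs, List.mem_append, not_or] at hd hL
    have h1 := hp s (fun r hr => (hd r (Or.inl hr)).1) (fun r hr => hL r (Or.inl hr))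
    have h2 := hq (p.run ω s) (fun r hr => (hd r (Or.inr hr)).2) (fun r hr => by
      rw [Cmd.reg_run (hd r (Or.inr hr)).1]; exact hL r (Or.inr hr))
    simp only [Cmd.run, Cmd.cost]
    omega
  | ifLe e f p q hp hq =>
    simp only [Cmd.loopRegs, Cmd.regs, List.mem_append, not_or] at hd hL
    simp only [Cmd.run, Cmd.cost]
    split_ifs
    · have h1 := hp (s.tick (e.size + f.size + 1)) (fun r hr => (hd r (Or.inl hr)).1)
        (fun r hr => hL r (Or.inl hr))
      simp only [State.tick_time] at h1
      omega
    · have h1 := hq (s.tick (e.size + f.size + 1)) (fun r hr => (hd r (Or.inr hr)).2)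
        (fun r hr => hL r (Or.inr hr))
      simp only [State.tick_time] at h1
      omega
  | loop x e p hp =>
    simp only [Cmd.loopRegs, Cmd.regs, List.mem_append, List.mem_cons, not_or] at hd hL
    have hb : e.eval s ≤ e.bound L := e.eval_le_bound fun r hr => hL r (Or.inl hr)
    have key : ((Cmd.loop x e p).run ω s).time
        ≤ s.time + (e.size + 1) + e.eval s * (p.cost L + 1) := by
      refine Cmd.run_loop_induct (x := x) (p := p) rfl
        (fun i s' => s'.time ≤ s.time + (e.size + 1) + i * (p.cost L + 1)) (by simp) ?_
      intro i _ s' hA hi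
      have h1 := hp ((s'.setReg x i).tick 1) (fun r hr => (hd r (Or.inr hr)).2) (fun r hr => by
        have hr' := hd r (Or.inr hr)
        have h2 : s'.reg r = s.reg r := hA.1 r (by simp [hr'.1, hr'.2])
        simp only [State.tick_reg, State.setReg_reg, Function.update_of_ne hr'.1, h2]
        exact hL r (Or.inr hr))
      simp only [State.tick_time, State.setReg_time] at h1
      rw [Nat.add_mul, one_mul]
      omega
    simp only [Cmd.cost]
    have := Nat.mul_le_mul_right (p.cost L + 1) hb
    omega

end BDDLasso
end

noncomputable section

namespace BDDLasso

/-! ### Filling an array with sums -/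

/-- Put `∑ u < nl, e` into the cell `(off + i, j)` of array `a`, for all `i < nx` and `j < ny`; here
`i`, `j`, `u` are the values of the registers `20`, `21`, `22`. -/
def sumFill (a : ℕ) (off nx ny nl : NExp) (e : RExp) : Cmd :=
  .loop 20 nx (.loop 21 ny (.seq
    (.setMem a (off.add (.reg 20)) (.reg 21) (.nat (.lit 0)))
    (.loop 22 nl (.setMem a (off.add (.reg 20)) (.reg 21)
      (.add (.get a (off.add (.reg 20)) (.reg 21)) e)))))

/-- Three nested invariants: finished rows, finished cells of the current row, partial sum in the
current cell. By `hf` the summand has the same value in all states that differ from `s` only in the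
other registers `20`–`22` and in array `a`, so it does not depend on the array being filled. Cells
outside the rectangle keep their content, which permits filling an array block by block. -/
theorem sumFill_spec {a : ℕ} {off nx ny nl : NExp} {e : RExp} {ω : ℕ → ℝ} {s : State}
    (p q r b : ℕ) (hr : ∀ x ∈ off.regs ++ nx.regs ++ ny.regs ++ nl.regs, x < 20)
    (hb : off.eval s = b) (hp : nx.eval s = p) (hq : ny.eval s = q) (hl : nl.eval s = r)
    (f : ℕ → ℕ → ℕ → ℝ)
    (hf : ∀ s', Agree [20, 21, 22] [a] s s' → s'.reg 20 < p → s'.reg 21 < q → s'.reg 22 < r →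
      e.eval s' = f (s'.reg 20) (s'.reg 21) (s'.reg 22)) (i j : ℕ) :
    ((sumFill a off nx ny nl e).run ω s).mem a i j =
      if b ≤ i ∧ i < b + p ∧ j < q then ∑ u ∈ Finset.range r, f (i - b) j u else s.mem a i j := by
  have hcong : ∀ (E : NExp), E.regs ⊆ off.regs ++ nx.regs ++ ny.regs ++ nl.regs → ∀ s',
      Agree [20, 21, 22] [a] s s' → E.eval s' = E.eval s := fun E hE s' hA =>
    E.eval_congr fun x hx => hA.1 x (by
      have := hr x (hE hx)
      simp only [List.mem_cons, List.not_mem_nil, or_false]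
      omega)
  have main := Cmd.run_loop_induct (ω := ω) (x := 20)
    (p := (.loop 21 ny (.seq
      (.setMem a (off.add (.reg 20)) (.reg 21) (.nat (.lit 0)))
      (.loop 22 nl (.setMem a (off.add (.reg 20)) (.reg 21)
        (.add (.get a (off.add (.reg 20)) (.reg 21)) e)))))) hp
    (fun x s' => ∀ i j, s'.mem a i j = if b ≤ i ∧ i < b + x ∧ j < q then
      ∑ u ∈ Finset.range r, f (i - b) j u else s.mem a i j)
    (fun i j => by rw [if_neg (by omega)]; rfl) ?_
  · exact main i j
  intro x hx s1 hA1 h1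
  replace hA1 : Agree [20, 21, 22] [a] s s1 :=
    hA1.mono (by simp [Cmd.regs]) (by simp [Cmd.arrs])
  have hA2 : Agree [20, 21, 22] [a] s ((s1.setReg 20 x).tick 1) :=
    hA1.trans (Agree.setReg_tick (by simp))
  have hx2 : ((s1.setReg 20 x).tick 1).reg 20 = x := by simp
  have hm2 : ((s1.setReg 20 x).tick 1).mem = s1.mem := rfl
  generalize (s1.setReg 20 x).tick 1 = s2 at hA2 hx2 hm2
  have main := Cmd.run_loop_induct (ω := ω) (x := 21) (s := s2)
    (p := (.seq
      (.setMem a (off.add (.reg 20)) (.reg 21) (.nat (.lit 0)))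
      (.loop 22 nl (.setMem a (off.add (.reg 20)) (.reg 21)
        (.add (.get a (off.add (.reg 20)) (.reg 21)) e)))))
    (((hcong ny (by intro; simp; tauto) s2 hA2)).trans hq)
    (fun y s' => ∀ i j, s'.mem a i j = if i = b + x ∧ j < y then
      ∑ u ∈ Finset.range r, f (i - b) j u else s1.mem a i j)
    (fun i j => by rw [if_neg (by omega), ← hm2]; rfl) ?_
  · intro i j
    rw [main i j, h1 i j]
    by_cases h : b ≤ i ∧ i < b + x ∧ j < q
    · rw [if_neg (by omega), if_pos h, if_pos (by omega)]
    · rw [if_neg h]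
      by_cases h' : i = b + x ∧ j < q
      · rw [if_pos h', if_pos (by omega)]
      · rw [if_neg h', if_neg (by omega)]
  intro y hy s3 hA3 h3
  have hx3 : s3.reg 20 = x := (hA3.1 20 (by simp [Cmd.regs])).trans hx2
  replace hA3 : Agree [20, 21, 22] [a] s s3 :=
    hA2.trans (hA3.mono (by simp [Cmd.regs]) (by simp [Cmd.arrs]))
  have hA4 : Agree [20, 21, 22] [a] s ((s3.setReg 21 y).tick 1) :=
    hA3.trans (Agree.setReg_tick (by simp))
  have hx4 : ((s3.setReg 21 y).tick 1).reg 20 = x := by simpa using hx3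
  have hy4 : ((s3.setReg 21 y).tick 1).reg 21 = y := by simp
  have hm4 : ((s3.setReg 21 y).tick 1).mem = s3.mem := rfl
  generalize (s3.setReg 21 y).tick 1 = s4 at hA4 hx4 hy4 hm4
  rw [Cmd.run]
  have hoff : ∀ s', Agree [20, 21, 22] [a] s s' → off.eval s' = b := fun s' h =>
    (hcong off (by intro; simp; tauto) s' h).trans hb
  have hA5 : Agree [20, 21, 22] [a] s
      ((Cmd.setMem a (off.add (.reg 20)) (.reg 21) (.nat (.lit 0))).run ω s4) :=
    hA4.trans ((Cmd.agree_run _ _ _).mono (by simp [Cmd.regs]) (by simp [Cmd.arrs]))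
  have hm5 : ∀ i j, ((Cmd.setMem a (off.add (.reg 20)) (.reg 21) (.nat (.lit 0))).run ω s4).mem a i j
      = if i = b + x ∧ j = y then 0 else s3.mem a i j := by
    intro i j
    simp [Cmd.run, State.setMem_mem, NExp.eval, RExp.eval, hx4, hy4, hoff s4 hA4, hm4]
  have hx5 : ((Cmd.setMem a (off.add (.reg 20)) (.reg 21) (.nat (.lit 0))).run ω s4).reg 20 = x :=
    hx4
  have hy5 : ((Cmd.setMem a (off.add (.reg 20)) (.reg 21) (.nat (.lit 0))).run ω s4).reg 21 = y :=
    hy4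
  generalize (Cmd.setMem a (off.add (.reg 20)) (.reg 21) (.nat (.lit 0))).run ω s4 = s5
    at hA5 hm5 hx5 hy5
  have main := Cmd.run_loop_induct (ω := ω) (x := 22) (s := s5)
    (p := .setMem a (off.add (.reg 20)) (.reg 21)
        (.add (.get a (off.add (.reg 20)) (.reg 21)) e))
    ((hcong nl (by intro; simp; tauto) s5 hA5).trans hl)
    (fun z s' => ∀ i j, s'.mem a i j = if i = b + x ∧ j = y then
      ∑ u ∈ Finset.range z, f x y u else s3.mem a i j)
    (fun i j => by simpa using hm5 i j) ?_
  · intro i j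
    rw [main i j, h3 i j]
    by_cases h : i = b + x ∧ j = y
    · obtain ⟨rfl, rfl⟩ := h
      rw [if_pos ⟨rfl, rfl⟩, if_pos (by omega), Nat.add_sub_cancel_left]
    · rw [if_neg h]
      by_cases h' : i = b + x ∧ j < y
      · rw [if_pos h', if_pos (by omega)]
      · rw [if_neg h', if_neg (by omega)]
  intro z hz s6 hA6 h6 i j
  have hx6 : s6.reg 20 = x := (hA6.1 20 (by simp [Cmd.regs])).trans hx5
  have hy6 : s6.reg 21 = y := (hA6.1 21 (by simp [Cmd.regs])).trans hy5
  replace hA6 : Agree [20, 21, 22] [a] s s6 :=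
    hA5.trans (hA6.mono (by simp [Cmd.regs]) (by simp [Cmd.arrs]))
  have hA7 : Agree [20, 21, 22] [a] s ((s6.setReg 22 z).tick 1) :=
    hA6.trans (Agree.setReg_tick (by simp))
  have hx7 : ((s6.setReg 22 z).tick 1).reg 20 = x := by simpa using hx6
  have hy7 : ((s6.setReg 22 z).tick 1).reg 21 = y := by simpa using hy6
  have hz7 : ((s6.setReg 22 z).tick 1).reg 22 = z := by simp
  have hm7 : ((s6.setReg 22 z).tick 1).mem = s6.mem := rfl
  generalize (s6.setReg 22 z).tick 1 = s7 at hA7 hx7 hy7 hz7 hm7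
  have he := hf s7 hA7 (by omega) (by omega) (by omega)
  rw [hx7, hy7, hz7] at he
  simp only [Cmd.run, State.tick_mem, State.setMem_mem, NExp.eval, RExp.eval, hx7, hy7,
    hoff s7 hA7, hm7, true_and, h6, he, Finset.sum_range_succ]
  by_cases h : i = b + x ∧ j = y <;> simp [h]

/-- The leading `p × q` part of an array. -/
def State.mat (s : State) (a p q : ℕ) : Matrix (Fin p) (Fin q) ℝ := fun i j => s.mem a i j

theorem sumFill_mat {a : ℕ} {off nx ny nl : NExp} {e : RExp} {ω : ℕ → ℝ} {s : State}
    (p q r : ℕ) (hr : ∀ x ∈ off.regs ++ nx.regs ++ ny.regs ++ nl.regs, x < 20)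
    (hb : off.eval s = 0) (hp : nx.eval s = p) (hq : ny.eval s = q) (hl : nl.eval s = r)
    (f : ℕ → ℕ → ℕ → ℝ)
    (hf : ∀ s', Agree [20, 21, 22] [a] s s' → s'.reg 20 < p → s'.reg 21 < q → s'.reg 22 < r →
      e.eval s' = f (s'.reg 20) (s'.reg 21) (s'.reg 22)) :
    ((sumFill a off nx ny nl e).run ω s).mat a p q =
      fun (i : Fin p) (j : Fin q) => ∑ u : Fin r, f i j u := by
  funext i j
  rw [State.mat, sumFill_spec p q r 0 hr hb hp hq hl f hf, if_pos (by omega), Finset.sum_range]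
  rfl

end BDDLasso
end

noncomputable section

namespace BDDLasso

theorem Cmd.run_seq (ω : ℕ → ℝ) (p q : Cmd) (s : State) :
    (Cmd.seq p q).run ω s = q.run ω (p.run ω s) := rfl

/-! ### Parameters and gadget matrices -/

/-- Register `5` becomes `m - k`, register `3` becomes `d / k`. -/
def setupDiv : Cmd :=
  .seq (.setReg 5 (.sub (.reg 2) (.reg 1))) (.seq (.setReg 3 (.lit 0)) (.seq (.setReg 10 (.lit 0))
    (.loop 6 (.reg 0) (.seq (.setReg 10 (.add (.reg 10) (.reg 1)))
      (.setReg 3 (.add (.reg 3) (.sub (.lit 1) (.sub (.reg 10) (.reg 0)))))))))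

theorem setupDiv_reg_five (ω : ℕ → ℝ) (s : State) :
    (setupDiv.run ω s).reg 5 = s.reg 2 - s.reg 1 := by
  rw [setupDiv, Cmd.run_seq, Cmd.reg_run (by decide)]
  simp [Cmd.run, NExp.eval]

/-- Registers cannot be divided by k directly, so the multiples of k that are at most d are counted.
The truncated difference 1 - (qk - d) is the indicator of qk ≤ d, the count after q rounds is min q
(d/k), and d rounds suffice. -/
theorem setupDiv_reg_three (ω : ℕ → ℝ) (s : State) (hk : 0 < s.reg 1) :
    (setupDiv.run ω s).reg 3 = s.reg 0 / s.reg 1 := by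
  rw [setupDiv, Cmd.run_seq, Cmd.run_seq, Cmd.run_seq]
  set s1 := (Cmd.setReg 10 (.lit 0)).run ω ((Cmd.setReg 3 (.lit 0)).run ω
    ((Cmd.setReg 5 (.sub (.reg 2) (.reg 1))).run ω s)) with hs1
  have h0 : s1.reg 0 = s.reg 0 := by simp [hs1, Cmd.run]
  have h1 : s1.reg 1 = s.reg 1 := by simp [hs1, Cmd.run]
  have main := Cmd.run_loop_induct (ω := ω) (x := 6) (e := .reg 0) (s := s1)
    (p := .seq (.setReg 10 (.add (.reg 10) (.reg 1)))
      (.setReg 3 (.add (.reg 3) (.sub (.lit 1) (.sub (.reg 10) (.reg 0)))))) h0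
    (fun q s' => s'.reg 10 = q * s.reg 1 ∧ s'.reg 3 = min q (s.reg 0 / s.reg 1))
    (by simp [hs1, Cmd.run, NExp.eval]) ?_
  · rw [main.2, min_eq_right (Nat.div_le_self _ _)]
  intro q hq s' hA ⟨h10, h3⟩
  have h0' : s'.reg 0 = s.reg 0 := (hA.1 0 (by decide)).trans h0
  have h1' : s'.reg 1 = s.reg 1 := (hA.1 1 (by decide)).trans h1
  have hle := Nat.le_div_iff_mul_le (x := q + 1) (y := s.reg 0) hk
  have e10 : (q + 1) * s.reg 1 = q * s.reg 1 + s.reg 1 := by ring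
  simp [Cmd.run, NExp.eval, h10, h3, h0', h1', e10]
  rw [e10] at hle
  omega

/-- Register `4` becomes `2 ^ N`, where register `3` holds `N`. -/
def setupPow : Cmd :=
  .seq (.setReg 4 (.lit 1)) (.loop 6 (.reg 3) (.setReg 4 (.add (.reg 4) (.reg 4))))

theorem setupPow_reg_four (ω : ℕ → ℝ) (s : State) : (setupPow.run ω s).reg 4 = 2 ^ s.reg 3 := by
  rw [setupPow, Cmd.run_seq]
  refine Cmd.run_loop_induct (n := s.reg 3) (by simp [Cmd.run, NExp.eval])
    (fun q s' => s'.reg 4 = 2 ^ q) (by simp [Cmd.run, NExp.eval]) ?_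
  intro q _ s' _ h
  simp [Cmd.run, NExp.eval, h, pow_succ]
  ring

/-- Register `9` becomes `k * P`, where the registers `1` and `4` hold `k` and `P`. -/
def setupMul : Cmd :=
  .seq (.setReg 9 (.lit 0)) (.loop 6 (.reg 1) (.setReg 9 (.add (.reg 9) (.reg 4))))

theorem setupMul_reg_nine (ω : ℕ → ℝ) (s : State) :
    (setupMul.run ω s).reg 9 = s.reg 1 * s.reg 4 := by
  rw [setupMul, Cmd.run_seq]
  refine Cmd.run_loop_induct (n := s.reg 1) (by simp [Cmd.run, NExp.eval])
    (fun q s' => s'.reg 9 = q * s.reg 4) (by simp [Cmd.run, NExp.eval]) ?_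
  intro q _ s' hA h
  have h4 : s'.reg 4 = s.reg 4 := (hA.1 4 (by decide)).trans (by simp [Cmd.run])
  simp [Cmd.run, NExp.eval, h, h4]
  ring

/-- The lowest bit of register `14`. -/
def lowBit : NExp := .sub (.reg 14) (.add (.half (.reg 14)) (.half (.reg 14)))

/-- One column of the sign gadget, from the binary digits of register `14`. -/
def gadgetColumn : Cmd :=
  .loop 8 (.reg 3) (.seq
    (.setMem 12 (.add (.reg 11) (.reg 8)) (.reg 10)
      (.sub (.nat (.add lowBit lowBit)) (.nat (.lit 1))))
    (.setReg 14 (.half (.reg 14))))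

/-- One block of columns of both gadgets. -/
def gadgetBlock : Cmd :=
  .loop 7 (.reg 4) (.seq (.setReg 14 (.reg 7)) (.seq
    (.setMem 13 (.reg 6) (.reg 10) (.nat (.lit 1))) (.seq gadgetColumn
    (.setReg 10 (.add (.reg 10) (.lit 1))))))

/-- Write the matrix `G_sparse` into array `12` and `G_partite` into array `13`. -/
def gadget : Cmd :=
  .seq (.setReg 10 (.lit 0)) (.seq (.setReg 11 (.lit 0))
    (.loop 6 (.reg 1) (.seq gadgetBlock (.setReg 11 (.add (.reg 11) (.reg 3))))))

/-- Register `14` is halved in every round, so its lowest bit in round r is bit r of the column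
number. The sign written is twice this bit minus one. -/
theorem gadgetColumn_mem (ω : ℕ → ℝ) (s : State) (i j : ℕ) :
    (gadgetColumn.run ω s).mem 12 i j =
      if j = s.reg 10 ∧ s.reg 11 ≤ i ∧ i < s.reg 11 + s.reg 3 then
        (if (s.reg 14).testBit (i - s.reg 11) then 1 else -1) else s.mem 12 i j := by
  have main := Cmd.run_loop_induct (ω := ω) (x := 8) (e := .reg 3) (s := s)
    (p := .seq
    (.setMem 12 (.add (.reg 11) (.reg 8)) (.reg 10)
      (.sub (.nat (.add lowBit lowBit)) (.nat (.lit 1))))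
    (.setReg 14 (.half (.reg 14)))) rfl
    (fun r s' => s'.reg 14 = s.reg 14 / 2 ^ r ∧ ∀ i j, s'.mem 12 i j =
      if j = s.reg 10 ∧ s.reg 11 ≤ i ∧ i < s.reg 11 + r then
        (if (s.reg 14).testBit (i - s.reg 11) then 1 else -1) else s.mem 12 i j)
    ⟨by simp, fun i j => by rw [if_neg (by omega)]; rfl⟩ ?_
  · exact main.2 i j
  intro r hr s' hA ⟨h14, hm⟩
  have h10 : s'.reg 10 = s.reg 10 := hA.1 10 (by decide)
  have h11 : s'.reg 11 = s.reg 11 := hA.1 11 (by decide)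
  refine ⟨by simp [Cmd.run, NExp.eval, h14, pow_succ, Nat.div_div_eq_div_mul], fun i j => ?_⟩
  have hbit : (s.reg 14).testBit r = decide (s.reg 14 / 2 ^ r % 2 = 1) :=
    Nat.testBit_eq_decide_div_mod_eq
  simp only [Cmd.run, State.tick_mem, State.setReg_mem, State.setMem_mem, lowBit, NExp.eval,
    RExp.eval, State.tick_reg, State.setReg_reg, Function.update_self, hm, h10, h11, h14,
    Function.update_of_ne (show (11 : ℕ) ≠ 8 by decide),
    Function.update_of_ne (show (10 : ℕ) ≠ 8 by decide),
    Function.update_of_ne (show (14 : ℕ) ≠ 8 by decide), true_and]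
  by_cases h : i = s.reg 11 + r ∧ j = s.reg 10
  · obtain ⟨rfl, rfl⟩ := h
    rw [if_pos ⟨rfl, rfl⟩, if_pos (by omega), Nat.add_sub_cancel_left, hbit]
    rcases Nat.mod_two_eq_zero_or_one (s.reg 14 / 2 ^ r) with h | h
    · have : s.reg 14 / 2 ^ r - (s.reg 14 / 2 ^ r / 2 + s.reg 14 / 2 ^ r / 2) = 0 := by omega
      simp [this, h]
    · have : s.reg 14 / 2 ^ r - (s.reg 14 / 2 ^ r / 2 + s.reg 14 / 2 ^ r / 2) = 1 := by omega
      simp [this, h]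
      norm_num
  · rw [if_neg h]
    by_cases h' : j = s.reg 10 ∧ s.reg 11 ≤ i ∧ i < s.reg 11 + r
    · rw [if_pos h',
        if_pos (show j = s.reg 10 ∧ s.reg 11 ≤ i ∧ i < s.reg 11 + (r + 1) by omega)]
    · rw [if_neg h', if_neg (by omega)]

/-- The entries of the first `n` columns of `G_sparse`. -/
def gadgetEntry (N P n i j : ℕ) : ℝ :=
  if j < n ∧ i / N = j / P then (if (j % P).testBit (i % N) then 1 else -1) else 0

/-- Appending column c of block b changes only that column, and in it only the N rows of the block,
exactly the cells that `gadgetColumn` writes. -/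
theorem gadgetEntry_succ {N P b c : ℕ} (hN : 0 < N) (hc : c < P) (i j : ℕ) :
    gadgetEntry N P (b * P + (c + 1)) i j = if j = b * P + c ∧ b * N ≤ i ∧ i < b * N + N then
      (if c.testBit (i - b * N) then 1 else -1) else gadgetEntry N P (b * P + c) i j := by
  have hi : i / N = b ↔ b * N ≤ i ∧ i < b * N + N := by
    rw [Nat.div_eq_iff hN, Nat.lt_iff_le_pred (by omega : 0 < b * N + N)]
  have hj : j = b * P + c → j / P = b ∧ j % P = c := by
    rintro rfl
    rw [Nat.mul_comm b P]
    refine ⟨?_, ?_⟩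
    · rw [Nat.mul_add_div (by omega), Nat.div_eq_of_lt hc, add_zero]
    · rw [Nat.mul_add_mod, Nat.mod_eq_of_lt hc]
  unfold gadgetEntry
  by_cases h : j = b * P + c
  · obtain ⟨h1, h2⟩ := hj h
    simp only [h1, h2, hi]
    by_cases h3 : b * N ≤ i ∧ i < b * N + N
    · have h4 : i % N = i - b * N := by
        have := Nat.div_add_mod i N
        rw [hi.2 h3, Nat.mul_comm] at this
        omega
      rw [if_pos (show j < b * P + (c + 1) ∧ b * N ≤ i ∧ i < b * N + N from ⟨by omega, h3⟩),
        if_pos (show j = b * P + c ∧ b * N ≤ i ∧ i < b * N + N from ⟨h, h3⟩), h4]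
    · rw [if_neg (fun h' => h3 h'.2), if_neg (fun h' => h3 h'.2), if_neg (fun h' => h3 h'.2)]
  · rw [if_neg (fun h' : j = b * P + c ∧ _ => h h'.1)]
    have : j < b * P + (c + 1) ↔ j < b * P + c := by omega
    simp only [this]

theorem gadgetBlock_spec (ω : ℕ → ℝ) (s : State) {b N P : ℕ} (hN : 0 < N) (h3 : s.reg 3 = N)
    (h4 : s.reg 4 = P) (h6 : s.reg 6 = b) (h10 : s.reg 10 = b * P) (h11 : s.reg 11 = b * N)
    (h12 : ∀ i j, s.mem 12 i j = gadgetEntry N P (b * P) i j)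
    (h13 : ∀ i j, s.mem 13 i j = if j < b * P ∧ i = j / P then 1 else 0) :
    (gadgetBlock.run ω s).reg 10 = b * P + P ∧
    (∀ i j, (gadgetBlock.run ω s).mem 12 i j = gadgetEntry N P (b * P + P) i j) ∧
    ∀ i j, (gadgetBlock.run ω s).mem 13 i j = if j < b * P + P ∧ i = j / P then 1 else 0 := by
  refine Cmd.run_loop_induct (ω := ω) (x := 7) (e := .reg 4) (s := s) h4
    (fun c s' => s'.reg 10 = b * P + c ∧
      (∀ i j, s'.mem 12 i j = gadgetEntry N P (b * P + c) i j) ∧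
      ∀ i j, s'.mem 13 i j = if j < b * P + c ∧ i = j / P then 1 else 0)
    ⟨h10, h12, h13⟩ ?_
  intro c hc s1 hA ⟨k10, k12, k13⟩
  have k3 : s1.reg 3 = N := (hA.1 3 (by decide)).trans h3
  have k6 : s1.reg 6 = b := (hA.1 6 (by decide)).trans h6
  have k11 : s1.reg 11 = b * N := (hA.1 11 (by decide)).trans h11
  rw [Cmd.run_seq, Cmd.run_seq, Cmd.run_seq]
  set s2 := (Cmd.setReg 14 (.reg 7)).run ω ((s1.setReg 7 c).tick 1) with hs2
  have l14 : s2.reg 14 = c := by simp [hs2, Cmd.run, NExp.eval]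
  have l10 : s2.reg 10 = b * P + c := by simp [hs2, Cmd.run, k10]
  have l3 : s2.reg 3 = N := by simp [hs2, Cmd.run, k3]
  have l6 : s2.reg 6 = b := by simp [hs2, Cmd.run, k6]
  have l11 : s2.reg 11 = b * N := by simp [hs2, Cmd.run, k11]
  have lm : s2.mem = s1.mem := rfl
  clear_value s2
  set s3 := (Cmd.setMem 13 (.reg 6) (.reg 10) (.nat (.lit 1))).run ω s2 with hs3
  have e3 : s3.reg = s2.reg := rfl
  have m13 : ∀ i j, s3.mem 13 i j = if i = b ∧ j = b * P + c then 1 else s1.mem 13 i j := by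
    intro i j
    simp [hs3, Cmd.run, State.setMem_mem, NExp.eval, RExp.eval, l6, l10, lm]
  have m12 : s3.mem 12 = s1.mem 12 := by
    rw [hs3, Cmd.mem_run (by decide), lm]
  clear_value s3
  refine ⟨?_, fun i j => ?_, fun i j => ?_⟩
  · rw [Cmd.run]
    simp only [NExp.eval, State.tick_reg, State.setReg_reg, Function.update_self]
    rw [Cmd.reg_run (by decide), e3, l10]
    ring
  · rw [Cmd.mem_run (by decide), gadgetColumn_mem, e3, l14, l10, l11, l3, m12, k12,
      gadgetEntry_succ hN hc]
  · rw [Cmd.mem_run (by decide), Cmd.mem_run (by decide), m13, k13]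
    have hj : j = b * P + c → j / P = b := by
      rintro rfl
      rw [Nat.mul_comm b P, Nat.mul_add_div (by omega), Nat.div_eq_of_lt hc, add_zero]
    by_cases h : j = b * P + c
    · have := hj h
      by_cases hi : i = b
      · rw [if_pos ⟨hi, h⟩, if_pos ⟨by omega, by omega⟩]
      · rw [if_neg (fun h' => hi h'.1), if_neg (by omega), if_neg (by omega)]
    · rw [if_neg (fun h' => h h'.2)]
      have : j < b * P + (c + 1) ↔ j < b * P + c := by omega
      simp only [this]

/-- Only entries inside the diagonal blocks are written. The zeros elsewhere come from the initial
memory, whence the hypotheses on arrays `12` and `13`. -/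
theorem gadget_spec (ω : ℕ → ℝ) (s : State) {k N P : ℕ} (hN : 0 < N) (h1 : s.reg 1 = k)
    (h3 : s.reg 3 = N) (h4 : s.reg 4 = P) (h12 : ∀ i j, s.mem 12 i j = 0)
    (h13 : ∀ i j, s.mem 13 i j = 0) :
    (∀ i j, (gadget.run ω s).mem 12 i j = gadgetEntry N P (k * P) i j) ∧
    ∀ i j, (gadget.run ω s).mem 13 i j = if j < k * P ∧ i = j / P then 1 else 0 := by
  rw [gadget, Cmd.run_seq, Cmd.run_seq]
  set s1 := (Cmd.setReg 11 (.lit 0)).run ω ((Cmd.setReg 10 (.lit 0)).run ω s) with hs1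
  have main := Cmd.run_loop_induct (ω := ω) (x := 6) (e := .reg 1) (s := s1) (n := k)
    (p := .seq gadgetBlock (.setReg 11 (.add (.reg 11) (.reg 3))))
    (by simp [hs1, Cmd.run, NExp.eval, h1])
    (fun b s' => s'.reg 10 = b * P ∧ s'.reg 11 = b * N ∧
      (∀ i j, s'.mem 12 i j = gadgetEntry N P (b * P) i j) ∧
      ∀ i j, s'.mem 13 i j = if j < b * P ∧ i = j / P then 1 else 0)
    ⟨by simp [hs1, Cmd.run, NExp.eval], by simp [hs1, Cmd.run, NExp.eval],
      fun i j => by simpa [gadgetEntry, hs1, Cmd.run] using h12 i j,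
      fun i j => by simpa [hs1, Cmd.run] using h13 i j⟩ ?_
  · exact main.2.2
  intro b _ s2 hA ⟨k10, k11, k12, k13⟩
  have k3 : s2.reg 3 = N := (hA.1 3 (by decide)).trans (by simp [hs1, Cmd.run, h3])
  have k4 : s2.reg 4 = P := (hA.1 4 (by decide)).trans (by simp [hs1, Cmd.run, h4])
  obtain ⟨g1, g2, g3⟩ := gadgetBlock_spec ω ((s2.setReg 6 b).tick 1) (b := b) (N := N) (P := P) hN
    (by simpa using k3) (by simpa using k4) (by simp) (by simpa using k10) (by simpa using k11)
    k12 k13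
  have e : (b + 1) * P = b * P + P := by ring
  rw [Cmd.run_seq, e]
  refine ⟨?_, ?_, ?_, ?_⟩
  · rw [Cmd.reg_run (by decide), g1]
  · rw [Cmd.run]
    simp only [NExp.eval, State.tick_reg, State.setReg_reg, Function.update_self]
    rw [Cmd.reg_run (by decide), Cmd.reg_run (by decide)]
    simp [k11, k3]
    ring
  · rw [Cmd.mem_run (by decide)]
    exact g2
  · rw [Cmd.mem_run (by decide)]
    exact g3

end BDDLasso
end

noncomputable section

namespace BDDLasso

/-! ### Euclidean norm and singular values -/

section norm
variable {ι : Type*} [Fintype ι]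

theorem l2norm_nonneg (v : ι → ℝ) : 0 ≤ l2norm v := norm_nonneg _

theorem l2norm_sq (v : ι → ℝ) : l2norm v ^ 2 = v ⬝ᵥ v := by
  rw [l2norm, EuclideanSpace.norm_sq_eq]
  simp [dotProduct, sq]

theorem l2norm_sub_le (v w : ι → ℝ) : l2norm (v - w) ≤ l2norm v + l2norm w := by
  simpa [l2norm] using norm_sub_le (WithLp.toLp 2 v) (WithLp.toLp 2 w)

theorem l2norm_smul (c : ℝ) (v : ι → ℝ) : l2norm (c • v) = |c| * l2norm v := by
  simp [l2norm, norm_smul]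

theorem l2norm_eq_zero {v : ι → ℝ} : l2norm v = 0 ↔ v = 0 := by
  simp [l2norm]

theorem abs_dotProduct_le (v w : ι → ℝ) : |v ⬝ᵥ w| ≤ l2norm v * l2norm w := by
  have := abs_real_inner_le_norm (WithLp.toLp 2 w) (WithLp.toLp 2 v)
  rw [EuclideanSpace.inner_toLp_toLp] at this
  simpa [l2norm, mul_comm] using this

theorem dotProduct_le_l2norm (v w : ι → ℝ) : v ⬝ᵥ w ≤ l2norm v * l2norm w :=
  (le_abs_self _).trans (abs_dotProduct_le v w)

theorem abs_apply_le_l2norm (v : ι → ℝ) (i : ι) : |v i| ≤ l2norm v := by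
  simpa [l2norm] using PiLp.norm_apply_le (WithLp.toLp 2 v) i

end norm

/-! ### Singular values as extreme stretching factors, and traces of powers of the Gram matrix. -/

section singular
variable {d : ℕ} (B : Matrix (Fin d) (Fin d) ℝ)

/-- The c i are the coordinates of x in an orthonormal eigenbasis of BᵀB, whose eigenvalues are the
squared singular values. Both bounds on ‖Bx‖ by extreme singular values follow termwise. -/
theorem l2norm_mulVec_sq_eq (x : Fin d → ℝ) :
    ∃ c : Fin d → ℝ, l2norm x ^ 2 = ∑ i, c i ^ 2 ∧
      l2norm (B *ᵥ x) ^ 2 =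
        ∑ i : Fin d, (Matrix.toEuclideanLin B).singularValues i ^ 2 * c i ^ 2 := by
  set T := Matrix.toEuclideanLin B with hT
  have hn : Module.finrank ℝ (EuclideanSpace ℝ (Fin d)) = d := by simp
  have hS := T.isSymmetric_adjoint_comp_self
  set b := hS.eigenvectorBasis hn
  set y : EuclideanSpace ℝ (Fin d) := WithLp.toLp 2 x
  refine ⟨fun i => inner ℝ y (b i), ?_, ?_⟩
  · have := b.sum_inner_mul_inner y y
    rw [real_inner_self_eq_norm_sq] at this
    rw [l2norm, ← this]
    exact Finset.sum_congr rfl fun i _ => by rw [real_inner_comm y (b i), sq]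
  · have h1 : l2norm (B *ᵥ x) ^ 2 = inner ℝ ((LinearMap.adjoint T ∘ₗ T) y) y := by
      rw [LinearMap.comp_apply, LinearMap.adjoint_inner_left, real_inner_self_eq_norm_sq]
      rfl
    rw [h1, ← b.sum_inner_mul_inner]
    refine Finset.sum_congr rfl fun i _ => ?_
    rw [hS y (b i), hS.apply_eigenvectorBasis hn i, inner_smul_right, T.sq_singularValues_fin hn i,
      real_inner_comm y (b i)]
    simp only [RCLike.ofReal_real_eq_id, id]
    ring

theorem sigmaMax_nonneg : 0 ≤ sigmaMax B := LinearMap.singularValues_nonneg _ _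

theorem sigmaMin_nonneg : 0 ≤ sigmaMin B := LinearMap.singularValues_nonneg _ _

theorem l2norm_mulVec_le (x : Fin d → ℝ) : l2norm (B *ᵥ x) ≤ sigmaMax B * l2norm x := by
  obtain ⟨c, h1, h2⟩ := l2norm_mulVec_sq_eq B x
  refine le_of_sq_le_sq ?_ (mul_nonneg (sigmaMax_nonneg B) (l2norm_nonneg x))
  rw [mul_pow, h1, h2, Finset.mul_sum]
  refine Finset.sum_le_sum fun i _ => mul_le_mul_of_nonneg_right ?_ (sq_nonneg _)
  exact pow_le_pow_left₀ (LinearMap.singularValues_nonneg _ _)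
    (LinearMap.singularValues_antitone _ (Nat.zero_le _)) 2

theorem sigmaMin_mul_le (x : Fin d → ℝ) : sigmaMin B * l2norm x ≤ l2norm (B *ᵥ x) := by
  obtain ⟨c, h1, h2⟩ := l2norm_mulVec_sq_eq B x
  refine le_of_sq_le_sq ?_ (l2norm_nonneg _)
  rw [mul_pow, h1, h2, Finset.mul_sum]
  refine Finset.sum_le_sum fun i _ => mul_le_mul_of_nonneg_right ?_ (sq_nonneg _)
  exact pow_le_pow_left₀ (LinearMap.singularValues_nonneg _ _)
    (LinearMap.singularValues_antitone _ (by omega)) 2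

/-- The singular values are attained: n = d - 1 serves for the positivity of σ_min, n = 0 for the
lower bound on the trace. -/
theorem exists_singular_vector {n : ℕ} (hn : n < d) :
    ∃ v : Fin d → ℝ, v ≠ 0 ∧
      (Bᵀ * B) *ᵥ v = (Matrix.toEuclideanLin B).singularValues n ^ 2 • v := by
  have h := (Matrix.toEuclideanLin B).hasEigenvalue_adjoint_comp_self_sq_singularValues (n := n)
    (by simpa using hn)
  obtain ⟨w, hw⟩ := h.exists_hasEigenvector
  refine ⟨w.ofLp, fun h0 => hw.2 (by ext i; simp [h0]), ?_⟩
  have h1 := hw.apply_eq_smul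
  rw [LinearMap.comp_apply, ← Matrix.toEuclideanLin_conjTranspose_eq_adjoint] at h1
  have h2 := congrArg WithLp.ofLp h1
  rw [← mulVec_mulVec]
  simpa [conjTranspose_eq_transpose_of_trivial] using h2

theorem sigmaMin_pos (hd : 0 < d) (hB : B.det ≠ 0) : 0 < sigmaMin B := by
  refine lt_of_le_of_ne (sigmaMin_nonneg B) fun h => ?_
  obtain ⟨v, hv, h1⟩ := exists_singular_vector B (n := d - 1) (by omega)
  rw [← sigmaMin, ← h] at h1
  exact hv (eq_zero_of_mulVec_eq_zero (M := Bᵀ * B) (by simp [hB]) (by simpa using h1))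

theorem sigmaMin_le_sigmaMax : sigmaMin B ≤ sigmaMax B :=
  LinearMap.singularValues_antitone _ (Nat.zero_le _)

theorem l2norm_transpose_mulVec_le (x : Fin d → ℝ) :
    l2norm (Bᵀ *ᵥ x) ≤ sigmaMax B * l2norm x := by
  have h1 : l2norm (Bᵀ *ᵥ x) ^ 2 ≤ (sigmaMax B * l2norm x) * l2norm (Bᵀ *ᵥ x) := by
    calc l2norm (Bᵀ *ᵥ x) ^ 2 = x ⬝ᵥ (B *ᵥ (Bᵀ *ᵥ x)) := by
          rw [l2norm_sq, dotProduct_mulVec x, mulVec_transpose]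
      _ ≤ l2norm x * l2norm (B *ᵥ (Bᵀ *ᵥ x)) := dotProduct_le_l2norm _ _
      _ ≤ l2norm x * (sigmaMax B * l2norm (Bᵀ *ᵥ x)) :=
          mul_le_mul_of_nonneg_left (l2norm_mulVec_le B _) (l2norm_nonneg _)
      _ = _ := by ring
  rcases (l2norm_nonneg (Bᵀ *ᵥ x)).eq_or_lt with h | h
  · rw [← h]
    exact mul_nonneg (sigmaMax_nonneg B) (l2norm_nonneg x)
  · rw [sq] at h1
    exact le_of_mul_le_mul_right h1 h

theorem l2norm_gram_pow_mulVec_le (n : ℕ) (x : Fin d → ℝ) :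
    l2norm ((Bᵀ * B) ^ n *ᵥ x) ≤ sigmaMax B ^ (2 * n) * l2norm x := by
  induction n with
  | zero => simp
  | succ n ih =>
    rw [pow_succ', ← mulVec_mulVec, ← mulVec_mulVec]
    calc _ ≤ sigmaMax B * l2norm (B *ᵥ ((Bᵀ * B) ^ n *ᵥ x)) := l2norm_transpose_mulVec_le B _
      _ ≤ sigmaMax B * (sigmaMax B * l2norm ((Bᵀ * B) ^ n *ᵥ x)) :=
        mul_le_mul_of_nonneg_left (l2norm_mulVec_le B _) (sigmaMax_nonneg B)
      _ ≤ sigmaMax B * (sigmaMax B * (sigmaMax B ^ (2 * n) * l2norm x)) := by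
        have := sigmaMax_nonneg B
        gcongr
      _ = _ := by ring

/-- For symmetric A the trace of A^(2n) is the squared Frobenius norm of A^n, summed here over
columns. -/
theorem trace_gram_pow_two_mul (n : ℕ) :
    ((Bᵀ * B) ^ (2 * n)).trace = ∑ j, l2norm ((Bᵀ * B) ^ n *ᵥ Pi.single j 1) ^ 2 := by
  have hs : ((Bᵀ * B) ^ n)ᵀ = (Bᵀ * B) ^ n := by
    rw [transpose_pow, transpose_mul, transpose_transpose]
  rw [two_mul, pow_add, trace]
  refine Finset.sum_congr rfl fun j _ => ?_
  rw [l2norm_sq, mulVec_single_one, diag_apply, mul_apply]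
  exact Finset.sum_congr rfl fun i _ => congrArg (· * _) (congrFun (congrFun hs i) j)

theorem trace_gram_pow_le (n : ℕ) :
    ((Bᵀ * B) ^ (2 * n)).trace ≤ d * sigmaMax B ^ (4 * n) := by
  rw [trace_gram_pow_two_mul]
  calc _ ≤ ∑ _j : Fin d, sigmaMax B ^ (4 * n) := Finset.sum_le_sum fun j _ => by
        have h := l2norm_gram_pow_mulVec_le B n (Pi.single j 1)
        have h1 : l2norm (Pi.single j (1 : ℝ) : Fin d → ℝ) = 1 := by simp [l2norm]
        rw [h1, mul_one] at h
        calc _ ≤ (sigmaMax B ^ (2 * n)) ^ 2 := pow_le_pow_left₀ (l2norm_nonneg _) h 2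
          _ = _ := by ring
    _ = _ := by simp

/-- A top singular vector is stretched by σ_max^(2n) under (BᵀB)^n, and the Frobenius norm dominates
this factor by Cauchy–Schwarz in each row. -/
theorem pow_le_trace_gram_pow (hd : 0 < d) (n : ℕ) :
    sigmaMax B ^ (4 * n) ≤ ((Bᵀ * B) ^ (2 * n)).trace := by
  obtain ⟨v, hv, h1⟩ := exists_singular_vector B hd
  rw [← sigmaMax] at h1
  have h2 : (Bᵀ * B) ^ n *ᵥ v = sigmaMax B ^ (2 * n) • v := by
    induction n with
    | zero => simp
    | succ n ih =>
      rw [pow_succ, ← mulVec_mulVec, h1, mulVec_smul, ih, smul_smul]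
      ring_nf
  have hs : ((Bᵀ * B) ^ n)ᵀ = (Bᵀ * B) ^ n := by
    rw [transpose_pow, transpose_mul, transpose_transpose]
  have hv0 : 0 < l2norm v := lt_of_le_of_ne (l2norm_nonneg v) fun h => hv (l2norm_eq_zero.1 h.symm)
  have h3 : l2norm ((Bᵀ * B) ^ n *ᵥ v) ^ 2 ≤
      (∑ j, l2norm ((Bᵀ * B) ^ n *ᵥ Pi.single j 1) ^ 2) * l2norm v ^ 2 := by
    rw [l2norm_sq, dotProduct, Finset.sum_mul]
    refine Finset.sum_le_sum fun i _ => ?_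
    have hrow : ((Bᵀ * B) ^ n).col i = fun j => ((Bᵀ * B) ^ n) i j :=
      funext fun j => congrFun (congrFun hs i) j
    rw [← sq, ← mul_pow, mulVec_single_one, hrow]
    exact sq_le_sq' (neg_le_of_abs_le (abs_dotProduct_le _ v)) (dotProduct_le_l2norm _ v)
  rw [h2, l2norm_smul, ← trace_gram_pow_two_mul, mul_pow] at h3
  have := le_of_mul_le_mul_right h3 (pow_pos hv0 2)
  calc _ = |sigmaMax B ^ (2 * n)| ^ 2 := by rw [sq_abs]; ring
    _ ≤ _ := this

end singular

theorem sqrt_iterate_pow {g : ℝ} (hg : 0 ≤ g) (n : ℕ) : Real.sqrt^[n] (g ^ 2 ^ n) = g := by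
  induction n with
  | zero => simp
  | succ n ih =>
    rw [Function.iterate_succ_apply, pow_succ, pow_mul, Real.sqrt_sq (pow_nonneg hg _), ih]

theorem sqrt_iterate_mono (n : ℕ) : Monotone (Real.sqrt^[n]) :=
  Monotone.iterate (fun _ _ h => Real.sqrt_le_sqrt h) n

/-- An estimate of the largest singular value, by a power method. -/
def sigmaEst {d : ℕ} (B : Matrix (Fin d) (Fin d) ℝ) : ℝ :=
  Real.sqrt^[d + 1] ((Bᵀ * B) ^ 2 ^ d).trace

theorem sigmaMax_le_sigmaEst {d : ℕ} (B : Matrix (Fin d) (Fin d) ℝ) (hd : 0 < d) :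
    sigmaMax B ≤ sigmaEst B := by
  -- For d > 0 the exponent 2^d is even, as the trace bounds require. The d + 1 square roots undo
  -- the exponent 2^(d+1) of σ_max.
  obtain ⟨n, rfl⟩ : ∃ n, d = n + 1 := ⟨d - 1, by omega⟩
  have h := pow_le_trace_gram_pow B hd (2 ^ n)
  calc sigmaMax B = Real.sqrt^[n + 1 + 1] (sigmaMax B ^ 2 ^ (n + 1 + 1)) :=
        (sqrt_iterate_pow (sigmaMax_nonneg B) _).symm
    _ ≤ _ := sqrt_iterate_mono _ (by
        rw [show 2 ^ (n + 1 + 1) = 4 * 2 ^ n by ring, show 2 ^ (n + 1) = 2 * 2 ^ n by ring]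
        exact h)

/-- The trace exceeds σ_max^(2^(d+1)) by a factor at most d ≤ 2^(2^(d+1)), which the d + 1 square
roots reduce to at most 2. -/
theorem sigmaEst_le {d : ℕ} (B : Matrix (Fin d) (Fin d) ℝ) (hd : 0 < d) :
    sigmaEst B ≤ 2 * sigmaMax B := by
  obtain ⟨n, rfl⟩ : ∃ n, d = n + 1 := ⟨d - 1, by omega⟩
  have h := trace_gram_pow_le B (2 ^ n)
  have h0 := sigmaMax_nonneg B
  calc _ ≤ Real.sqrt^[n + 1 + 1] ((2 * sigmaMax B) ^ 2 ^ (n + 1 + 1)) := sqrt_iterate_mono _ (by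
        rw [show 2 ^ (n + 1 + 1) = 4 * 2 ^ n by ring, show 2 ^ (n + 1) = 2 * 2 ^ n by ring, mul_pow]
        refine h.trans (mul_le_mul_of_nonneg_right ?_ (pow_nonneg h0 _))
        have h1 : n + 1 ≤ 4 * 2 ^ n := by
          have := Nat.lt_two_pow_self (n := n); omega
        have h2 : (4 * 2 ^ n) ≤ 2 ^ (4 * 2 ^ n) := Nat.lt_two_pow_self.le
        exact_mod_cast h1.trans h2)
    _ = _ := sqrt_iterate_pow (by positivity) _

/-! ### A lower estimate of the smallest singular value -/

section projection
variable {d : ℕ} (B : Matrix (Fin d) (Fin d) ℝ)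

/-- One step of the Gram–Schmidt process: project onto the orthogonal complement of `b`. -/
def orthStep (b : Fin d → ℝ) (P : Matrix (Fin d) (Fin d) ℝ) : Matrix (Fin d) (Fin d) ℝ :=
  P - (b ⬝ᵥ (P *ᵥ b))⁻¹ • vecMulVec (P *ᵥ b) (P *ᵥ b)

/-- The projection onto the orthogonal complement of the first `n` columns but the `i`-th one. -/
def orthProj (i : ℕ) : ℕ → Matrix (Fin d) (Fin d) ℝ
  | 0 => 1
  | n + 1 => if h : n < d ∧ n ≠ i then orthStep (B.col ⟨n, h.1⟩) (orthProj i n) else orthProj i n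

/-- The square of the distance of the `i`-th column from the span of the others. -/
def distSq (i : Fin d) : ℝ := B.col i ⬝ᵥ (orthProj B i d *ᵥ B.col i)

/-- The squared Frobenius norm of the inverse. -/
def invNormSq : ℝ := ∑ i, 1 / distSq B i

theorem orthStep_mulVec (b : Fin d → ℝ) (P : Matrix (Fin d) (Fin d) ℝ) (w : Fin d → ℝ) :
    orthStep b P *ᵥ w = P *ᵥ w - ((b ⬝ᵥ (P *ᵥ b))⁻¹ * ((P *ᵥ b) ⬝ᵥ w)) • (P *ᵥ b) := by
  rw [orthStep, sub_mulVec, smul_mulVec, vecMulVec_mulVec, op_smul_eq_smul, smul_smul]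

theorem mulVec_col_eq (l : Fin d) : B *ᵥ Pi.single l 1 = B.col l := mulVec_single_one _ _

/-- The invariants of Gram–Schmidt: self-adjoint, idempotent, zero on the columns treated so far,
and moving a vector only by a combination of those columns. The last one brings in the invertibility
of B and, later, the comparison with σ_min. -/
theorem orthProj_spec (hB : B.det ≠ 0) (i n : ℕ) (hn : n ≤ d) :
    (∀ v w, (orthProj B i n *ᵥ v) ⬝ᵥ w = v ⬝ᵥ (orthProj B i n *ᵥ w)) ∧
    (∀ v, orthProj B i n *ᵥ (orthProj B i n *ᵥ v) = orthProj B i n *ᵥ v) ∧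
    (∀ l : Fin d, (l : ℕ) < n → (l : ℕ) ≠ i → orthProj B i n *ᵥ B.col l = 0) ∧
    ∀ w, ∃ c : Fin d → ℝ, (∀ l : Fin d, n ≤ (l : ℕ) ∨ (l : ℕ) = i → c l = 0) ∧
      orthProj B i n *ᵥ w = w - B *ᵥ c := by
  induction n with
  | zero =>
    refine ⟨by simp [orthProj], by simp [orthProj], by simp, fun w => ⟨0, by simp, ?_⟩⟩
    simp [orthProj]
  | succ n ih =>
    obtain ⟨h1, h2, h3, h4⟩ := ih (by omega)
    rw [orthProj]
    split_ifs with h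
    swap
    · refine ⟨h1, h2, fun l hl hi => h3 l (by omega) hi, fun w => ?_⟩
      obtain ⟨c, hc, hw⟩ := h4 w
      exact ⟨c, fun l hl => hc l (by omega), hw⟩
    set P := orthProj B i n
    set b := B.col ⟨n, h.1⟩
    set v := P *ᵥ b with hv
    set q := b ⬝ᵥ v with hq
    have hqv : v ⬝ᵥ v = q := by rw [hv, h1, h2]
    have hvb : v ⬝ᵥ b = q := dotProduct_comm _ _
    have hPv : P *ᵥ v = v := h2 b
    -- q = ‖Pb‖². If it vanished, b would equal Bc with c zero at index n, against the injectivity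
    -- of B.
    have hq0 : q ≠ 0 := by
      intro h0
      have hv0 : v = 0 := dotProduct_self_eq_zero.1 (hqv.trans h0)
      obtain ⟨c, hc, hw⟩ := h4 b
      have : B *ᵥ (Pi.single ⟨n, h.1⟩ 1 - c) = 0 := by
        rw [mulVec_sub, mulVec_col_eq, ← hv0, hv, hw]
      have := congrFun (eq_zero_of_mulVec_eq_zero hB this) ⟨n, h.1⟩
      simp [hc ⟨n, h.1⟩ (Or.inl le_rfl)] at this
    have hstep : ∀ w, orthStep b P *ᵥ w = P *ᵥ w - (q⁻¹ * (v ⬝ᵥ w)) • v := orthStep_mulVec b P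
    refine ⟨fun x w => ?_, fun x => ?_, fun l hl hi => ?_, fun w => ?_⟩
    · rw [hstep, hstep, sub_dotProduct, dotProduct_sub, smul_dotProduct, dotProduct_smul, h1,
        smul_eq_mul, smul_eq_mul, dotProduct_comm x v]
      ring
    · rw [hstep, hstep, mulVec_sub, mulVec_smul, h2, hPv, dotProduct_sub, dotProduct_smul, hqv,
        ← h1 v x, hPv, smul_eq_mul]
      have : q⁻¹ * (v ⬝ᵥ x - q⁻¹ * (v ⬝ᵥ x) * q) = 0 := by field_simp; ring
      rw [this, zero_smul, sub_zero]
    · rw [hstep]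
      rcases Nat.lt_succ_iff_lt_or_eq.1 hl with hl | hl
      · have h5 : v ⬝ᵥ B.col l = 0 := by rw [hv, h1, h3 l hl hi, dotProduct_zero]
        rw [h3 l hl hi, h5]
        simp
      · have : l = ⟨n, h.1⟩ := Fin.ext hl
        subst this
        change P *ᵥ b - (q⁻¹ * (v ⬝ᵥ b)) • v = 0
        rw [hvb, inv_mul_cancel₀ hq0, one_smul, ← hv, sub_self]
    · obtain ⟨c, hc, hw⟩ := h4 w
      obtain ⟨c', hc', hb⟩ := h4 b
      -- The subtracted multiple of v = b - Bc' lies again in the span of the treated columns.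
      refine ⟨c + (q⁻¹ * (v ⬝ᵥ w)) • (Pi.single ⟨n, h.1⟩ 1 - c'), fun l hl => ?_, ?_⟩
      · have hln : l ≠ ⟨n, h.1⟩ := by
          rintro rfl
          simp only at hl
          have := h.2
          omega
        simp [hc l (by omega), hc' l (by omega), hln]
      · rw [hstep, hw, mulVec_add, mulVec_smul, mulVec_sub, mulVec_col_eq, ← hb]
        abel

variable {B}

/-- Projecting Bx away from the other columns leaves x_i times the projected i-th column, and an
orthogonal projection does not increase the norm. -/
theorem sq_mul_distSq_le (hB : B.det ≠ 0) (i : Fin d) (x : Fin d → ℝ) :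
    x i ^ 2 * distSq B i ≤ l2norm (B *ᵥ x) ^ 2 := by
  obtain ⟨h1, h2, h3, -⟩ := orthProj_spec B hB i d le_rfl
  have hP : orthProj B i d *ᵥ (B *ᵥ x) = x i • (orthProj B i d *ᵥ B.col i) := by
    have hx : B *ᵥ x = ∑ l, x l • B.col l := by
      rw [mulVec_eq_sum]
      exact Finset.sum_congr rfl fun l _ => op_smul_eq_smul _ _
    rw [hx, mulVec_sum, Finset.sum_eq_single i]
    · rw [mulVec_smul]
    · intro l _ hl
      rw [mulVec_smul, h3 l l.2 (fun h => hl (Fin.ext h)), smul_zero]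
    · simp
  have hd : x i ^ 2 * distSq B i = l2norm (orthProj B i d *ᵥ (B *ᵥ x)) ^ 2 := by
    rw [hP, l2norm_sq, smul_dotProduct, dotProduct_smul, h1, h2, distSq, smul_eq_mul, smul_eq_mul]
    ring
  have h5 : l2norm (orthProj B i d *ᵥ (B *ᵥ x)) ^ 2 ≤
      l2norm (B *ᵥ x) * l2norm (orthProj B i d *ᵥ (B *ᵥ x)) := by
    rw [l2norm_sq, h1, h2]
    exact dotProduct_le_l2norm _ _
  rw [hd]
  have ha := l2norm_nonneg (orthProj B i d *ᵥ (B *ᵥ x))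
  have hb := l2norm_nonneg (B *ᵥ x)
  rcases ha.eq_or_lt with h | h
  · rw [← h]
    simpa using sq_nonneg _
  · rw [sq] at h5
    exact pow_le_pow_left₀ ha (le_of_mul_le_mul_right h5 h) 2

/-- The projected i-th column is B(e_i - c) with c_i = 0, and e_i - c has norm at least 1. -/
theorem sigmaMin_sq_le_distSq (hB : B.det ≠ 0) (i : Fin d) : sigmaMin B ^ 2 ≤ distSq B i := by
  obtain ⟨h1, h2, -, h4⟩ := orthProj_spec B hB i d le_rfl
  obtain ⟨c, hc, hw⟩ := h4 (B.col i)
  have hd : distSq B i = l2norm (B *ᵥ (Pi.single i 1 - c)) ^ 2 := by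
    rw [mulVec_sub, mulVec_col_eq, ← hw, l2norm_sq, h1, h2, distSq]
  have h5 : 1 ≤ l2norm (Pi.single i 1 - c) := by
    have := abs_apply_le_l2norm (Pi.single i 1 - c) i
    have h0 : (Pi.single i 1 - c : Fin d → ℝ) i = 1 := by simp [hc i (Or.inr rfl)]
    rwa [h0, abs_one] at this
  rw [hd]
  refine pow_le_pow_left₀ (sigmaMin_nonneg B) ?_ 2
  have := sigmaMin_mul_le B (Pi.single i 1 - c)
  nlinarith [sigmaMin_nonneg B]

theorem distSq_pos (hB : B.det ≠ 0) (i : Fin d) : 0 < distSq B i :=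
  lt_of_lt_of_le (pow_pos (sigmaMin_pos B i.pos hB) 2) (sigmaMin_sq_le_distSq hB i)

/-- With `invNormSq_mul_le`, this makes `invNormSq` a substitute for σ_min⁻² that arithmetic alone
can compute. -/
theorem l2norm_sq_le_invNormSq_mul (hB : B.det ≠ 0) (x : Fin d → ℝ) :
    l2norm x ^ 2 ≤ invNormSq B * l2norm (B *ᵥ x) ^ 2 := by
  rw [l2norm_sq, dotProduct, invNormSq, Finset.sum_mul]
  refine Finset.sum_le_sum fun i _ => ?_
  rw [one_div, ← div_eq_inv_mul, le_div_iff₀ (distSq_pos hB i), ← sq]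
  exact sq_mul_distSq_le hB i x

theorem invNormSq_mul_le (hB : B.det ≠ 0) : invNormSq B * sigmaMin B ^ 2 ≤ d := by
  rw [invNormSq, Finset.sum_mul]
  calc _ ≤ ∑ _i : Fin d, (1 : ℝ) := Finset.sum_le_sum fun i _ => by
        rw [one_div, ← div_eq_inv_mul, div_le_one (distSq_pos hB i)]
        exact sigmaMin_sq_le_distSq hB i
    _ = d := by simp

theorem invNormSq_pos (hd : 0 < d) (hB : B.det ≠ 0) : 0 < invNormSq B :=
  Finset.sum_pos (fun i _ => one_div_pos.2 (distSq_pos hB i)) ⟨⟨0, hd⟩, Finset.mem_univ _⟩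

/-- Test on one unit vector. This converts γ, whose size is given in terms of σ_max, to the scale 1
/ `invNormSq` of the error analysis. -/
theorem one_le_invNormSq_mul (hd : 0 < d) (hB : B.det ≠ 0) :
    1 ≤ invNormSq B * sigmaMax B ^ 2 := by
  have h := l2norm_sq_le_invNormSq_mul hB (Pi.single ⟨0, hd⟩ 1)
  have h1 : l2norm (Pi.single ⟨0, hd⟩ (1 : ℝ) : Fin d → ℝ) = 1 := by simp [l2norm]
  have h2 := l2norm_mulVec_le B (Pi.single ⟨0, hd⟩ 1)
  rw [h1] at h h2
  rw [one_pow] at h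
  rw [mul_one] at h2
  exact h.trans (mul_le_mul_of_nonneg_left (pow_le_pow_left₀ (l2norm_nonneg _) h2 2)
    (invNormSq_pos hd hB).le)

end projection

end BDDLasso
end

noncomputable section

namespace BDDLasso

/-! ### Matrix programs -/

/-- Array `c` becomes the product of the `p × r` array `a` and the `r × q` array `b`. -/
def mulArr (c a b : ℕ) (p q r : NExp) : Cmd :=
  sumFill c (.lit 0) p q r (.mul (.get a (.reg 20) (.reg 22)) (.get b (.reg 22) (.reg 21)))

/-- Copy the `p × q` array `a` to array `c`. -/
def copyArr (c a : ℕ) (p q : NExp) : Cmd :=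
  sumFill c (.lit 0) p q (.lit 1) (.get a (.reg 20) (.reg 21))

theorem mulArr_mat {c a b : ℕ} {ep eq er : NExp} (ω : ℕ → ℝ) {s : State} (p q r : ℕ)
    (hr : ∀ x ∈ ep.regs ++ eq.regs ++ er.regs, x < 20) (hp : ep.eval s = p)
    (hq : eq.eval s = q) (hl : er.eval s = r) (ha : a ≠ c) (hb : b ≠ c) :
    ((mulArr c a b ep eq er).run ω s).mat c p q = s.mat a p r * s.mat b r q := by
  exact sumFill_mat p q r (by simpa [NExp.regs] using hr) rfl hp hq hl
    (fun i j u => s.mem a i u * s.mem b u j) fun s' hA _ _ _ => by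
      simp [RExp.eval, NExp.eval, hA.2 a (by simpa using ha), hA.2 b (by simpa using hb)]

theorem copyArr_mat {c a : ℕ} {ep eq : NExp} (ω : ℕ → ℝ) {s : State} (p q : ℕ)
    (hr : ∀ x ∈ ep.regs ++ eq.regs, x < 20) (hp : ep.eval s = p)
    (hq : eq.eval s = q) (ha : a ≠ c) :
    ((copyArr c a ep eq).run ω s).mat c p q = s.mat a p q := by
  refine (sumFill_mat p q 1 (by simpa [NExp.regs] using hr) rfl hp hq rfl
    (fun i j _ => s.mem a i j) fun s' hA _ _ _ => by
      simp [RExp.eval, NExp.eval, hA.2 a (by simpa using ha)]).trans ?_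
  funext i j
  simp [State.mat]

theorem Cmd.mat_run {p : Cmd} {ω : ℕ → ℝ} {s : State} {a : ℕ} (h : a ∉ p.arrs) (n q : ℕ) :
    (p.run ω s).mat a n q = s.mat a n q := by
  unfold State.mat
  rw [Cmd.mem_run h]

/-! ### Estimating the largest singular value -/

/-- Array `5` becomes the Gram matrix of array `0`. -/
def gramProg : Cmd :=
  sumFill 5 (.lit 0) (.reg 0) (.reg 0) (.reg 0)
    (.mul (.get 0 (.reg 22) (.reg 20)) (.get 0 (.reg 22) (.reg 21)))

/-- Square the matrix in array `5`. -/
def squareProg : Cmd :=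
  .seq (mulArr 6 5 5 (.reg 0) (.reg 0) (.reg 0)) (copyArr 5 6 (.reg 0) (.reg 0))

/-- Cell `(0, 0)` of array `7` becomes the trace of array `5`. -/
def traceProg : Cmd :=
  sumFill 7 (.lit 0) (.lit 1) (.lit 1) (.reg 0) (.get 5 (.reg 22) (.reg 22))

/-- Take the square root of cell `(0, 0)` of array `7`. -/
def sqrtProg : Cmd := .setMem 7 (.lit 0) (.lit 0) (.sqrt (.get 7 (.lit 0) (.lit 0)))

/-- Compute `sigmaEst`. -/
def sigmaProg : Cmd :=
  .seq gramProg (.seq (.loop 6 (.reg 0) squareProg) (.seq traceProg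
    (.seq (.loop 6 (.reg 0) sqrtProg) sqrtProg)))

theorem gramProg_mat (ω : ℕ → ℝ) (s : State) {d : ℕ} (h0 : s.reg 0 = d) :
    (gramProg.run ω s).mat 5 d d = (s.mat 0 d d)ᵀ * s.mat 0 d d := by
  exact sumFill_mat d d d (by simp [NExp.regs]) rfl (by exact h0) (by exact h0) (by exact h0)
    (fun i j u => s.mem 0 u i * s.mem 0 u j) fun s' hA _ _ _ => by
      simp [RExp.eval, NExp.eval, hA.2 0 (by simp)]

/-- `mulArr_mat` requires the target to differ from both factors, hence the detour through array
`6`. -/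
theorem squareProg_mat (ω : ℕ → ℝ) (s : State) {d : ℕ} (h0 : s.reg 0 = d) :
    (squareProg.run ω s).mat 5 d d = s.mat 5 d d * s.mat 5 d d := by
  have h1 : ((mulArr 6 5 5 (.reg 0) (.reg 0) (.reg 0)).run ω s).reg 0 = d :=
    (Cmd.reg_run (by decide)).trans h0
  rw [squareProg, Cmd.run_seq]
  exact (copyArr_mat ω d d (by simp [NExp.regs]) (by exact h1) (by exact h1)
    (by decide)).trans
    (mulArr_mat ω d d d (by simp [NExp.regs]) (by exact h0) (by exact h0) (by exact h0)
      (by decide) (by decide))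

theorem traceProg_mem (ω : ℕ → ℝ) (s : State) {d : ℕ} (h0 : s.reg 0 = d) :
    (traceProg.run ω s).mem 7 0 0 = (s.mat 5 d d).trace := by
  refine (sumFill_spec 1 1 d 0 (by simp [NExp.regs]) rfl rfl rfl (by exact h0)
    (fun _ _ u => s.mem 5 u u) (fun s' hA _ _ _ => by
      simp [RExp.eval, NExp.eval, hA.2 5 (by simp)]) _ _).trans ?_
  rw [if_pos (by simp), Finset.sum_range]
  rfl

theorem sqrtProg_mem (ω : ℕ → ℝ) (s : State) :
    (sqrtProg.run ω s).mem 7 0 0 = √(s.mem 7 0 0) := by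
  simp [sqrtProg, Cmd.run, State.setMem_mem, NExp.eval, RExp.eval]

theorem sigmaProg_mem (ω : ℕ → ℝ) (s : State) {d : ℕ} (h0 : s.reg 0 = d) :
    (sigmaProg.run ω s).mem 7 0 0 = sigmaEst (s.mat 0 d d) := by
  rw [sigmaProg, Cmd.run_seq, Cmd.run_seq, Cmd.run_seq, Cmd.run_seq]
  set s1 := gramProg.run ω s with hs1
  have h1 : s1.reg 0 = d := (Cmd.reg_run (by decide)).trans h0
  have k1 : s1.mat 5 d d = (s.mat 0 d d)ᵀ * s.mat 0 d d := gramProg_mat ω s h0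
  clear_value s1
  set s2 := (Cmd.loop 6 (.reg 0) squareProg).run ω s1 with hs2
  have h2 : s2.reg 0 = d := (Cmd.reg_run (by decide)).trans h1
  have k2 : s2.mat 5 d d = ((s.mat 0 d d)ᵀ * s.mat 0 d d) ^ 2 ^ d := by
    rw [hs2]
    refine Cmd.run_loop_induct (x := 6) (e := .reg 0) (p := squareProg) h1
      (fun i s' => s'.mat 5 d d = ((s.mat 0 d d)ᵀ * s.mat 0 d d) ^ 2 ^ i)
      (by rw [pow_zero, pow_one, ← k1]; rfl) ?_
    intro i _ s' hA hi
    have h0' : ((s'.setReg 6 i).tick 1).reg 0 = d := by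
      simpa [h1] using hA.1 0 (by decide)
    rw [squareProg_mat ω _ h0', show ((s'.setReg 6 i).tick 1).mat 5 d d = s'.mat 5 d d from rfl,
      hi, ← pow_add, pow_succ, mul_two]
  clear_value s2
  set s3 := traceProg.run ω s2 with hs3
  have h3 : s3.reg 0 = d := (Cmd.reg_run (by decide)).trans h2
  have k3 : s3.mem 7 0 0 = (((s.mat 0 d d)ᵀ * s.mat 0 d d) ^ 2 ^ d).trace := by
    rw [hs3, traceProg_mem ω s2 h2, k2]
  clear_value s3
  rw [sqrtProg_mem, sigmaEst, Function.iterate_succ_apply']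
  congr 1
  refine Cmd.run_loop_induct (x := 6) (e := .reg 0) (p := sqrtProg) h3
      (fun i s' => s'.mem 7 0 0 = Real.sqrt^[i] (((s.mat 0 d d)ᵀ * s.mat 0 d d) ^ 2 ^ d).trace)
      (by simpa using k3) ?_
  intro i _ s' _ hi
  rw [sqrtProg_mem, Function.iterate_succ_apply', ← hi]
  rfl

/-! ### Estimating the smallest singular value -/

/-- The Kronecker delta of two registers. -/
def deltaExp (e f : NExp) : RExp := .nat (.sub (.lit 1) (.add (.sub e f) (.sub f e)))

theorem deltaExp_eval (e f : NExp) (s : State) :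
    (deltaExp e f).eval s = if e.eval s = f.eval s then 1 else 0 := by
  simp only [deltaExp, RExp.eval, NExp.eval]
  split_ifs with h
  · simp [h]
  · have : 1 - (e.eval s - f.eval s + (f.eval s - e.eval s)) = 0 := by omega
    rw [this, Nat.cast_zero]

/-- Array `10` becomes the identity matrix. -/
def oneProg : Cmd :=
  sumFill 10 (.lit 0) (.reg 0) (.reg 0) (.lit 1) (deltaExp (.reg 20) (.reg 21))

/-- Apply array `10` to the column of array `0` with index in register `c`. -/
def colProg (c : ℕ) : Cmd :=
  sumFill 11 (.lit 0) (.reg 0) (.lit 1) (.reg 0)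
    (.mul (.get 10 (.reg 20) (.reg 22)) (.get 0 (.reg 22) (.reg c)))

/-- The scalar product of this vector with the column. -/
def dotProg (c : ℕ) : Cmd :=
  sumFill 15 (.lit 0) (.lit 1) (.lit 1) (.reg 0)
    (.mul (.get 0 (.reg 22) (.reg c)) (.get 11 (.reg 22) (.lit 0)))

/-- Subtract the rank one correction, unless the registers `6` and `7` agree. -/
def correctProg : Cmd :=
  .seq (sumFill 16 (.lit 0) (.reg 0) (.reg 0) (.lit 1)
    (.sub (.get 10 (.reg 20) (.reg 21))
      (.mul (.sub (.nat (.lit 1)) (deltaExp (.reg 7) (.reg 6)))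
        (.div (.mul (.get 11 (.reg 20) (.lit 0)) (.get 11 (.reg 21) (.lit 0)))
          (.get 15 (.lit 0) (.lit 0))))))
    (copyArr 10 16 (.reg 0) (.reg 0))

/-- Project onto the orthogonal complement of all columns but that in register `6`. -/
def projProg : Cmd :=
  .seq oneProg (.loop 7 (.reg 0) (.seq (colProg 7) (.seq (dotProg 7) correctProg)))

/-- Add the inverse of the squared distance of a column from the span of the others. -/
def distProg : Cmd :=
  .seq projProg (.seq (colProg 6) (.seq (dotProg 6)
    (.setMem 17 (.lit 0) (.lit 0) (.add (.get 17 (.lit 0) (.lit 0))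
      (.div (.nat (.lit 1)) (.get 15 (.lit 0) (.lit 0)))))))

/-- Compute `invNormSq`. -/
def invNormProg : Cmd :=
  .seq (.setMem 17 (.lit 0) (.lit 0) (.nat (.lit 0))) (.loop 6 (.reg 0) distProg)

theorem oneProg_mat (ω : ℕ → ℝ) (s : State) {d : ℕ} (h0 : s.reg 0 = d) :
    (oneProg.run ω s).mat 10 d d = 1 := by
  refine (sumFill_mat d d 1 (by simp [NExp.regs]) rfl (by exact h0) (by exact h0) rfl
    (fun i j _ => if i = j then 1 else 0) fun s' hA _ _ _ => deltaExp_eval _ _ _).trans ?_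
  funext i j
  simp [one_apply, Fin.ext_iff]

theorem colProg_mem {c : ℕ} (hc : c < 20) (ω : ℕ → ℝ) (s : State) {d : ℕ} (h0 : s.reg 0 = d)
    (l : Fin d) (hl : s.reg c = l) (i : Fin d) :
    ((colProg c).run ω s).mem 11 i 0 = (s.mat 10 d d *ᵥ (s.mat 0 d d).col l) i := by
  refine (sumFill_spec d 1 d 0 (by simp [NExp.regs]) rfl (by exact h0) rfl (by exact h0)
    (fun i _ u => s.mem 10 i u * s.mem 0 u l) (fun s' hA _ _ _ => by
      simp [RExp.eval, NExp.eval, hA.2 10 (by simp), hA.2 0 (by simp), ← hl,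
        hA.1 c (by simp; omega)]) _ _).trans ?_
  rw [if_pos (by simp), Finset.sum_range]
  rfl

theorem dotProg_mem {c : ℕ} (hc : c < 20) (ω : ℕ → ℝ) (s : State) {d : ℕ} (h0 : s.reg 0 = d)
    (l : Fin d) (hl : s.reg c = l) :
    ((dotProg c).run ω s).mem 15 0 0 =
      (s.mat 0 d d).col l ⬝ᵥ fun i : Fin d => s.mem 11 i 0 := by
  refine (sumFill_spec 1 1 d 0 (by simp [NExp.regs]) rfl rfl rfl (by exact h0)
    (fun _ _ u => s.mem 0 u l * s.mem 11 u 0) (fun s' hA _ _ _ => by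
      simp [RExp.eval, NExp.eval, hA.2 11 (by simp), hA.2 0 (by simp), ← hl,
        hA.1 c (by simp; omega)]) _ _).trans ?_
  rw [if_pos (by simp), Finset.sum_range]
  rfl

theorem correctProg_mat (ω : ℕ → ℝ) (s : State) {d : ℕ} (h0 : s.reg 0 = d) :
    (correctProg.run ω s).mat 10 d d = fun i j : Fin d => s.mem 10 i j -
      (1 - if s.reg 7 = s.reg 6 then 1 else 0) *
        (s.mem 11 i 0 * s.mem 11 j 0 / s.mem 15 0 0) := by
  rw [correctProg, Cmd.run_seq]
  refine (copyArr_mat ω d d (by simp [NExp.regs]) (by exact (Cmd.reg_run (by decide)).trans h0)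
    (by exact (Cmd.reg_run (by decide)).trans h0) (by decide)).trans ?_
  refine (sumFill_mat d d 1 (by simp [NExp.regs]) rfl (by exact h0) (by exact h0) rfl
    (fun i j _ => s.mem 10 i j - (1 - if s.reg 7 = s.reg 6 then 1 else 0) *
        (s.mem 11 i 0 * s.mem 11 j 0 / s.mem 15 0 0)) (fun s' hA _ _ _ => by
      simp [RExp.eval, NExp.eval, deltaExp_eval, hA.2 10 (by simp), hA.2 11 (by simp),
        hA.2 15 (by simp), hA.1 6 (by simp), hA.1 7 (by simp)])).trans ?_
  funext i j
  simp

theorem projProg_mat (ω : ℕ → ℝ) (s : State) {d : ℕ} (h0 : s.reg 0 = d) :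
    (projProg.run ω s).mat 10 d d = orthProj (s.mat 0 d d) (s.reg 6) d := by
  rw [projProg, Cmd.run_seq]
  set s1 := oneProg.run ω s with hs1
  have h1 : s1.reg 0 = d := (Cmd.reg_run (by decide)).trans h0
  have h16 : s1.reg 6 = s.reg 6 := Cmd.reg_run (by decide)
  have hB1 : s1.mat 0 d d = s.mat 0 d d := Cmd.mat_run (by decide) _ _
  refine Cmd.run_loop_induct (x := 7) (e := .reg 0)
    (p := .seq (colProg 7) (.seq (dotProg 7) correctProg)) h1
    (fun n s' => s'.mat 10 d d = orthProj (s.mat 0 d d) (s.reg 6) n) (oneProg_mat ω s h0) ?_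
  intro n hn s2 hA hP
  have h2 : s2.reg 0 = d := (hA.1 0 (by decide)).trans h1
  have h26 : s2.reg 6 = s.reg 6 := (hA.1 6 (by decide)).trans h16
  have hB2 : s2.mat 0 d d = s.mat 0 d d := by
    rw [← hB1]
    unfold State.mat
    rw [hA.2 0 (by decide)]
  rw [Cmd.run_seq, Cmd.run_seq]
  set s3 := (s2.setReg 7 n).tick 1 with hs3
  have h3 : s3.reg 0 = d := by simpa [hs3] using h2
  have h36 : s3.reg 6 = s.reg 6 := by simpa [hs3] using h26
  have h37 : s3.reg 7 = n := by simp [hs3]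
  have hP3 : s3.mat 10 d d = orthProj (s.mat 0 d d) (s.reg 6) n := hP
  have hB3 : s3.mat 0 d d = s.mat 0 d d := hB2
  clear_value s3
  set s4 := (colProg 7).run ω s3 with hs4
  have h4 : s4.reg 0 = d := (Cmd.reg_run (by decide)).trans h3
  have h46 : s4.reg 6 = s.reg 6 := (Cmd.reg_run (by decide)).trans h36
  have h47 : s4.reg 7 = n := (Cmd.reg_run (by decide)).trans h37
  have hP4 : s4.mat 10 d d = _ := (Cmd.mat_run (by decide) _ _).trans hP3
  have hB4 : s4.mat 0 d d = _ := (Cmd.mat_run (by decide) _ _).trans hB3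
  have hv4 : (fun i : Fin d => s4.mem 11 i 0) = orthProj (s.mat 0 d d) (s.reg 6) n *ᵥ
      (s.mat 0 d d).col ⟨n, hn⟩ := funext fun i => by
    rw [hs4, colProg_mem (by decide) ω s3 h3 ⟨n, hn⟩ h37, hP3, hB3]
  clear_value s4
  set s5 := (dotProg 7).run ω s4 with hs5
  have h5 : s5.reg 0 = d := (Cmd.reg_run (by decide)).trans h4
  have h56 : s5.reg 6 = s.reg 6 := (Cmd.reg_run (by decide)).trans h46
  have h57 : s5.reg 7 = n := (Cmd.reg_run (by decide)).trans h47
  have hP5 : s5.mat 10 d d = _ := (Cmd.mat_run (by decide) _ _).trans hP4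
  have hv5 : (fun i : Fin d => s5.mem 11 i 0) = orthProj (s.mat 0 d d) (s.reg 6) n *ᵥ
      (s.mat 0 d d).col ⟨n, hn⟩ := by
    rw [← hv4, hs5, Cmd.mem_run (by decide)]
  have hq5 : s5.mem 15 0 0 = (s.mat 0 d d).col ⟨n, hn⟩ ⬝ᵥ
      (orthProj (s.mat 0 d d) (s.reg 6) n *ᵥ (s.mat 0 d d).col ⟨n, hn⟩) := by
    rw [hs5, dotProg_mem (by decide) ω s4 h4 ⟨n, hn⟩ h47, hB4, hv4]
  clear_value s5
  rw [correctProg_mat ω s5 h5, h56, h57, orthProj]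
  funext i j
  have hi := congrFun hv5 i
  have hj := congrFun hv5 j
  have hPij : s5.mem 10 i j = _ := congrFun (congrFun hP5 i) j
  rw [show s5.mem 11 i 0 = _ from hi, show s5.mem 11 j 0 = _ from hj, hPij, hq5]
  -- For the excluded column the correction carries the factor 0. For the others both sides use the
  -- same total division, so B need not be invertible here.
  by_cases h : n = s.reg 6
  · have h' : ¬(n < d ∧ n ≠ s.reg 6) := by tauto
    simp only [if_pos h, dif_neg h']
    simp
  · have h' : n < d ∧ n ≠ s.reg 6 := ⟨hn, h⟩
    simp only [if_neg h, dif_pos h']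
    rw [orthStep, Matrix.sub_apply, Matrix.smul_apply, vecMulVec_apply, smul_eq_mul,
      div_eq_inv_mul, sub_zero, one_mul]

theorem distProg_mem (ω : ℕ → ℝ) (s : State) {d : ℕ} (h0 : s.reg 0 = d) (i : Fin d)
    (hi : s.reg 6 = i) :
    (distProg.run ω s).mem 17 0 0 = s.mem 17 0 0 + 1 / distSq (s.mat 0 d d) i := by
  rw [distProg, Cmd.run_seq, Cmd.run_seq, Cmd.run_seq]
  set s1 := projProg.run ω s with hs1
  have h1 : s1.reg 0 = d := (Cmd.reg_run (by decide)).trans h0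
  have h16 : s1.reg 6 = i := (Cmd.reg_run (by decide)).trans hi
  have hP1 : s1.mat 10 d d = orthProj (s.mat 0 d d) i d := by
    rw [hs1, projProg_mat ω s h0, hi]
  have hB1 : s1.mat 0 d d = s.mat 0 d d := Cmd.mat_run (by decide) _ _
  have hW1 : s1.mem 17 = s.mem 17 := Cmd.mem_run (by decide)
  clear_value s1
  set s2 := (colProg 6).run ω s1 with hs2
  have h2 : s2.reg 0 = d := (Cmd.reg_run (by decide)).trans h1
  have h26 : s2.reg 6 = i := (Cmd.reg_run (by decide)).trans h16
  have hB2 : s2.mat 0 d d = s.mat 0 d d := (Cmd.mat_run (by decide) _ _).trans hB1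
  have hW2 : s2.mem 17 = s.mem 17 := (Cmd.mem_run (by decide)).trans hW1
  have hv2 : (fun l : Fin d => s2.mem 11 l 0) = orthProj (s.mat 0 d d) i d *ᵥ
      (s.mat 0 d d).col i := funext fun l => by
    rw [hs2, colProg_mem (by decide) ω s1 h1 i h16, hP1, hB1]
  clear_value s2
  set s3 := (dotProg 6).run ω s2 with hs3
  have hW3 : s3.mem 17 = s.mem 17 := (Cmd.mem_run (by decide)).trans hW2
  have hq3 : s3.mem 15 0 0 = distSq (s.mat 0 d d) i := by
    rw [hs3, dotProg_mem (by decide) ω s2 h2 i h26, hB2, hv2]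
    rfl
  clear_value s3
  simp [Cmd.run, State.setMem_mem, NExp.eval, RExp.eval, hW3, hq3]

theorem invNormProg_mem (ω : ℕ → ℝ) (s : State) {d : ℕ} (h0 : s.reg 0 = d) :
    (invNormProg.run ω s).mem 17 0 0 = invNormSq (s.mat 0 d d) := by
  rw [invNormProg, Cmd.run_seq]
  set s1 := (Cmd.setMem 17 (.lit 0) (.lit 0) (.nat (.lit 0))).run ω s with hs1
  have h1 : s1.reg 0 = d := h0
  have hB1 : s1.mat 0 d d = s.mat 0 d d := Cmd.mat_run (by decide) _ _
  have hW1 : s1.mem 17 0 0 = 0 := by simp [hs1, Cmd.run, State.setMem_mem, NExp.eval, RExp.eval]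
  clear_value s1
  set F : ℕ → ℝ := fun u => if h : u < d then 1 / distSq (s.mat 0 d d) ⟨u, h⟩ else 0 with hF
  have main := Cmd.run_loop_induct (ω := ω) (x := 6) (e := .reg 0) (p := distProg) h1
    (fun n s' => s'.mem 17 0 0 = ∑ u ∈ Finset.range n, F u) (by simpa using hW1) ?_
  · rw [main, Finset.sum_range, invNormSq]
    simp [hF]
  intro n hn s2 hA h17
  have h2 : s2.reg 0 = d := (hA.1 0 (by decide)).trans h1
  have hB2 : s2.mat 0 d d = s.mat 0 d d := by
    rw [← hB1]
    unfold State.mat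
    rw [hA.2 0 (by decide)]
  rw [distProg_mem ω _ (by simpa using h2) ⟨n, hn⟩ (by simp), Finset.sum_range_succ]
  congr 1
  simp [hF, hn]
  rw [← hB2]
  rfl

end BDDLasso
end

noncomputable section

namespace BDDLasso

/-! ### The two programs -/

/-- Fill the first `m - k` rows of array `8` with samples. -/
def sampleProg : Cmd :=
  .loop 6 (.sub (.reg 2) (.reg 1)) (.loop 7 (.reg 0) (.sample 8 (.reg 6) (.reg 7)))

/-- After i rows the tape position is i d, so the samples land at the indices used by `tapeMatrix`.
-/
theorem sampleProg_mat (ω : ℕ → ℝ) (s : State) {p d : ℕ} (h0 : s.reg 0 = d)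
    (hp : s.reg 2 - s.reg 1 = p) (hpos : s.pos = 0) :
    (sampleProg.run ω s).mat 8 p d = tapeMatrix p d ω := by
  have main := Cmd.run_loop_induct (ω := ω) (x := 6) (e := .sub (.reg 2) (.reg 1)) (s := s)
    (p := .loop 7 (.reg 0) (.sample 8 (.reg 6) (.reg 7))) hp
    (fun i s' => s'.pos = i * d ∧ ∀ i' j', i' < i → j' < d → s'.mem 8 i' j' = ω (i' * d + j'))
    ⟨by simpa using hpos, fun _ _ h => absurd h (Nat.not_lt_zero _)⟩ ?_
  · funext i j
    exact main.2 i j i.2 j.2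
  intro i _ s1 hA ⟨h1, h2⟩
  have k0 : ((s1.setReg 6 i).tick 1).reg 0 = d := by
    simpa [h0] using hA.1 0 (by decide)
  have main := Cmd.run_loop_induct (ω := ω) (x := 7) (e := .reg 0) (s := (s1.setReg 6 i).tick 1)
    (p := .sample 8 (.reg 6) (.reg 7)) k0
    (fun j s' => s'.pos = i * d + j ∧ ∀ i' j', (i' < i ∧ j' < d ∨ i' = i ∧ j' < j) →
      s'.mem 8 i' j' = ω (i' * d + j'))
    ⟨by simpa using h1, fun i' j' h => h2 i' j' (by omega) (by omega)⟩ ?_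
  · exact ⟨by rw [main.1]; ring, fun i' j' hi hj => main.2 i' j' (by omega)⟩
  intro j _ s2 hA2 ⟨h3, h4⟩
  have k6 : s2.reg 6 = i := by
    simpa using hA2.1 6 (by decide)
  refine ⟨by simp [Cmd.run, h3]; ring, fun i' j' h => ?_⟩
  simp only [Cmd.run, State.setMem_mem, NExp.eval, State.tick_reg, State.setReg_reg,
    State.tick_mem, State.setReg_mem, State.tick_pos, State.setReg_pos, Function.update_self, h3,
    Function.update_of_ne (show (6 : ℕ) ≠ 7 by decide), k6, true_and]
  by_cases h' : i' = i ∧ j' = j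
  · rw [if_pos h', h'.1, h'.2]
  · rw [if_neg h']
    exact h4 i' j' (by omega)

/-- The registers `3`, `4`, `5`, `9` become `d / k`, `2 ^ (d / k)`, `m - k`, `k * 2 ^ (d / k)`. -/
def setup : Cmd := .seq setupDiv (.seq setupPow setupMul)

/-- The registers that are constant after the setup. -/
structure ParamRegs (d k m : ℕ) (s : State) : Prop where
  zero : s.reg 0 = d
  one : s.reg 1 = k
  three : s.reg 3 = d / k
  four : s.reg 4 = 2 ^ (d / k)
  five : s.reg 5 = m - k
  nine : s.reg 9 = k * 2 ^ (d / k)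

theorem setup_spec (ω : ℕ → ℝ) (s : State) {d k m : ℕ} (hk : 0 < k) (h0 : s.reg 0 = d)
    (h1 : s.reg 1 = k) (h2 : s.reg 2 = m) : ParamRegs d k m (setup.run ω s) := by
  have h3 : (setupDiv.run ω s).reg 3 = d / k := by
    rw [setupDiv_reg_three ω s (by omega), h0, h1]
  have h4 : (setupPow.run ω (setupDiv.run ω s)).reg 4 = 2 ^ (d / k) := by
    rw [setupPow_reg_four, h3]
  have k1 : (setupPow.run ω (setupDiv.run ω s)).reg 1 = k :=
    (Cmd.reg_run (by decide)).trans ((Cmd.reg_run (by decide)).trans h1)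
  refine ⟨?_, ?_, ?_, ?_, ?_, ?_⟩
  · exact (Cmd.reg_run (by decide)).trans h0
  · exact (Cmd.reg_run (by decide)).trans h1
  · exact (Cmd.reg_run (p := setupMul) (by decide)).trans ((Cmd.reg_run (by decide)).trans h3)
  · exact (Cmd.reg_run (p := setupMul) (by decide)).trans h4
  · refine (Cmd.reg_run (p := setupMul) (by decide)).trans ((Cmd.reg_run (by decide)).trans ?_)
    rw [setupDiv_reg_five, h1, h2]
  · refine (setupMul_reg_nine _ _).trans ?_
    rw [k1, h4]

theorem ParamRegs.run {d k m : ℕ} {s : State} (h : ParamRegs d k m s) {p : Cmd} (ω : ℕ → ℝ)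
    (hp : ∀ r ∈ [0, 1, 3, 4, 5, 9], r ∉ p.regs) : ParamRegs d k m (p.run ω s) :=
  ⟨(Cmd.reg_run (hp 0 (by simp))).trans h.zero, (Cmd.reg_run (hp 1 (by simp))).trans h.one,
    (Cmd.reg_run (hp 3 (by simp))).trans h.three, (Cmd.reg_run (hp 4 (by simp))).trans h.four,
    (Cmd.reg_run (hp 5 (by simp))).trans h.five, (Cmd.reg_run (hp 9 (by simp))).trans h.nine⟩

theorem ParamRegs.le {d k m : ℕ} {s : State} (h : ParamRegs d k m s) (hk : 0 < k) (hkd : k ≤ d)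
    (hm : d ≤ m) (r : ℕ) (hr : r ∈ [0, 1, 3, 4, 5, 9]) : s.reg r ≤ m + k * 2 ^ (d / k) := by
  have h1 : d / k ≤ d := Nat.div_le_self _ _
  have h2 : 2 ^ (d / k) ≤ k * 2 ^ (d / k) := Nat.le_mul_of_pos_left _ hk
  simp only [List.mem_cons, List.not_mem_nil, or_false] at hr
  rcases hr with rfl | rfl | rfl | rfl | rfl | rfl
  · rw [h.zero]; omega
  · rw [h.one]; omega
  · rw [h.three]; omega
  · rw [h.four]; omega
  · rw [h.five]; omega
  · rw [h.nine]; omega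

theorem gadget_mat (ω : ℕ → ℝ) {s : State} {d k m : ℕ} (h : ParamRegs d k m s) (hN : 0 < d / k)
    (h12 : ∀ i j, s.mem 12 i j = 0) (h13 : ∀ i j, s.mem 13 i j = 0) :
    (gadget.run ω s).mat 12 d (k * 2 ^ (d / k)) = gSparse d k ∧
      (gadget.run ω s).mat 13 k (k * 2 ^ (d / k)) = gPartite d k := by
  obtain ⟨h1, h2⟩ := gadget_spec ω s hN h.one h.three h.four h12 h13
  refine ⟨?_, ?_⟩
  · funext i j
    simp [State.mat, h1, gadgetEntry, gSparse]
  · funext i j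
    simp [State.mat, h2, gPartite]

/-- Cell `(0, 0)` of array `14` becomes the scalar `γ`. -/
def gammaProg : Cmd :=
  .setMem 14 (.lit 0) (.lit 0) (.mul (.mul (.mul (.nat (.lit 10)) (.sqrt (.nat (.lit 3))))
    (.get 7 (.lit 0) (.lit 0))) (.sqrt (.div (.mul (.nat (.reg 0)) (.nat (.reg 5)))
      (.nat (.reg 1)))))

/-- Cell `(0, 0)` of array `4` becomes the regularization parameter. -/
def lamProg : Cmd :=
  .setMem 4 (.lit 0) (.lit 0) (.div (.nat (.lit 1)) (.mul (.mul (.nat (.lit 20)) (.nat (.reg 0)))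
    (.get 17 (.lit 0) (.lit 0))))

/-- The lower block of the design matrix. -/
def designProg : Cmd :=
  sumFill 2 (.reg 5) (.reg 1) (.reg 9) (.lit 1)
    (.mul (.get 14 (.lit 0) (.lit 0)) (.get 13 (.reg 20) (.reg 21)))

/-- The upper part of the response vector. -/
def responseProg : Cmd :=
  sumFill 3 (.lit 0) (.reg 5) (.lit 1) (.reg 0)
    (.mul (.get 8 (.reg 20) (.reg 22)) (.get 1 (.reg 22) (.lit 0)))

/-- The lower part of the response vector. -/
def constProg : Cmd :=
  sumFill 3 (.reg 5) (.reg 1) (.lit 1) (.lit 1) (.get 14 (.lit 0) (.lit 0))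

/-- The scalars `γ` and `lam`. -/
def scalarProg : Cmd := .seq sigmaProg (.seq gammaProg (.seq invNormProg lamProg))

/-- The matrix `X`. -/
def matrixProg : Cmd :=
  .seq (mulArr 9 8 0 (.reg 5) (.reg 0) (.reg 0)) (.seq (mulArr 2 9 12 (.reg 5) (.reg 9) (.reg 0))
    designProg)

/-- The vector `y`. -/
def vectorProg : Cmd := .seq responseProg constProg

/-- The computations of the preprocessing after sampling and setup. -/
def instanceProg : Cmd := .seq gadget (.seq scalarProg (.seq matrixProg vectorProg))

/-- The preprocessing. -/
def preProg : Cmd := .seq sampleProg (.seq setup instanceProg)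

/-- The decoding of a regression vector in array `0`: every coordinate `x` is replaced by
`(1 + sign (x - 1 / 2)) / 2`. -/
def decodeProg : Cmd :=
  sumFill 1 (.lit 0) (.reg 0) (.lit 1) (.reg 9) (.mul (.get 12 (.reg 20) (.reg 22))
    (.div (.add (.nat (.lit 1)) (.div
      (.sub (.get 0 (.reg 22) (.lit 0)) (.div (.nat (.lit 1)) (.nat (.lit 2))))
      (.sqrt (.mul (.sub (.get 0 (.reg 22) (.lit 0)) (.div (.nat (.lit 1)) (.nat (.lit 2))))
        (.sub (.get 0 (.reg 22) (.lit 0)) (.div (.nat (.lit 1)) (.nat (.lit 2))))))))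
      (.nat (.lit 2))))

/-- The postprocessing. -/
def postProg : Cmd := .seq setup (.seq gadget decodeProg)

/-- The scalar `γ` chosen by the preprocessing. -/
def gammaVal {d : ℕ} (k m : ℕ) (B : Matrix (Fin d) (Fin d) ℝ) : ℝ :=
  10 * √3 * sigmaEst B * √((d : ℝ) * (m - k : ℕ) / k)

/-- The regularization parameter chosen by the preprocessing. -/
def lamVal {d : ℕ} (B : Matrix (Fin d) (Fin d) ℝ) : ℝ := 1 / (20 * d * invNormSq B)

theorem scalarProg_mem (ω : ℕ → ℝ) {s : State} {d k m : ℕ} (h : ParamRegs d k m s) :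
    (scalarProg.run ω s).mem 14 0 0 = gammaVal k m (s.mat 0 d d) ∧
      (scalarProg.run ω s).mem 4 0 0 = lamVal (s.mat 0 d d) := by
  rw [scalarProg, Cmd.run_seq, Cmd.run_seq, Cmd.run_seq]
  have h1 : ParamRegs d k m (sigmaProg.run ω s) := h.run ω (by decide)
  have e1 := sigmaProg_mem ω s h.zero
  have b1 : (sigmaProg.run ω s).mat 0 d d = s.mat 0 d d := Cmd.mat_run (by decide) _ _
  generalize sigmaProg.run ω s = s1 at h1 e1 b1
  have h2 : ParamRegs d k m (gammaProg.run ω s1) := h1.run ω (by decide)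
  have b2 : (gammaProg.run ω s1).mat 0 d d = s.mat 0 d d :=
    (Cmd.mat_run (by decide) _ _).trans b1
  have e2 : (gammaProg.run ω s1).mem 14 0 0 = gammaVal k m (s.mat 0 d d) := by
    simp [gammaProg, Cmd.run, State.setMem_mem, RExp.eval, NExp.eval, e1, h1.zero, h1.one, h1.five,
      gammaVal]
  generalize gammaProg.run ω s1 = s2 at h2 b2 e2
  have h3 : ParamRegs d k m (invNormProg.run ω s2) := h2.run ω (by decide)
  have e3 := invNormProg_mem ω s2 h2.zero
  have k3 : (invNormProg.run ω s2).mem 14 = s2.mem 14 := Cmd.mem_run (by decide)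
  rw [b2] at e3
  generalize invNormProg.run ω s2 = s3 at h3 e3 k3
  constructor
  · rw [Cmd.mem_run (by decide), k3, e2]
  · simp [lamProg, Cmd.run, State.setMem_mem, RExp.eval, NExp.eval, e3, h3.zero, lamVal]

theorem matrixProg_mem (ω : ℕ → ℝ) {s : State} {d k m : ℕ} (h : ParamRegs d k m s) :
    (∀ (i : Fin (m - k)) (j : Fin (k * 2 ^ (d / k))), (matrixProg.run ω s).mem 2 i j =
      (s.mat 8 (m - k) d * s.mat 0 d d * s.mat 12 d (k * 2 ^ (d / k))) i j) ∧
    ∀ (b : Fin k) (j : Fin (k * 2 ^ (d / k))), (matrixProg.run ω s).mem 2 (m - k + b) j =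
      s.mem 14 0 0 * s.mem 13 b j := by
  rw [matrixProg, Cmd.run_seq, Cmd.run_seq]
  set s1 := (mulArr 9 8 0 (.reg 5) (.reg 0) (.reg 0)).run ω s with hs1
  have h1 : ParamRegs d k m s1 := h.run ω (by decide)
  have e1 : s1.mat 9 (m - k) d = s.mat 8 (m - k) d * s.mat 0 d d :=
    mulArr_mat ω (m - k) d d (by simp [NExp.regs]) h.five h.zero h.zero (by decide) (by decide)
  have g1 : s1.mat 12 d (k * 2 ^ (d / k)) = s.mat 12 d (k * 2 ^ (d / k)) :=
    Cmd.mat_run (by decide) _ _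
  have p1 : s1.mem 13 = s.mem 13 := Cmd.mem_run (by decide)
  have q1 : s1.mem 14 = s.mem 14 := Cmd.mem_run (by decide)
  clear_value s1
  set s2 := (mulArr 2 9 12 (.reg 5) (.reg 9) (.reg 0)).run ω s1 with hs2
  have h2 : ParamRegs d k m s2 := h1.run ω (by decide)
  have e2 : s2.mat 2 (m - k) (k * 2 ^ (d / k)) =
      s.mat 8 (m - k) d * s.mat 0 d d * s.mat 12 d (k * 2 ^ (d / k)) := by
    rw [← e1, ← g1]
    exact mulArr_mat ω (m - k) _ d (by simp [NExp.regs]) h1.five h1.nine h1.zero (by decide)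
      (by decide)
  have p2 : s2.mem 13 = s.mem 13 := (Cmd.mem_run (by decide)).trans p1
  have q2 : s2.mem 14 = s.mem 14 := (Cmd.mem_run (by decide)).trans q1
  clear_value s2
  -- The lower block is written at row offset m - k. The upper block lies outside this rectangle and
  -- survives.
  have e3 := sumFill_spec (a := 2) (off := .reg 5) (nx := .reg 1) (ny := .reg 9) (nl := .lit 1)
    (e := .mul (.get 14 (.lit 0) (.lit 0)) (.get 13 (.reg 20) (.reg 21))) (ω := ω) (s := s2)
    k (k * 2 ^ (d / k)) 1 (m - k) (by simp [NExp.regs]) h2.five h2.one h2.nine rfl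
    (fun i j _ => s.mem 14 0 0 * s.mem 13 i j) (fun s' hA _ _ _ => by
      simp [RExp.eval, NExp.eval, hA.2 13 (by simp), hA.2 14 (by simp), p2, q2])
  refine ⟨fun i j => ?_, fun b j => ?_⟩
  · refine (e3 i j).trans ?_
    rw [if_neg (by omega), ← e2]
    rfl
  · refine (e3 _ j).trans ?_
    rw [if_pos (by omega)]
    simp

theorem vectorProg_mem (ω : ℕ → ℝ) {s : State} {d k m : ℕ} (h : ParamRegs d k m s) :
    (∀ (i : Fin (m - k)), (vectorProg.run ω s).mem 3 i 0 =
      (s.mat 8 (m - k) d *ᵥ fun j : Fin d => s.mem 1 j 0) i) ∧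
    ∀ (b : Fin k), (vectorProg.run ω s).mem 3 (m - k + b) 0 = s.mem 14 0 0 := by
  rw [vectorProg, Cmd.run_seq]
  have h1 : ParamRegs d k m (responseProg.run ω s) := h.run ω (by decide)
  have e1 := sumFill_spec (a := 3) (off := .lit 0) (nx := .reg 5) (ny := .lit 1) (nl := .reg 0)
    (e := .mul (.get 8 (.reg 20) (.reg 22)) (.get 1 (.reg 22) (.lit 0))) (ω := ω) (s := s)
    (m - k) 1 d 0 (by simp [NExp.regs]) rfl h.five rfl h.zero
    (fun i _ u => s.mem 8 i u * s.mem 1 u 0) (fun s' hA _ _ _ => by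
      simp [RExp.eval, NExp.eval, hA.2 8 (by simp), hA.2 1 (by simp)])
  have q1 : (responseProg.run ω s).mem 14 = s.mem 14 := Cmd.mem_run (by decide)
  change ∀ i j, (responseProg.run ω s).mem 3 i j = _ at e1
  generalize responseProg.run ω s = s1 at h1 e1 q1
  have e2 := sumFill_spec (a := 3) (off := .reg 5) (nx := .reg 1) (ny := .lit 1) (nl := .lit 1)
    (e := .get 14 (.lit 0) (.lit 0)) (ω := ω) (s := s1)
    k 1 1 (m - k) (by simp [NExp.regs]) h1.five h1.one rfl rfl
    (fun _ _ _ => s.mem 14 0 0) (fun s' hA _ _ _ => by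
      simp [RExp.eval, NExp.eval, hA.2 14 (by simp), q1])
  refine ⟨fun i => ?_, fun b => ?_⟩
  · refine (e2 i 0).trans ?_
    rw [if_neg (by omega), e1, if_pos (by omega), Finset.sum_range]
    rfl
  · refine (e2 _ 0).trans ?_
    rw [if_pos (by omega)]
    simp

theorem preInit_mat {d k m : ℕ} (B : Matrix (Fin d) (Fin d) ℝ) (t : Fin d → ℝ) :
    (preInit d k m B t).mat 0 d d = B := by
  funext i j
  simp [State.mat, preInit]

/-- The stages leave B, t, the samples and the gadgets intact until they are used. For given k and
m, γ and λ depend on B alone, as the quantifiers of `SolvesViaLasso` require. -/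
theorem preProg_holds {d k m : ℕ} (hk : 0 < k) (hkd : k ≤ d)
    (B : Matrix (Fin d) (Fin d) ℝ) (t : Fin d → ℝ) (ω : ℕ → ℝ) :
    HoldsLassoInstance (preProg.run ω (preInit d k m B t))
      (design d k m B (tapeMatrix (m - k) d ω) (gammaVal k m B))
      (response d k m t (tapeMatrix (m - k) d ω) (gammaVal k m B)) (lamVal B) := by
  rw [preProg, Cmd.run_seq, Cmd.run_seq, instanceProg, Cmd.run_seq, Cmd.run_seq, Cmd.run_seq]
  set s0 := preInit d k m B t with hs0
  have B0 : s0.mat 0 d d = B := preInit_mat B t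
  have t0 : ∀ j : Fin d, s0.mem 1 j 0 = t j := by simp [hs0, preInit]
  have z12 : ∀ i j, s0.mem 12 i j = 0 := by simp [hs0, preInit]
  have z13 : ∀ i j, s0.mem 13 i j = 0 := by simp [hs0, preInit]
  have R1 := sampleProg_mat ω s0 (d := d) (p := m - k) rfl rfl rfl
  set s1 := sampleProg.run ω s0 with hs1
  have hp2 := setup_spec ω s1 (d := d) (k := k) (m := m) hk (Cmd.reg_run (by decide))
    (Cmd.reg_run (by decide)) (Cmd.reg_run (by decide))
  set s2 := setup.run ω s1 with hs2
  have f2 : ∀ a, a ≠ 8 → s2.mem a = s0.mem a := fun a ha =>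
    (Cmd.mem_run (by simp [setup, setupDiv, setupPow, setupMul, Cmd.arrs])).trans
      (Cmd.mem_run (by simp [sampleProg, Cmd.arrs, ha]))
  have R2 : s2.mat 8 (m - k) d = tapeMatrix (m - k) d ω := (Cmd.mat_run (by decide) _ _).trans R1
  have B2 : s2.mat 0 d d = B := by
    rw [← B0]; unfold State.mat; rw [f2 0 (by decide)]
  have t2 : ∀ j : Fin d, s2.mem 1 j 0 = t j := by rw [f2 1 (by decide)]; exact t0
  have G3 := gadget_mat ω hp2 (Nat.div_pos hkd hk) (by rw [f2 12 (by decide)]; exact z12)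
    (by rw [f2 13 (by decide)]; exact z13)
  clear_value s2
  have hp3 : ParamRegs d k m (gadget.run ω s2) := hp2.run ω (by decide)
  have R3 : (gadget.run ω s2).mat 8 (m - k) d = _ := (Cmd.mat_run (by decide) _ _).trans R2
  have B3 : (gadget.run ω s2).mat 0 d d = _ := (Cmd.mat_run (by decide) _ _).trans B2
  have t3 : (gadget.run ω s2).mem 1 = s2.mem 1 := Cmd.mem_run (by decide)
  generalize gadget.run ω s2 = s3 at hp3 R3 B3 t3 G3
  have hp4 : ParamRegs d k m (scalarProg.run ω s3) := hp3.run ω (by decide)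
  have c4 := scalarProg_mem ω hp3
  rw [B3] at c4
  have R4 : (scalarProg.run ω s3).mat 8 (m - k) d = _ := (Cmd.mat_run (by decide) _ _).trans R3
  have B4 : (scalarProg.run ω s3).mat 0 d d = _ := (Cmd.mat_run (by decide) _ _).trans B3
  have G4 : (scalarProg.run ω s3).mat 12 d (k * 2 ^ (d / k)) = _ :=
    (Cmd.mat_run (by decide) _ _).trans G3.1
  have P4 : (scalarProg.run ω s3).mat 13 k (k * 2 ^ (d / k)) = _ :=
    (Cmd.mat_run (by decide) _ _).trans G3.2
  have t4 : (scalarProg.run ω s3).mem 1 = s2.mem 1 := (Cmd.mem_run (by decide)).trans t3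
  generalize scalarProg.run ω s3 = s4 at hp4 R4 B4 t4 G4 P4 c4
  have hp5 : ParamRegs d k m (matrixProg.run ω s4) := hp4.run ω (by decide)
  have X5 := matrixProg_mem ω hp4
  have R5 : (matrixProg.run ω s4).mat 8 (m - k) d = _ := (Cmd.mat_run (by decide) _ _).trans R4
  have t5 : (matrixProg.run ω s4).mem 1 = s2.mem 1 := (Cmd.mem_run (by decide)).trans t4
  have c5 : (matrixProg.run ω s4).mem 14 = s4.mem 14 := Cmd.mem_run (by decide)
  have l5 : (matrixProg.run ω s4).mem 4 = s4.mem 4 := Cmd.mem_run (by decide)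
  generalize matrixProg.run ω s4 = s5 at hp5 R5 t5 X5 c5 l5
  have y6 := vectorProg_mem ω hp5
  have X6 : (vectorProg.run ω s5).mem 2 = s5.mem 2 := Cmd.mem_run (by decide)
  have l6 : (vectorProg.run ω s5).mem 4 = s5.mem 4 := Cmd.mem_run (by decide)
  rw [HoldsLassoInstance, X6, l6, l5]
  refine ⟨fun r j => ?_, fun r => ?_, c4.2⟩
  · rcases r with i | b
    · rw [finSumFinEquiv_apply_left, Fin.val_castAdd, X5.1, R4, B4, G4]
      rfl
    · rw [finSumFinEquiv_apply_right, Fin.val_natAdd, X5.2, c4.1,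
        show s4.mem 13 b j = _ from congrFun (congrFun P4 b) j]
      rfl
  · rcases r with i | b
    · rw [finSumFinEquiv_apply_left, Fin.val_castAdd, y6.1, R5, t5, funext t2]
      rfl
    · rw [finSumFinEquiv_apply_right, Fin.val_natAdd, y6.2, c5, c4.1]
      rfl

/-- x / √(x²) is the sign of x for x ≠ 0 and replaces rounding. An entry equal to 1/2 would give the
value 1/2, since division by zero is zero; the strict bound on the error excludes it. -/
theorem postOutput_postProg {d k m : ℕ} (hk : 0 < k) (hkd : k ≤ d)
    (θ : Fin (k * 2 ^ (d / k)) → ℝ) :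
    postOutput postProg d k m θ = gSparse d k *ᵥ fun j =>
      (1 + (θ j - 1 / 2) / √((θ j - 1 / 2) * (θ j - 1 / 2))) / 2 := by
  funext i
  rw [postOutput, postProg, Cmd.run_seq, Cmd.run_seq]
  generalize (fun _ => 0 : ℕ → ℝ) = ω
  set s0 := postInit d k m θ with hs0
  have z : ∀ a i j, a ≠ 0 → s0.mem a i j = 0 := by
    intro a i j ha
    simp [hs0, postInit, ha]
  have θ0 : ∀ j : Fin (k * 2 ^ (d / k)), s0.mem 0 j 0 = θ j := by simp [hs0, postInit]
  have hp1 := setup_spec ω s0 (d := d) (k := k) (m := m) hk rfl rfl rfl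
  have f1 : ∀ a, (setup.run ω s0).mem a = s0.mem a := fun a =>
    Cmd.mem_run (by simp [setup, setupDiv, setupPow, setupMul, Cmd.arrs])
  generalize setup.run ω s0 = s1 at hp1 f1
  have G2 := (gadget_mat ω hp1 (Nat.div_pos hkd hk) (fun i j => by rw [f1, z 12 i j (by decide)])
    (fun i j => by rw [f1, z 13 i j (by decide)])).1
  have hp2 : ParamRegs d k m (gadget.run ω s1) := hp1.run ω (by decide)
  have θ2 : (gadget.run ω s1).mem 0 = s0.mem 0 := (Cmd.mem_run (by decide)).trans (f1 0)
  generalize gadget.run ω s1 = s2 at hp2 G2 θ2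
  refine (sumFill_spec d 1 (k * 2 ^ (d / k)) 0 (by simp [NExp.regs]) rfl (by exact hp2.zero) rfl
    (by exact hp2.nine) (fun i _ u => s2.mem 12 i u * ((1 + (s2.mem 0 u 0 - 1 / 2) /
      √((s2.mem 0 u 0 - 1 / 2) * (s2.mem 0 u 0 - 1 / 2))) / 2)) (fun s' hA _ _ _ => by
      simp [RExp.eval, NExp.eval, hA.2 12 (by simp), hA.2 0 (by simp)]) _ _).trans ?_
  rw [if_pos (by simp), Finset.sum_range]
  refine Finset.sum_congr rfl fun j _ => ?_
  rw [θ2, θ0, ← G2]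
  rfl

/-! ### Running time -/

theorem time_sampleProg_le {d k m : ℕ} (hkd : k ≤ d) (hm : d ≤ m) (B : Matrix (Fin d) (Fin d) ℝ)
    (t : Fin d → ℝ) (ω : ℕ → ℝ) : (sampleProg.run ω (preInit d k m B t)).time ≤
      sampleProg.cost (m + k * 2 ^ (d / k)) := by
  have h := Cmd.time_run_le sampleProg ω (preInit d k m B t) (m + k * 2 ^ (d / k)) (by decide)
    (by
      intro r hr
      have hr' : r = 2 ∨ r = 1 ∨ r = 0 := by
        simpa [sampleProg, Cmd.loopRegs, NExp.regs] using hr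
      rcases hr' with rfl | rfl | rfl <;> simp [preInit, paramRegs] <;> omega)
  simpa [preInit] using h

/-- `setupPow` loops over register `3`, which `setupDiv` writes, so `Cmd.time_run_le` is applied to
the three pieces separately, with the intermediate register values known. -/
theorem time_setup_le {d k m : ℕ} (hk : 0 < k) (hkd : k ≤ d) (hm : d ≤ m) (ω : ℕ → ℝ) {s : State}
    (h0 : s.reg 0 = d) (h1 : s.reg 1 = k) :
    (setup.run ω s).time ≤ s.time + setup.cost (m + k * 2 ^ (d / k)) := by
  have h3 : (setupDiv.run ω s).reg 3 = d / k := by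
    rw [setupDiv_reg_three ω s (by omega), h0, h1]
  have hN : d / k ≤ d := Nat.div_le_self _ _
  have k1 : (setupPow.run ω (setupDiv.run ω s)).reg 1 = k :=
    (Cmd.reg_run (by decide)).trans ((Cmd.reg_run (by decide)).trans h1)
  have t1 := Cmd.time_run_le setupDiv ω s (m + k * 2 ^ (d / k)) (by decide) (by
    intro r hr
    have hr' : r = 0 := by simpa [setupDiv, Cmd.loopRegs, NExp.regs] using hr
    subst hr'
    omega)
  have t2 := Cmd.time_run_le setupPow ω (setupDiv.run ω s) (m + k * 2 ^ (d / k)) (by decide) (by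
    intro r hr
    have hr' : r = 3 := by simpa [setupPow, Cmd.loopRegs, NExp.regs] using hr
    subst hr'
    omega)
  have t3 := Cmd.time_run_le setupMul ω (setupPow.run ω (setupDiv.run ω s))
    (m + k * 2 ^ (d / k)) (by decide) (by
    intro r hr
    have hr' : r = 1 := by simpa [setupMul, Cmd.loopRegs, NExp.regs] using hr
    subst hr'
    omega)
  simp only [setup, Cmd.run_seq, Cmd.cost] at t1 t2 t3 ⊢
  omega

theorem exists_time_le : ∃ a : ℕ, ∀ d k m : ℕ, 0 < k → k ≤ d → d ≤ m → 2 ≤ m →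
    ∀ (B : Matrix (Fin d) (Fin d) ℝ) (t : Fin d → ℝ) (ω : ℕ → ℝ)
      (θ : Fin (k * 2 ^ (d / k)) → ℝ) (T : ℕ → ℕ → ℕ),
      totalTime preProg postProg T d k m B t ω θ ≤
        (m + k * 2 ^ (d / k)) ^ a + T m (k * 2 ^ (d / k)) := by
  -- The concatenation serves only to get one exponent for both costs; it is never run.
  obtain ⟨a, ha⟩ := (Cmd.seq preProg postProg).cost_le_pow
  refine ⟨a, fun d k m hk hkd hdm hm B t ω θ T => ?_⟩
  set L := m + k * 2 ^ (d / k) with hL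
  have hle : preProg.cost L + postProg.cost L ≤ L ^ a := ha L (by omega)
  have hpre : (preProg.run ω (preInit d k m B t)).time ≤ preProg.cost L := by
    have t1 := time_sampleProg_le hkd hdm B t ω
    have h0 : (sampleProg.run ω (preInit d k m B t)).reg 0 = d := Cmd.reg_run (by decide)
    have h1 : (sampleProg.run ω (preInit d k m B t)).reg 1 = k := Cmd.reg_run (by decide)
    have h2 : (sampleProg.run ω (preInit d k m B t)).reg 2 = m := Cmd.reg_run (by decide)
    have t2 := time_setup_le hk hkd hdm ω h0 h1
    have hp := setup_spec ω _ hk h0 h1 h2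
    have hsub : ∀ r ∈ instanceProg.loopRegs, r ∈ [0, 1, 3, 4, 5, 9] := by decide
    have t3 := Cmd.time_run_le instanceProg ω _ L (by decide)
      (fun r hr => hp.le hk hkd hdm r (hsub r hr))
    simp only [preProg, Cmd.run_seq, Cmd.cost]
    rw [← hL] at t1 t2
    omega
  have hpost : (postProg.run (fun _ => 0) (postInit d k m θ)).time ≤ postProg.cost L := by
    have t2 := time_setup_le hk hkd hdm (fun _ => 0) (s := postInit d k m θ) rfl rfl
    have hp := setup_spec (fun _ => 0) (postInit d k m θ) (d := d) (m := m) hk rfl rfl rfl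
    have hsub : ∀ r ∈ (Cmd.seq gadget decodeProg).loopRegs, r ∈ [0, 1, 3, 4, 5, 9] := by decide
    have t3 := Cmd.time_run_le (Cmd.seq gadget decodeProg) (fun _ => 0) _ L (by decide)
      (fun r hr => hp.le hk hkd hdm r (hsub r hr))
    have e : (postInit d k m θ).time = 0 := rfl
    simp only [postProg, Cmd.run_seq, Cmd.cost] at t3 ⊢
    rw [← hL] at t2
    omega
  rw [totalTime]
  omega

end BDDLasso
end

noncomputable section

namespace BDDLasso

/-! ### Gaussian matrices are well conditioned -/

theorem tapeIndex_injective (p d : ℕ) :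
    Function.Injective fun q : Fin p × Fin d => (q.1 : ℕ) * d + q.2 := by
  rintro ⟨i, j⟩ ⟨i', j'⟩ h
  simp only at h
  have hd : 0 < d := j.pos
  have h1 : (i : ℕ) = i' := by
    have e1 := congrArg (· / d) h
    simp only [Nat.mul_comm _ d, Nat.mul_add_div hd, Nat.div_eq_of_lt j.2,
      Nat.div_eq_of_lt j'.2] at e1
    omega
  have h2 : (j : ℕ) = j' := by
    rw [h1] at h
    omega
  exact Prod.ext (Fin.ext h1) (Fin.ext h2)

theorem infinitePi_gaussian_map_dotProduct {d : ℕ} {v : Fin d → ℝ} (hv : l2norm v = 1) :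
    (Measure.infinitePi fun _ : Fin d => gaussianReal 0 1).map (fun x => x ⬝ᵥ v) =
      gaussianReal 0 1 := by
  set L : StrongDual ℝ (EuclideanSpace ℝ (Fin d)) := innerSL ℝ (WithLp.toLp 2 v) with hL
  have h1 := IsGaussian.map_eq_gaussianReal (μ := stdGaussian (EuclideanSpace ℝ (Fin d))) L
  rw [integral_strongDual_stdGaussian, variance_dual_stdGaussian, hL, innerSL_apply_norm,
    show ‖WithLp.toLp 2 v‖ = 1 from hv, ← map_pi_eq_stdGaussian,
    Measure.map_map (by fun_prop) (by fun_prop)] at h1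
  rw [Measure.infinitePi_eq_pi]
  have h2 : (1 ^ 2 : ℝ).toNNReal = 1 := by simp
  rw [h2] at h1
  refine Eq.trans ?_ h1
  congr 1

/-- The rows occupy disjoint stretches of the tape, so the entries are independent after reindexing
and currying, and each row has a standard Gaussian scalar product with the unit vector v. -/
theorem gaussianTape_map_mulVec (p : ℕ) {d : ℕ} {v : Fin d → ℝ} (hv : l2norm v = 1) :
    gaussianTape.map (fun ω => tapeMatrix p d ω *ᵥ v) =
      Measure.infinitePi fun _ : Fin p => gaussianReal 0 1 := by
  have hm : Measurable fun (x : Fin p → Fin d → ℝ) i => x i ⬝ᵥ v := by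
    unfold dotProduct
    fun_prop
  have h1 : gaussianTape.map (fun ω (q : Fin p × Fin d) => ω (q.1 * d + q.2)) =
      Measure.infinitePi fun _ : Fin p × Fin d => gaussianReal 0 1 :=
    Measure.map_infinitePi_infinitePi_of_inj (tapeIndex_injective p d)
  have h2 := Measure.infinitePi_map_curry (fun (_ : Fin p) (_ : Fin d) => gaussianReal 0 1)
  have h3 := Measure.infinitePi_map_pi
    (fun _ : Fin p => Measure.infinitePi fun _ : Fin d => gaussianReal 0 1)
    (f := fun _ x => x ⬝ᵥ v) (fun _ => by unfold dotProduct; fun_prop)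
  rw [infinitePi_gaussian_map_dotProduct hv, ← h2, ← h1, Measure.map_map, Measure.map_map] at h3
  · rw [← h3]
    congr 1
  · exact hm.comp (MeasurableEquiv.measurable _)
  · fun_prop
  · exact hm
  · exact MeasurableEquiv.measurable _

/-- Moment generating function of a squared standard Gaussian. Negative c is allowed, as the lower
tail needs it. -/
theorem lintegral_exp_mul_sq_gaussian {c : ℝ} (hc : c < 1 / 2) :
    ∫⁻ x, ENNReal.ofReal (Real.exp (c * x ^ 2)) ∂gaussianReal 0 1 =
      ENNReal.ofReal √(1 / (1 - 2 * c)) := by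
  have hb : 0 < 1 / 2 - c := by linarith
  rw [gaussianReal_of_var_ne_zero _ one_ne_zero,
    lintegral_withDensity_eq_lintegral_mul _ (measurable_gaussianPDF 0 1) (by fun_prop)]
  have h1 : ∀ x : ℝ, (gaussianPDF 0 1 * fun x => ENNReal.ofReal (Real.exp (c * x ^ 2))) x =
      ENNReal.ofReal ((√(2 * Real.pi))⁻¹ * Real.exp (-(1 / 2 - c) * x ^ 2)) := by
    intro x
    rw [Pi.mul_apply, gaussianPDF, gaussianPDFReal, ← ENNReal.ofReal_mul (by positivity), mul_assoc,
      ← Real.exp_add]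
    congr 3
    · simp
    · simp
      ring
  simp_rw [h1]
  rw [← ofReal_integral_eq_lintegral_ofReal ((integrable_exp_neg_mul_sq hb).const_mul _)
    (Filter.Eventually.of_forall fun x => by positivity), integral_const_mul, integral_gaussian,
    ← Real.sqrt_inv, ← Real.sqrt_mul (by positivity)]
  congr 2
  have := Real.pi_pos.ne'
  have h2 : 1 - 2 * c ≠ 0 := by linarith
  field_simp

/-- Chernoff's bound for both tails at once: multiplication by c keeps the inequality for c > 0
(upper tail) and reverses it for c < 0 (lower tail). -/
theorem chiSq_tail (p : ℕ) {c : ℝ} (hc : c < 1 / 2) (s : ℝ) :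
    (Measure.infinitePi fun _ : Fin p => gaussianReal 0 1)
      {x | c * (s * p) ≤ c * l2norm x ^ 2} ≤
      ENNReal.ofReal ((Real.exp (-(c * s)) * √(1 / (1 - 2 * c))) ^ p) := by
  set ν := Measure.infinitePi fun _ : Fin p => gaussianReal 0 1
  set F : (Fin p → ℝ) → ENNReal := fun x => ∏ i, ENNReal.ofReal (Real.exp (c * x i ^ 2)) with hF
  have hmeas : Measurable F := by fun_prop
  have hint : ∫⁻ x, F x ∂ν = ENNReal.ofReal √(1 / (1 - 2 * c)) ^ p := by
    rw [hF, lintegral_prod_eq_prod_lintegral_of_indepFun Finset.univ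
      (fun i (x : Fin p → ℝ) => ENNReal.ofReal (Real.exp (c * x i ^ 2)))
      (iIndepFun_infinitePi (X := fun _ x => ENNReal.ofReal (Real.exp (c * x ^ 2)))
        (fun _ => by fun_prop)) (fun _ => by fun_prop)]
    have h1 : ∀ i : Fin p, ∫⁻ x, ENNReal.ofReal (Real.exp (c * x i ^ 2)) ∂ν =
        ENNReal.ofReal √(1 / (1 - 2 * c)) := by
      intro i
      rw [← lintegral_exp_mul_sq_gaussian hc,
        ← Measure.infinitePi_map_eval (fun _ : Fin p => gaussianReal 0 1) i,
        lintegral_map (by fun_prop) (by fun_prop)]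
    exact (Finset.prod_congr rfl fun i _ => h1 i).trans (by simp)
  have hFexp : ∀ x, F x = ENNReal.ofReal (Real.exp (c * l2norm x ^ 2)) := by
    intro x
    rw [hF, l2norm_sq, dotProduct, Finset.mul_sum, Real.exp_sum,
      ENNReal.ofReal_prod_of_nonneg fun _ _ => (Real.exp_pos _).le]
    simp [sq]
  set ε := ENNReal.ofReal (Real.exp (c * (s * p))) with hε
  have hmarkov := mul_meas_ge_le_lintegral (μ := ν) hmeas ε
  have hsub : {x : Fin p → ℝ | c * (s * p) ≤ c * l2norm x ^ 2} ⊆ {x | ε ≤ F x} := by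
    intro x hx
    rw [Set.mem_ofPred_eq, hFexp]
    exact ENNReal.ofReal_le_ofReal (Real.exp_le_exp.2 hx)
  have hε0 : ε ≠ 0 := (ENNReal.ofReal_pos.2 (Real.exp_pos _)).ne'
  calc _ ≤ ν {x | ε ≤ F x} := measure_mono hsub
    _ ≤ (∫⁻ x, F x ∂ν) / ε := by
        rw [ENNReal.le_div_iff_mul_le (Or.inl hε0) (Or.inl ENNReal.ofReal_ne_top), mul_comm]
        exact hmarkov
    _ = _ := by
        rw [hint, hε, ← ENNReal.ofReal_pow (Real.sqrt_nonneg _),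
          ← ENNReal.ofReal_div_of_pos (Real.exp_pos _), mul_pow, ← Real.exp_nat_mul, div_eq_mul_inv,
          ← Real.exp_neg, mul_comm]
        congr 3
        ring

theorem gaussianTape_tail (p : ℕ) {d : ℕ} {v : Fin d → ℝ} (hv : l2norm v = 1) {c : ℝ}
    (hc : c < 1 / 2) (s : ℝ) :
    gaussianTape {ω | c * (s * p) ≤ c * l2norm (tapeMatrix p d ω *ᵥ v) ^ 2} ≤
      ENNReal.ofReal ((Real.exp (-(c * s)) * √(1 / (1 - 2 * c))) ^ p) := by
  refine le_trans (le_of_eq ?_) (chiSq_tail p hc s)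
  rw [← gaussianTape_map_mulVec p hv, Measure.map_apply]
  · rfl
  · unfold tapeMatrix
    rw [measurable_pi_iff]
    intro i
    simp only [mulVec, dotProduct]
    fun_prop
  · refine measurableSet_le measurable_const ?_
    simp only [l2norm_sq, dotProduct]
    fun_prop

/-- Volume comparison: the disjoint balls of radius δ about the points lie in the ball of radius 1 +
δ. -/
theorem card_le_of_separated_unit {d : ℕ} {δ : ℝ} (hδ : 0 < δ)
    (s : Finset (EuclideanSpace ℝ (Fin d))) (hs : ∀ c ∈ s, ‖c‖ ≤ 1)
    (h : ∀ c ∈ s, ∀ c' ∈ s, c ≠ c' → 2 * δ ≤ ‖c - c'‖) : (s.card : ℝ) ≤ ((1 + δ) / δ) ^ d := by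
  have D : Set.Pairwise (s : Set (EuclideanSpace ℝ (Fin d)))
      (Function.onFun Disjoint fun c => Metric.ball c δ) := by
    intro c hc c' hc' hcc
    apply Metric.ball_disjoint_ball
    rw [dist_eq_norm]
    linarith [h c hc c' hc' hcc]
  have hsub : (⋃ c ∈ s, Metric.ball c δ) ⊆ Metric.ball (0 : EuclideanSpace ℝ (Fin d)) (1 + δ) := by
    refine Set.iUnion₂_subset fun x hx => Metric.ball_subset_ball' ?_
    rw [dist_zero_right]
    linarith [hs x hx]
  have hr : Module.finrank ℝ (EuclideanSpace ℝ (Fin d)) = d := by simp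
  set μ : Measure (EuclideanSpace ℝ (Fin d)) := volume
  have I : (s.card : ENNReal) * ENNReal.ofReal (δ ^ d) * μ (Metric.ball 0 1) ≤
      ENNReal.ofReal ((1 + δ) ^ d) * μ (Metric.ball 0 1) := by
    calc _ = μ (⋃ c ∈ s, Metric.ball c δ) := by
          rw [measure_biUnion_finset D fun c _ => measurableSet_ball]
          simp only [μ.addHaar_ball_of_pos _ hδ, hr, Finset.sum_const, nsmul_eq_mul, mul_assoc]
      _ ≤ μ (Metric.ball 0 (1 + δ)) := measure_mono hsub
      _ = _ := by rw [μ.addHaar_ball_of_pos _ (by linarith), hr]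
  have J := (ENNReal.mul_le_mul_iff_left (Metric.measure_ball_pos _ _ zero_lt_one).ne'
    measure_ball_lt_top.ne).1 I
  have K := ENNReal.toReal_le_of_le_ofReal (by positivity) J
  rw [ENNReal.toReal_mul, ENNReal.toReal_ofReal (by positivity), ENNReal.toReal_natCast] at K
  rwa [div_pow, le_div_iff₀ (by positivity)]

/-- A 1/120-separated subset of the sphere of maximal size is a net. Volume comparison with δ =
1/240 gives 241 = (1 + δ)/δ. -/
theorem exists_net (d : ℕ) : ∃ T : Finset (EuclideanSpace ℝ (Fin d)),
    (∀ c ∈ T, ‖c‖ = 1) ∧ T.card ≤ 241 ^ d ∧ ∀ x, ‖x‖ = 1 → ∃ c ∈ T, ‖x - c‖ ≤ 1 / 120 := by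
  set A : Set (EuclideanSpace ℝ (Fin d)) := {x | ‖x‖ = 1}
  have hfin : ∀ s : Finset (EuclideanSpace ℝ (Fin d)), (s : Set _) ⊆ A →
      (∀ c ∈ s, ∀ c' ∈ s, c ≠ c' → 1 / 120 ≤ ‖c - c'‖) → s.card ≤ 241 ^ d := by
    intro s hs h
    have := card_le_of_separated_unit (δ := 1 / 240) (by norm_num) s (fun c hc => (hs hc).le)
      (by norm_num at h ⊢; exact h)
    norm_num at this
    exact_mod_cast this
  set S : Set ℕ := {n | ∃ s : Finset (EuclideanSpace ℝ (Fin d)), (s : Set _) ⊆ A ∧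
      (∀ c ∈ s, ∀ c' ∈ s, c ≠ c' → 1 / 120 ≤ ‖c - c'‖) ∧ s.card = n}
  have hS : BddAbove S := ⟨241 ^ d, by rintro n ⟨s, h1, h2, rfl⟩; exact hfin s h1 h2⟩
  have hne : S.Nonempty := ⟨0, ∅, by simp, by simp, rfl⟩
  obtain ⟨T, hT1, hT2, hT3⟩ := Nat.sSup_mem hne hS
  refine ⟨T, fun c hc => hT1 hc, hfin T hT1 hT2, fun x hx => ?_⟩
  classical
  by_contra! hcon
  have hxT : x ∉ T := fun h => by
    have := hcon x h
    rw [sub_self, norm_zero] at this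
    norm_num at this
  have : T.card + 1 ∈ S := by
    refine ⟨insert x T, ?_, ?_, Finset.card_insert_of_notMem hxT⟩
    · intro y hy
      rcases Finset.mem_insert.1 hy with rfl | hy
      · exact hx
      · exact hT1 hy
    · intro c hc c' hc' hcc
      rcases Finset.mem_insert.1 hc with h | hc <;> rcases Finset.mem_insert.1 hc' with h' | hc'
      · exact absurd (h.trans h'.symm) hcc
      · rw [h]
        exact (hcon c' hc').le
      · rw [h', norm_sub_rev]
        exact (hcon c hc).le
      · exact hT2 c hc c' hc' hcc
  have := le_csSup hS this
  omega

/-- All singular values of the matrix are of the order of `√p`. -/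
def WellConditioned {p d : ℕ} (R : Matrix (Fin p) (Fin d) ℝ) : Prop :=
  ∀ v : Fin d → ℝ, √p / 15 * l2norm v ≤ l2norm (R *ᵥ v) ∧ l2norm (R *ᵥ v) ≤ 4 * √p * l2norm v

theorem wellConditioned_of_net {p d : ℕ} {R : Matrix (Fin p) (Fin d) ℝ}
    {T : Finset (EuclideanSpace ℝ (Fin d))}
    (hT : ∀ x, ‖x‖ = 1 → ∃ c ∈ T, ‖x - c‖ ≤ 1 / 120)
    (hlow : ∀ c ∈ T, √p / 10 ≤ l2norm (R *ᵥ c.ofLp))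
    (hupp : ∀ c ∈ T, l2norm (R *ᵥ c.ofLp) ≤ 3 * √p) : WellConditioned R := by
  set L : EuclideanSpace ℝ (Fin d) →L[ℝ] EuclideanSpace ℝ (Fin p) :=
    (Matrix.toEuclideanLin R).toContinuousLinearMap
  have hLv : ∀ x, ‖L x‖ = l2norm (R *ᵥ x.ofLp) := fun x => rfl
  have hp := Real.sqrt_nonneg (p : ℝ)
  have hL0 := norm_nonneg L
  have hdiff : ∀ x c, ‖x - c‖ ≤ 1 / 120 → ‖L x - L c‖ ≤ ‖L‖ / 120 := fun x c h => by
    rw [← map_sub]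
    refine (L.le_opNorm _).trans ?_
    calc _ ≤ ‖L‖ * (1 / 120) := mul_le_mul_of_nonneg_left h hL0
      _ = _ := by ring
  -- The unknown norm stands on both sides, but with factor 1/120 on the right, so it can be solved
  -- for.
  have hL1 : ‖L‖ ≤ 3 * √p + ‖L‖ / 120 := by
    refine L.opNorm_le_of_unit_norm (by positivity) fun x hx => ?_
    obtain ⟨c, hc, hxc⟩ := hT x hx
    have h1 := hupp c hc
    rw [← hLv] at h1
    have h2 := norm_sub_norm_le (L x) (L c)
    linarith [hdiff x c hxc]
  have hL2 : ‖L‖ ≤ 4 * √p := by linarith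
  have hL3 : ‖L‖ / 120 ≤ √p / 30 := by linarith
  -- The distance to the net costs at most √p/30, and 1/10 - 1/30 = 1/15.
  have hunit : ∀ x, ‖x‖ = 1 → √p / 15 ≤ ‖L x‖ := by
    intro x hx
    obtain ⟨c, hc, hxc⟩ := hT x hx
    have h1 := hlow c hc
    rw [← hLv] at h1
    have h2 := norm_sub_norm_le (L c) (L x)
    rw [norm_sub_rev] at h2
    have := hdiff x c hxc
    linarith
  intro v
  set x : EuclideanSpace ℝ (Fin d) := WithLp.toLp 2 v with hx
  have e1 : l2norm v = ‖x‖ := rfl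
  have e2 : l2norm (R *ᵥ v) = ‖L x‖ := rfl
  rw [e1, e2]
  refine ⟨?_, (L.le_opNorm x).trans (mul_le_mul_of_nonneg_right hL2 (norm_nonneg _))⟩
  rcases (norm_nonneg x).eq_or_lt with h | h
  · rw [← h, mul_zero]
    exact norm_nonneg _
  · have h1 := hunit (‖x‖⁻¹ • x) (by rw [norm_smul, norm_inv, norm_norm, inv_mul_cancel₀ h.ne'])
    rw [map_smul, norm_smul, norm_inv, norm_norm, ← div_eq_inv_mul, le_div_iff₀ h] at h1
    exact h1

/-- Each tail at a net point has probability at most e^(-3p/2). The net has at most 241^d ≤ e^(6d) ≤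
e^(3p/8) points and 2 ≤ e^(p/8), so the union bound gives e^(-p). -/
theorem gaussianTape_not_wellConditioned {p d : ℕ} (hd : 0 < d) (hp : 16 * d ≤ p) :
    gaussianTape {ω | ¬ WellConditioned (tapeMatrix p d ω)} ≤ ENNReal.ofReal (Real.exp (-p)) := by
  obtain ⟨T, hT1, hT2, hT3⟩ := exists_net d
  -- Upper tail ‖Rc‖² ≥ 9p. The parameter 3/8 makes the root in `chiSq_tail` equal to 2.
  set U : EuclideanSpace ℝ (Fin d) → Set (ℕ → ℝ) := fun c =>
    {ω | (3 / 8 : ℝ) * (9 * p) ≤ 3 / 8 * l2norm (tapeMatrix p d ω *ᵥ c.ofLp) ^ 2}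
  -- Lower tail ‖Rc‖² ≤ p/100. The parameter -40 makes the root equal to 1/9.
  set V : EuclideanSpace ℝ (Fin d) → Set (ℕ → ℝ) := fun c =>
    {ω | (-40 : ℝ) * (1 / 100 * p) ≤ -40 * l2norm (tapeMatrix p d ω *ᵥ c.ofLp) ^ 2}
  have hsub : {ω | ¬ WellConditioned (tapeMatrix p d ω)} ⊆ ⋃ c ∈ T, U c ∪ V c := by
    intro ω hω
    by_contra hcon
    simp only [Set.mem_iUnion, Set.mem_union, not_exists, not_or] at hcon
    refine hω (wellConditioned_of_net hT3 (fun c hc => ?_) fun c hc => ?_)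
    · have h := (hcon c hc).2
      simp only [V, Set.mem_ofPred_eq, not_le] at h
      refine le_of_sq_le_sq ?_ (l2norm_nonneg _)
      rw [div_pow, Real.sq_sqrt (Nat.cast_nonneg p)]
      linarith
    · have h := (hcon c hc).1
      simp only [U, Set.mem_ofPred_eq, not_le] at h
      refine le_of_sq_le_sq ?_ (by positivity)
      rw [mul_pow, Real.sq_sqrt (Nat.cast_nonneg p)]
      linarith
  have hexp2 : Real.exp 2 ≤ 9 := by
    have h := Real.exp_one_lt_d9
    have : Real.exp 2 = Real.exp 1 ^ 2 := by rw [← Real.exp_nat_mul]; norm_num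
    rw [this]
    nlinarith [Real.exp_pos 1]
  have hU : ∀ c ∈ T, gaussianTape (U c) ≤ ENNReal.ofReal (Real.exp (-(3 / 2 * p))) := by
    intro c hc
    refine (gaussianTape_tail p (hT1 c hc) (by norm_num) 9).trans (ENNReal.ofReal_le_ofReal ?_)
    rw [show -(3 / 2 * (p : ℝ)) = p * (-(3 / 2)) by ring, Real.exp_nat_mul]
    refine pow_le_pow_left₀ (by positivity) ?_ p
    have h1 : √(1 / (1 - 2 * (3 / 8)) : ℝ) = 2 := by
      rw [show (1 / (1 - 2 * (3 / 8)) : ℝ) = 2 ^ 2 by norm_num, Real.sqrt_sq (by norm_num)]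
    have h2 : (2 : ℝ) ≤ Real.exp (15 / 8) := by
      have := Real.add_one_le_exp (15 / 8 : ℝ)
      linarith
    rw [h1]
    calc _ ≤ Real.exp (-(3 / 8 * 9)) * Real.exp (15 / 8) := by gcongr
      _ = _ := by rw [← Real.exp_add]; norm_num
  have hV : ∀ c ∈ T, gaussianTape (V c) ≤ ENNReal.ofReal (Real.exp (-(3 / 2 * p))) := by
    intro c hc
    refine (gaussianTape_tail p (hT1 c hc) (by norm_num) (1 / 100)).trans
      (ENNReal.ofReal_le_ofReal ?_)
    rw [show -(3 / 2 * (p : ℝ)) = p * (-(3 / 2)) by ring, Real.exp_nat_mul]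
    refine pow_le_pow_left₀ (by positivity) ?_ p
    have h1 : √(1 / (1 - 2 * (-40)) : ℝ) = 1 / 9 := by
      rw [show (1 / (1 - 2 * (-40)) : ℝ) = (1 / 9) ^ 2 by norm_num, Real.sqrt_sq (by norm_num)]
    rw [h1, mul_one_div, div_le_iff₀ (by norm_num)]
    calc _ ≤ Real.exp (-(3 / 2) + 2) := Real.exp_le_exp.2 (by norm_num)
      _ = Real.exp (-(3 / 2)) * Real.exp 2 := Real.exp_add _ _
      _ ≤ _ := by gcongr
  have hcard : (T.card : ℝ) ≤ Real.exp (3 / 8 * p) := by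
    have h1 : (T.card : ℝ) ≤ 241 ^ d := by exact_mod_cast hT2
    have h2 : (241 : ℝ) ≤ Real.exp 6 := by
      have h := Real.exp_one_gt_d9
      have : Real.exp 6 = Real.exp 1 ^ 6 := by rw [← Real.exp_nat_mul]; norm_num
      rw [this]
      calc (241 : ℝ) ≤ 2.7 ^ 6 := by norm_num
        _ ≤ _ := pow_le_pow_left₀ (by norm_num) (by linarith) 6
    have h3 : (16 * d : ℝ) ≤ p := by exact_mod_cast hp
    calc _ ≤ (241 : ℝ) ^ d := h1
      _ ≤ Real.exp 6 ^ d := pow_le_pow_left₀ (by norm_num) h2 d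
      _ = Real.exp (d * 6) := (Real.exp_nat_mul _ _).symm
      _ ≤ _ := Real.exp_le_exp.2 (by linarith)
  calc _ ≤ gaussianTape (⋃ c ∈ T, U c ∪ V c) := measure_mono hsub
    _ ≤ ∑ c ∈ T, gaussianTape (U c ∪ V c) := measure_biUnion_finset_le T _
    _ ≤ ∑ _c ∈ T, ENNReal.ofReal (2 * Real.exp (-(3 / 2 * p))) :=
        Finset.sum_le_sum fun c hc => by
          rw [two_mul, ENNReal.ofReal_add (Real.exp_pos _).le (Real.exp_pos _).le]
          exact (measure_union_le _ _).trans (add_le_add (hU c hc) (hV c hc))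
    _ = ENNReal.ofReal (T.card * (2 * Real.exp (-(3 / 2 * p)))) := by
        rw [Finset.sum_const, nsmul_eq_mul, ENNReal.ofReal_mul (Nat.cast_nonneg _),
          ENNReal.ofReal_natCast]
    _ ≤ _ := ENNReal.ofReal_le_ofReal (by
        have h2 : (2 : ℝ) ≤ Real.exp (1 / 8 * p) := by
          have h3 : (16 : ℝ) ≤ p := by
            have : 16 ≤ p := by omega
            exact_mod_cast this
          have := Real.add_one_le_exp (1 / 8 * p : ℝ)
          linarith
        calc _ ≤ Real.exp (3 / 8 * p) * (Real.exp (1 / 8 * p) * Real.exp (-(3 / 2 * p))) := by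
              gcongr
          _ = _ := by
              rw [← Real.exp_add, ← Real.exp_add]
              congr 1
              ring)

end BDDLasso
end

noncomputable section

namespace BDDLasso

/-! ### The true support -/

section support
variable {d k : ℕ}

/-- Column `j` of `G_sparse` is the part of `z` in the block of `j`. -/
def IsTrueColumn (z : Fin d → ℝ) (j : Fin (k * 2 ^ (d / k))) : Prop :=
  ∀ i : Fin d, (i : ℕ) / (d / k) = (j : ℕ) / 2 ^ (d / k) → gSparse d k i j = z i

/-- Bit r of the column number records whether the r-th entry of the block of z is 1. -/
theorem exists_true_column (hkd : k ∣ d) {z : Fin d → ℝ} (hz : IsSign z) (b : Fin k) :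
    ∃ j : Fin (k * 2 ^ (d / k)), (j : ℕ) / 2 ^ (d / k) = b ∧ IsTrueColumn z j := by
  set N := d / k with hN
  have hd : k * N = d := Nat.mul_div_cancel' hkd
  have hidx : ∀ r : Fin N, b * N + r < d := fun r => by
    calc b * N + r < b * N + N := by omega
      _ = (b + 1) * N := by ring
      _ ≤ k * N := Nat.mul_le_mul_right _ b.2
      _ = d := hd
  set c := Nat.ofBits fun r : Fin N => decide (z ⟨b * N + r, hidx r⟩ = 1) with hc
  have hcN : c < 2 ^ N := Nat.ofBits_lt_two_pow _
  have hj : b * 2 ^ N + c < k * 2 ^ N := by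
    calc b * 2 ^ N + c < b * 2 ^ N + 2 ^ N := by omega
      _ = (b + 1) * 2 ^ N := by ring
      _ ≤ k * 2 ^ N := Nat.mul_le_mul_right _ b.2
  have hdiv : (b * 2 ^ N + c) / 2 ^ N = b := by
    rw [Nat.mul_comm, Nat.mul_add_div (by positivity), Nat.div_eq_of_lt hcN, add_zero]
  have hmod : (b * 2 ^ N + c) % 2 ^ N = c := by
    rw [Nat.mul_comm, Nat.mul_add_mod, Nat.mod_eq_of_lt hcN]
  refine ⟨⟨b * 2 ^ N + c, hj⟩, hdiv, fun i hi => ?_⟩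
  simp only [← hN] at hi
  rw [gSparse, if_pos hi]
  simp only [← hN, hmod]
  rw [hdiv] at hi
  have hN0 : 0 < N := by
    rcases Nat.eq_zero_or_pos N with h | h
    · rw [h, mul_zero] at hd
      exact absurd i.2 (by omega)
    · exact h
  have hr : (i : ℕ) % N < N := Nat.mod_lt _ hN0
  have hi' : (⟨b * N + i % N, hidx ⟨i % N, hr⟩⟩ : Fin d) = i := by
    have h1 := Nat.div_add_mod (i : ℕ) N
    rw [hi, Nat.mul_comm] at h1
    exact Fin.ext h1
  rw [hc, Nat.testBit_ofBits_lt _ _ hr]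
  simp only [hi', decide_eq_true_eq]
  rcases hz i with h | h <;> simp [h]
  norm_num

/-- Within a block the signs of a column are the bits of its number, so two columns that agree with
z there have the same number. -/
theorem IsTrueColumn.unique (hkd : k ∣ d) {z : Fin d → ℝ} {j j' : Fin (k * 2 ^ (d / k))}
    (hj : IsTrueColumn z j) (hj' : IsTrueColumn z j')
    (h : (j : ℕ) / 2 ^ (d / k) = (j' : ℕ) / 2 ^ (d / k)) : j = j' := by
  have hd : k * (d / k) = d := Nat.mul_div_cancel' hkd
  have hb : (j : ℕ) / 2 ^ (d / k) < k := (Nat.div_lt_iff_lt_mul (by positivity)).2 j.2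
  have hmod : (j : ℕ) % 2 ^ (d / k) = (j' : ℕ) % 2 ^ (d / k) := by
    apply Nat.eq_of_testBit_eq
    intro r
    by_cases hr : r < (d / k)
    · have hi : (j : ℕ) / 2 ^ (d / k) * (d / k) + r < d := by
        calc (j : ℕ) / 2 ^ (d / k) * (d / k) + r < (j : ℕ) / 2 ^ (d / k) * (d / k) + (d / k) := by omega
          _ = ((j : ℕ) / 2 ^ (d / k) + 1) * (d / k) := by ring
          _ ≤ k * (d / k) := Nat.mul_le_mul_right _ hb
          _ = d := hd
      have hdiv : ((j : ℕ) / 2 ^ (d / k) * (d / k) + r) / (d / k) = (j : ℕ) / 2 ^ (d / k) := by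
        rw [Nat.mul_comm, Nat.mul_add_div (by omega), Nat.div_eq_of_lt hr, add_zero]
      have hm : ((j : ℕ) / 2 ^ (d / k) * (d / k) + r) % (d / k) = r := by
        rw [Nat.mul_comm, Nat.mul_add_mod, Nat.mod_eq_of_lt hr]
      have h1 := (hj ⟨_, hi⟩ hdiv).trans (hj' ⟨_, hi⟩ (hdiv.trans h)).symm
      simp only [gSparse] at h1
      rw [if_pos hdiv, if_pos (hdiv.trans h), hm] at h1
      split_ifs at h1 with a1 a2 a2 <;> first | (simp [a1, a2]; done) | norm_num at h1
    · have hpow : 2 ^ (d / k) ≤ 2 ^ r := Nat.pow_le_pow_right (by omega) (by omega)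
      rw [Nat.testBit_lt_two_pow ((Nat.mod_lt _ (by positivity)).trans_le hpow),
        Nat.testBit_lt_two_pow ((Nat.mod_lt _ (by positivity)).trans_le hpow)]
  apply Fin.ext
  rw [← Nat.div_add_mod (j : ℕ) (2 ^ (d / k)), ← Nat.div_add_mod (j' : ℕ) (2 ^ (d / k)), hmod, h]

open Classical in
/-- The set of the columns that compose `z`. -/
def trueSupport (z : Fin d → ℝ) : Finset (Fin (k * 2 ^ (d / k))) :=
  Finset.univ.filter (IsTrueColumn z)

open Classical in
/-- The sparse vector encoding `z`. -/
def trueVector (z : Fin d → ℝ) : Fin (k * 2 ^ (d / k)) → ℝ :=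
  fun j => if j ∈ trueSupport z then 1 else 0

theorem exists_trueSupport_eq (hkd : k ∣ d) {z : Fin d → ℝ} (hz : IsSign z) :
    ∃ f : Fin k → Fin (k * 2 ^ (d / k)), Function.Injective f ∧
      (∀ b, (f b : ℕ) / 2 ^ (d / k) = b) ∧ (∀ b, IsTrueColumn z (f b)) ∧
      trueSupport z = Finset.univ.image f := by
  choose f hf1 hf2 using fun b => exists_true_column hkd hz b
  refine ⟨f, fun b b' h => Fin.ext (by rw [← hf1 b, h, hf1 b']), hf1, hf2, ?_⟩
  ext j
  simp only [trueSupport, Finset.mem_filter, Finset.mem_univ, true_and, Finset.mem_image]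
  constructor
  · intro hj
    have hb : (j : ℕ) / 2 ^ (d / k) < k := (Nat.div_lt_iff_lt_mul (by positivity)).2 j.2
    exact ⟨⟨_, hb⟩, (hf2 _).unique hkd hj (hf1 _)⟩
  · rintro ⟨b, rfl⟩
    exact hf2 b

theorem card_trueSupport (hkd : k ∣ d) {z : Fin d → ℝ} (hz : IsSign z) :
    (trueSupport z : Finset (Fin (k * 2 ^ (d / k)))).card = k := by
  obtain ⟨f, hf, -, -, h⟩ := exists_trueSupport_eq (k := k) hkd hz
  rw [h, Finset.card_image_of_injective _ hf, Finset.card_univ, Fintype.card_fin]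

theorem gSparse_mulVec_trueVector (hk : 0 < k) (hkd : k ∣ d) {z : Fin d → ℝ} (hz : IsSign z) :
    gSparse d k *ᵥ trueVector z = z := by
  obtain ⟨f, hf, hf1, hf2, h⟩ := exists_trueSupport_eq (k := k) hkd hz
  funext i
  have hN : 0 < d / k := Nat.div_pos (Nat.le_of_dvd i.pos hkd) hk
  have hb : (i : ℕ) / (d / k) < k := by
    rw [Nat.div_lt_iff_lt_mul hN, Nat.mul_div_cancel' hkd]
    exact i.2
  simp only [mulVec, dotProduct, trueVector, mul_ite, mul_one, mul_zero]
  rw [Finset.sum_ite_mem, Finset.univ_inter, h, Finset.sum_image fun _ _ _ _ e => hf e,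
    Finset.sum_eq_single ⟨_, hb⟩]
  · exact hf2 _ i (hf1 ⟨_, hb⟩).symm
  · intro b _ hne
    rw [gSparse, if_neg]
    intro e
    exact hne (Fin.ext (by rw [← hf1 b, ← e]))
  · simp

theorem gPartite_mulVec_trueVector (hkd : k ∣ d) {z : Fin d → ℝ} (hz : IsSign z) :
    gPartite d k *ᵥ trueVector z = fun _ => 1 := by
  obtain ⟨f, hf, hf1, hf2, h⟩ := exists_trueSupport_eq (k := k) hkd hz
  funext b
  simp only [mulVec, dotProduct, trueVector, mul_ite, mul_one, mul_zero]
  rw [Finset.sum_ite_mem, Finset.univ_inter, h, Finset.sum_image fun _ _ _ _ e => hf e,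
    Finset.sum_eq_single b]
  · rw [gPartite, if_pos (hf1 b).symm]
  · intro b' _ hne
    rw [gPartite, if_neg]
    intro e
    exact hne (Fin.ext (by rw [← hf1 b', ← e]))
  · simp

theorem sum_abs_trueVector (hkd : k ∣ d) {z : Fin d → ℝ} (hz : IsSign z) :
    ∑ j : Fin (k * 2 ^ (d / k)), |trueVector z j| = k := by
  have : ∀ j : Fin (k * 2 ^ (d / k)), |trueVector z j| = if j ∈ trueSupport z then 1 else 0 := by
    intro j
    rw [trueVector]
    split_ifs <;> simp
  simp_rw [this]
  rw [Finset.sum_ite_mem, Finset.univ_inter, Finset.sum_const, card_trueSupport hkd hz]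
  simp

theorem sum_gPartite_mulVec (θ : Fin (k * 2 ^ (d / k)) → ℝ) :
    ∑ b, (gPartite d k *ᵥ θ) b = ∑ j, θ j := by
  simp only [mulVec, dotProduct]
  rw [Finset.sum_comm]
  refine Finset.sum_congr rfl fun j _ => ?_
  have hb : (j : ℕ) / 2 ^ (d / k) < k := (Nat.div_lt_iff_lt_mul (by positivity)).2 j.2
  rw [Finset.sum_eq_single ⟨_, hb⟩]
  · simp [gPartite]
  · intro b _ hne
    rw [gPartite, if_neg (fun e => hne (Fin.ext e)), zero_mul]
  · simp

/-! ### Scalar products of z with the gadget columns. -/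

theorem card_block (hkd : k ∣ d) {b : ℕ} (hb : b < k) :
    (Finset.univ.filter fun i : Fin d => (i : ℕ) / (d / k) = b).card = d / k := by
  set N := d / k with hN
  have hd : k * N = d := Nat.mul_div_cancel' hkd
  rcases Nat.eq_zero_or_pos N with h0 | hN0
  · rw [h0, mul_zero] at hd
    subst hd
    simp [h0]
  have hidx : ∀ r : Fin N, b * N + r < d := fun r => by
    calc b * N + r < b * N + N := by omega
      _ = (b + 1) * N := by ring
      _ ≤ k * N := Nat.mul_le_mul_right _ hb
      _ = d := hd
  have : (Finset.univ.filter fun i : Fin d => (i : ℕ) / N = b) =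
      Finset.univ.image fun r : Fin N => (⟨b * N + r, hidx r⟩ : Fin d) := by
    ext i
    simp only [Finset.mem_filter, Finset.mem_univ, true_and, Finset.mem_image]
    constructor
    · intro h
      refine ⟨⟨i % N, Nat.mod_lt _ hN0⟩, Fin.ext ?_⟩
      have h1 := Nat.div_add_mod (i : ℕ) N
      rwa [h, Nat.mul_comm] at h1
    · rintro ⟨r, rfl⟩
      simp only
      rw [Nat.mul_comm, Nat.mul_add_div hN0, Nat.div_eq_of_lt r.2, add_zero]
  rw [this, Finset.card_image_of_injective, Finset.card_univ, Fintype.card_fin]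
  intro r r' h
  have := congrArg Fin.val h
  simp only at this
  exact Fin.ext (by omega)

theorem dotProduct_col_eq_sum (z : Fin d → ℝ) (j : Fin (k * 2 ^ (d / k))) :
    z ⬝ᵥ (gSparse d k).col j = ∑ i ∈ Finset.univ.filter
      (fun i : Fin d => (i : ℕ) / (d / k) = (j : ℕ) / 2 ^ (d / k)), z i * gSparse d k i j := by
  rw [dotProduct, Finset.sum_filter]
  refine Finset.sum_congr rfl fun i _ => ?_
  split_ifs with h
  · rfl
  · rw [col_apply, gSparse, if_neg h, mul_zero]

theorem mul_gSparse_mem {z : Fin d → ℝ} (hz : IsSign z) {i : Fin d} {j : Fin (k * 2 ^ (d / k))}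
    (h : (i : ℕ) / (d / k) = (j : ℕ) / 2 ^ (d / k)) :
    (z i * gSparse d k i j = 1 ∧ gSparse d k i j = z i) ∨
      (z i * gSparse d k i j = -1 ∧ gSparse d k i j ≠ z i) := by
  rw [gSparse, if_pos h]
  rcases hz i with h1 | h1 <;> rw [h1] <;> split_ifs <;> norm_num

theorem dotProduct_col_of_true (hkd : k ∣ d) {z : Fin d → ℝ} (hz : IsSign z)
    {j : Fin (k * 2 ^ (d / k))} (hj : IsTrueColumn z j) :
    z ⬝ᵥ (gSparse d k).col j = (d / k : ℕ) := by
  have hb : (j : ℕ) / 2 ^ (d / k) < k := (Nat.div_lt_iff_lt_mul (by positivity)).2 j.2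
  rw [dotProduct_col_eq_sum, Finset.sum_congr rfl (g := fun _ => (1 : ℝ)), Finset.sum_const,
    card_block hkd hb, nsmul_eq_mul, mul_one]
  intro i hi
  have hi' := (Finset.mem_filter.1 hi).2
  rcases mul_gSparse_mem hz hi' with h | h
  · exact h.1
  · exact absurd (hj i hi') h.2

/-- A wrong column disagrees with z at some coordinate of its block, which contributes -1 instead of
1. This gap of 2 separates the true columns from all others. -/
theorem dotProduct_col_le (hkd : k ∣ d) {z : Fin d → ℝ} (hz : IsSign z)
    {j : Fin (k * 2 ^ (d / k))} (hj : ¬ IsTrueColumn z j) :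
    z ⬝ᵥ (gSparse d k).col j ≤ (d / k : ℕ) - 2 := by
  have hb : (j : ℕ) / 2 ^ (d / k) < k := (Nat.div_lt_iff_lt_mul (by positivity)).2 j.2
  rw [IsTrueColumn] at hj
  push Not at hj
  obtain ⟨i₀, hi₀, hne⟩ := hj
  have hmem : i₀ ∈ Finset.univ.filter
      (fun i : Fin d => (i : ℕ) / (d / k) = (j : ℕ) / 2 ^ (d / k)) := by simpa using hi₀
  have h0 : z i₀ * gSparse d k i₀ j = -1 := by
    rcases mul_gSparse_mem hz hi₀ with h | h
    · exact absurd h.2 hne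
    · exact h.1
  have hcard := card_block hkd hb
  have h1 : ∑ i ∈ (Finset.univ.filter (fun i : Fin d => (i : ℕ) / (d / k) =
      (j : ℕ) / 2 ^ (d / k))).erase i₀, z i * gSparse d k i j ≤
      ∑ _i ∈ (Finset.univ.filter (fun i : Fin d => (i : ℕ) / (d / k) =
      (j : ℕ) / 2 ^ (d / k))).erase i₀, (1 : ℝ) := by
    refine Finset.sum_le_sum fun i hi => ?_
    rcases mul_gSparse_mem hz (Finset.mem_filter.1 (Finset.mem_of_mem_erase hi)).2 with h | h
    · exact h.1.le
    · rw [h.1]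
      norm_num
  rw [dotProduct_col_eq_sum, ← Finset.add_sum_erase _ _ hmem, h0]
  rw [Finset.sum_const, Finset.card_erase_of_mem hmem, hcard, nsmul_eq_mul, mul_one,
    Nat.cast_sub (by rw [← hcard]; exact Finset.card_pos.2 ⟨i₀, hmem⟩), Nat.cast_one] at h1
  linarith

theorem neg_le_dotProduct_col (hkd : k ∣ d) {z : Fin d → ℝ} (hz : IsSign z)
    (j : Fin (k * 2 ^ (d / k))) : -((d / k : ℕ) : ℝ) ≤ z ⬝ᵥ (gSparse d k).col j := by
  have hb : (j : ℕ) / 2 ^ (d / k) < k := (Nat.div_lt_iff_lt_mul (by positivity)).2 j.2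
  have h1 : ∑ _i ∈ Finset.univ.filter (fun i : Fin d => (i : ℕ) / (d / k) =
      (j : ℕ) / 2 ^ (d / k)), (-1 : ℝ) ≤ z ⬝ᵥ (gSparse d k).col j := by
    rw [dotProduct_col_eq_sum]
    refine Finset.sum_le_sum fun i hi => ?_
    rcases mul_gSparse_mem hz (Finset.mem_filter.1 hi).2 with h | h
    · rw [h.1]
      norm_num
    · exact h.1.ge
  rw [Finset.sum_const, card_block hkd hb] at h1
  simpa using h1

/-- The mass outside of the true support is controlled by the negative mass and by the defect of
`θ` in the direction of `z`. -/
theorem sum_abs_compl_le (hkd : k ∣ d) {z : Fin d → ℝ} (hz : IsSign z)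
    (θ : Fin (k * 2 ^ (d / k)) → ℝ) (hN : 1 ≤ d / k) :
    ∑ j ∈ (trueSupport z)ᶜ, |θ j| ≤
      (((d / k : ℕ) : ℝ) * ∑ j, θ j - z ⬝ᵥ (gSparse d k *ᵥ θ)) / 2 +
        ((d / k : ℕ) : ℝ) * (∑ j, |θ j| - ∑ j, θ j) := by
  set N : ℝ := ((d / k : ℕ) : ℝ) with hNdef
  have hN1 : 1 ≤ N := by
    rw [hNdef]
    exact_mod_cast hN
  have e1 : z ⬝ᵥ (gSparse d k *ᵥ θ) = ∑ j, θ j * (z ⬝ᵥ (gSparse d k).col j) := by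
    rw [dotProduct_mulVec, dotProduct]
    exact Finset.sum_congr rfl fun j _ => mul_comm _ _
  have e2 : ((N * ∑ j, θ j - z ⬝ᵥ (gSparse d k *ᵥ θ)) / 2 + N * (∑ j, |θ j| - ∑ j, θ j)) =
      ∑ j, (θ j * (N - z ⬝ᵥ (gSparse d k).col j) / 2 + N * (|θ j| - θ j)) := by
    rw [e1, Finset.sum_add_distrib, ← Finset.sum_div, ← Finset.mul_sum, Finset.sum_sub_distrib,
      Finset.mul_sum, ← Finset.sum_sub_distrib]
    congr 2
    exact Finset.sum_congr rfl fun j _ => by ring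
  rw [e2, ← Finset.sum_compl_add_sum (trueSupport z)]
  -- For θ_j ≥ 0 the gap makes the first term at least θ_j. For θ_j < 0 the first term is at least
  -- -N|θ_j| and the second is 2N|θ_j|, which leaves N|θ_j| ≥ |θ_j|.
  have h1 : ∀ j ∈ (trueSupport z)ᶜ,
      |θ j| ≤ θ j * (N - z ⬝ᵥ (gSparse d k).col j) / 2 + N * (|θ j| - θ j) := by
    intro j hj
    have hj' : ¬ IsTrueColumn z j := by simpa [trueSupport] using hj
    have a1 := dotProduct_col_le hkd hz hj'
    have a2 := neg_le_dotProduct_col hkd hz j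
    rw [← hNdef] at a1 a2
    rcases abs_cases (θ j) with ⟨h, h'⟩ | ⟨h, h'⟩ <;> rw [h] <;> nlinarith
  have h2 : 0 ≤ ∑ j ∈ trueSupport z,
      (θ j * (N - z ⬝ᵥ (gSparse d k).col j) / 2 + N * (|θ j| - θ j)) := by
    refine Finset.sum_nonneg fun j hj => ?_
    have hj' : IsTrueColumn z j := by simpa [trueSupport] using hj
    rw [dotProduct_col_of_true hkd hz hj', ← hNdef, sub_self, mul_zero, zero_div, zero_add]
    exact mul_nonneg (by linarith) (sub_nonneg.2 (le_abs_self _))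
  linarith [Finset.sum_le_sum h1]

end support

end BDDLasso
end

noncomputable section

namespace BDDLasso

/-! ### Deterministic recovery -/

/-- Two times a product is at most the weighted sum of the squares. -/
theorem two_mul_mul_le_sq_add_sq_div {c : ℝ} (hc : 0 < c) (w x : ℝ) :
    2 * w * x ≤ c * x ^ 2 + w ^ 2 / c := by
  have h : c * x ^ 2 + w ^ 2 / c - 2 * w * x = (c * x - w) ^ 2 / c := by
    field_simp
    ring
  have : 0 ≤ (c * x - w) ^ 2 / c := by positivity
  linarith

/-- The energy bound: `V` is the scale of the squared error, `P` is the signed defect of the mass,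
`q` the Euclidean defect of the block masses, and `ν` the negative mass. -/
theorem energy_bound {d k V μ γ r q P ν a : ℝ} (hd : 1 ≤ d) (hk : 0 < k) (hV : 0 < V)
    (hμ0 : 0 < μ) (hμ : 320 * d * μ ≤ 17 * V) (hγ : 300 * d * V ≤ γ ^ 2 * k)
    (hP : P ^ 2 ≤ k * q ^ 2)
    (hmain : r ^ 2 + γ ^ 2 * q ^ 2 + 2 * μ * (P + 2 * ν) ≤ a ^ 2) :
    r ^ 2 + γ ^ 2 * q ^ 2 / 2 + 4 * μ * ν ≤ a ^ 2 + 2 * (V * k ^ 2 / (100000 * d ^ 3)) := by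
  set w := 17 * V * k / (320 * d) with hw
  set x := |P| / k with hx
  have hx0 : 0 ≤ x := by positivity
  have hPx : |P| = k * x := by
    rw [hx]
    field_simp
  have h1 : μ * k ≤ w := by
    rw [hw, le_div_iff₀ (by positivity)]
    nlinarith
  -- γ²q² controls 300dV x², where x = |P|/k. Spending the weight 150dV on the linear term in P
  -- keeps half of γ²q² on the left.
  have h2 := two_mul_mul_le_sq_add_sq_div (c := 150 * d * V) (by positivity) w x
  have h3 : w ^ 2 / (150 * d * V) ≤ 2 * (V * k ^ 2 / (100000 * d ^ 3)) := by
    have : w ^ 2 / (150 * d * V) = 289 / 15360000 * (V * k ^ 2 / d ^ 3) := by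
      rw [hw]
      field_simp
      ring
    have h' : 2 * (V * k ^ 2 / (100000 * d ^ 3)) = 2 / 100000 * (V * k ^ 2 / d ^ 3) := by
      field_simp
    rw [this, h']
    have : 0 ≤ V * k ^ 2 / d ^ 3 := by positivity
    nlinarith
  have h4 : 300 * d * V * x ^ 2 ≤ γ ^ 2 * q ^ 2 := by
    have e1 : k * x ^ 2 ≤ q ^ 2 := by
      have : k * (k * x ^ 2) ≤ k * q ^ 2 := by
        rw [← sq_abs P, hPx] at hP
        nlinarith
      exact le_of_mul_le_mul_left this hk
    calc 300 * d * V * x ^ 2 ≤ γ ^ 2 * k * x ^ 2 := by gcongr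
      _ = γ ^ 2 * (k * x ^ 2) := by ring
      _ ≤ γ ^ 2 * q ^ 2 := by gcongr
  have h5 : -(2 * μ * P) ≤ 2 * w * x := by
    calc -(2 * μ * P) = 2 * μ * -P := by ring
      _ ≤ 2 * μ * |P| := by gcongr; exact neg_le_abs P
      _ = 2 * (μ * k) * x := by rw [hPx]; ring
      _ ≤ 2 * w * x := by gcongr
  nlinarith

/-- Measured in the unit Y, the energy bound yields |Z| ≤ 3/20, q ≤ 1/2000, N|P| ≤ 1/2000 and Nν ≤
1/1000, and these add up to less than 1/2. Q is the residue left by absorbing P. -/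
theorem mass_bound_of_energy {d k N Y Q μ γ q P ν a r H Z T : ℝ} (hd : 1 ≤ d) (hk0 : 0 < k)
    (hkd : k ≤ d) (hN : N * k = d) (hN0 : 0 < N) (hY : 0 < Y) (hμ : Y ≤ 20 * μ)
    (hγ : 300 * d * (d * Y) ≤ γ ^ 2 * k) (hP : P ^ 2 ≤ k * q ^ 2) (hν : 0 ≤ ν)
    (hE : r ^ 2 + γ ^ 2 * q ^ 2 / 2 + 4 * μ * ν ≤ a ^ 2 + 2 * Q)
    (ha : a ^ 2 ≤ Y / 1562500) (haN : N * a ^ 2 ≤ Y / 1562500)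
    (hQ : Q ≤ Y / 100000) (hQN : N * Q ≤ Y / 100000)
    (hH : d * Y * H ≤ 450 * (r ^ 2 + a ^ 2))
    (hZ : Z ^ 2 ≤ d * H) (hT : T ≤ (N * P - Z) / 2 + 2 * N * ν) :
    T + q < 1 / 2 := by
  have hd0 : 0 < d := by linarith
  have hμ0 : 0 < μ := by linarith
  have hg0 : 0 ≤ γ ^ 2 * q ^ 2 := by positivity
  have hr0 : 0 ≤ r ^ 2 := sq_nonneg r
  have hmn : 0 ≤ 4 * μ * ν := by positivity
  have hZ1 : |Z| ≤ 3 / 20 := by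
    have h1 : Y * (d * H) ≤ Y * (9 / 400) := by
      calc Y * (d * H) = d * Y * H := by ring
        _ ≤ _ := hH
        _ ≤ Y * (9 / 400) := by linarith
    have h2 := le_of_mul_le_mul_left h1 hY
    refine abs_le_of_sq_le_sq (by linarith) (by norm_num)
  have hq1 : d ^ 2 * q ^ 2 ≤ k / 4000000 := by
    have h1 : γ ^ 2 * q ^ 2 ≤ Y / 20000 := by linarith
    have h2 : 300 * d * (d * Y) * q ^ 2 ≤ k * (Y / 20000) := by
      calc 300 * d * (d * Y) * q ^ 2 ≤ γ ^ 2 * k * q ^ 2 := by gcongr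
        _ = k * (γ ^ 2 * q ^ 2) := by ring
        _ ≤ k * (Y / 20000) := by gcongr
    have h3 : Y * (d ^ 2 * q ^ 2) ≤ Y * (k / 6000000) := by linarith
    have := le_of_mul_le_mul_left h3 hY
    linarith
  have hq2 : q ≤ 1 / 2000 := by
    refine (le_abs_self q).trans (abs_le_of_sq_le_sq ?_ (by norm_num))
    have h1 : d * (d * q ^ 2) ≤ d * (1 / 4000000) := by linarith
    have h2 := le_of_mul_le_mul_left h1 hd0
    have h3 : 1 * q ^ 2 ≤ d * q ^ 2 := by gcongr
    linarith
  -- N²k² = d² matches the bound just obtained for d²q².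
  have hNP : |N * P| ≤ 1 / 2000 := by
    refine abs_le_of_sq_le_sq ?_ (by norm_num)
    have h1 : k * (N * P) ^ 2 ≤ k * (1 / 2000) ^ 2 := by
      calc k * (N * P) ^ 2 = N ^ 2 * k * P ^ 2 := by ring
        _ ≤ N ^ 2 * k * (k * q ^ 2) := by gcongr
        _ = d ^ 2 * q ^ 2 := by rw [← hN]; ring
        _ ≤ k / 4000000 := hq1
        _ = _ := by ring
    exact le_of_mul_le_mul_left h1 hk0
  have hNν : N * ν ≤ 1 / 1000 := by
    have h1 : Y * ν ≤ 5 * (a ^ 2 + 2 * Q) := by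
      have : Y * ν ≤ 20 * μ * ν := by gcongr
      linarith
    have h4 : Y * (N * ν) ≤ Y * (1 / 1000) := by
      calc Y * (N * ν) = N * (Y * ν) := by ring
        _ ≤ N * (5 * (a ^ 2 + 2 * Q)) := by gcongr
        _ = 5 * (N * a ^ 2 + 2 * (N * Q)) := by ring
        _ ≤ Y * (1 / 1000) := by linarith
    exact le_of_mul_le_mul_left h4 hY
  have b1 := le_abs_self (N * P)
  have b2 := neg_le_abs Z
  linarith

/-- Takes V = dY in `energy_bound`, whose residue is then Q = dYk²/(100000d³). By Nk = d, NQ is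
Y/100000 times k/d ≤ 1. -/
theorem mass_bound {d k N Y μ γ r q P ν a H Z T : ℝ} (hd : 1 ≤ d) (hk : 1 ≤ k) (hkd : k ≤ d)
    (hN : N * k = d) (hN1 : 1 ≤ N) (hY : 0 < Y) (hμ0 : Y ≤ 20 * μ) (hμ : 320 * μ ≤ 17 * Y)
    (hγ : 300 * d * (d * Y) ≤ γ ^ 2 * k) (hP : P ^ 2 ≤ k * q ^ 2) (hν : 0 ≤ ν)
    (hmain : r ^ 2 + γ ^ 2 * q ^ 2 + 2 * μ * (P + 2 * ν) ≤ a ^ 2)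
    (ha : d * a ^ 2 ≤ Y / 1562500) (hH : d * Y * H ≤ 450 * (r ^ 2 + a ^ 2))
    (hZ : Z ^ 2 ≤ d * H) (hT : T ≤ (N * P - Z) / 2 + 2 * N * ν) :
    T + q < 1 / 2 := by
  have hd0 : 0 < d := by linarith
  have hk0 : 0 < k := by linarith
  have hkd1 : k / d ≤ 1 := by
    rw [div_le_one hd0]
    exact hkd
  have hQN : N * (d * Y * k ^ 2 / (100000 * d ^ 3)) ≤ Y / 100000 := by
    have e : N * (d * Y * k ^ 2 / (100000 * d ^ 3)) = Y / 100000 * (k / d) := by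
      field_simp
      rw [← hN]
    rw [e]
    exact mul_le_of_le_one_right (by positivity) hkd1
  have haN : N * a ^ 2 ≤ Y / 1562500 := by
    have hNd : N ≤ d := by
      rw [← hN]
      exact le_mul_of_one_le_right (by linarith) hk
    exact (mul_le_mul_of_nonneg_right hNd (sq_nonneg a)).trans ha
  have hQ : d * Y * k ^ 2 / (100000 * d ^ 3) ≤ Y / 100000 :=
    (le_mul_of_one_le_left (by positivity) hN1).trans hQN
  have ha' : a ^ 2 ≤ Y / 1562500 := (le_mul_of_one_le_left (sq_nonneg a) hd).trans ha
  exact mass_bound_of_energy hd hk0 hkd hN (by linarith) hY hμ0 hγ hP hν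
    (energy_bound hd hk0 (by positivity) (by linarith) (by nlinarith) hγ hP hmain)
    ha' haN hQ hQN hH hZ hT

theorem l2norm_sum_sq {ι κ : Type*} [Fintype ι] [Fintype κ] (v : ι ⊕ κ → ℝ) :
    l2norm v ^ 2 = l2norm (fun i => v (Sum.inl i)) ^ 2 + l2norm (fun i => v (Sum.inr i)) ^ 2 := by
  simp only [l2norm_sq, dotProduct, Fintype.sum_sum_type]

/-! ### From optimality of a Lasso estimate to coordinatewise closeness. -/

section recovery
variable {d k m : ℕ} {B : Matrix (Fin d) (Fin d) ℝ} {R : Matrix (Fin (m - k)) (Fin d) ℝ}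
  {γ lam : ℝ} {z e : Fin d → ℝ}

theorem l2norm_residual_sq (θ : Fin (k * 2 ^ (d / k)) → ℝ) :
    l2norm (response d k m (B *ᵥ z + e) R γ - design d k m B R γ *ᵥ θ) ^ 2 =
      l2norm (R *ᵥ (e - B *ᵥ (gSparse d k *ᵥ θ - z))) ^ 2 +
        γ ^ 2 * l2norm (fun b => 1 - (gPartite d k *ᵥ θ) b) ^ 2 := by
  rw [l2norm_sum_sq]
  congr 1
  · congr 2
    funext i
    simp only [Pi.sub_apply, response, design, Sum.elim_inl, fromRows_mulVec]
    rw [← mulVec_mulVec, ← mulVec_mulVec, ← Pi.sub_apply, ← mulVec_sub, mulVec_sub B,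
      sub_sub_eq_add_sub, add_comm e]
  · rw [← mul_pow, ← sq_abs, ← sq_abs (γ * _), abs_mul, abs_of_nonneg (l2norm_nonneg _),
      abs_of_nonneg (l2norm_nonneg _), ← l2norm_smul]
    congr 2
    funext i
    simp only [Pi.sub_apply, response, design, Sum.elim_inr, fromRows_mulVec, smul_mulVec,
      Pi.smul_apply, smul_eq_mul]
    ring

/-- Comparison of the objective at a Lasso estimate and at the true sparse vector. -/
theorem IsLasso.basic_inequality (hkd : k ∣ d) (hk : 0 < k) (hkm : k ≤ m) (hz : IsSign z)
    {θ : Fin (k * 2 ^ (d / k)) → ℝ}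
    (hθ : IsLasso (design d k m B R γ) (response d k m (B *ᵥ z + e) R γ) lam θ) :
    l2norm (R *ᵥ (e - B *ᵥ (gSparse d k *ᵥ θ - z))) ^ 2 +
        γ ^ 2 * l2norm (fun b => 1 - (gPartite d k *ᵥ θ) b) ^ 2 +
        2 * (m * lam) * (∑ j, |θ j| - k) ≤ l2norm (R *ᵥ e) ^ 2 := by
  have h := hθ (trueVector z)
  have hm : (0 : ℝ) < m := by exact_mod_cast hk.trans_le hkm
  have hcard : (Fintype.card (Fin (m - k) ⊕ Fin k) : ℝ) = m := by
    rw [Fintype.card_sum, Fintype.card_fin, Fintype.card_fin, Nat.sub_add_cancel hkm]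
  rw [lassoObjective, lassoObjective, l2norm_residual_sq, l2norm_residual_sq, hcard,
    gSparse_mulVec_trueVector hk hkd hz, gPartite_mulVec_trueVector hkd hz,
    sum_abs_trueVector hkd hz, sub_self, mulVec_zero, sub_zero] at h
  have h0 : l2norm (fun _ : Fin k => (1 : ℝ) - 1) = 0 := by
    rw [l2norm_eq_zero]
    funext
    simp
  rw [h0] at h
  have h' := mul_le_mul_of_nonneg_left h (by positivity : 0 ≤ 2 * (m : ℝ))
  have e1 : ∀ x y : ℝ, 2 * (m : ℝ) * (1 / (2 * m) * x + y) = x + 2 * m * y := fun x y => by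
    field_simp
  rw [e1, e1] at h'
  linarith

/-- A Lasso estimate is within `1 / 2` of the true sparse vector in every coordinate. -/
theorem IsLasso.abs_sub_trueVector_lt (hkd : k ∣ d) (hk : 0 < k) (hd : 0 < d) (hm : 17 * d ≤ m)
    (hB : B.det ≠ 0) (hR : WellConditioned R)
    (hγ : 10 * √3 * sigmaMax B * √((d : ℝ) * (m - k : ℕ) / k) ≤ γ) (hz : IsSign z)
    (he : invNormSq B * (5000 * d * l2norm e) ^ 2 ≤ 1) {θ : Fin (k * 2 ^ (d / k)) → ℝ}
    (hθ : IsLasso (design d k m B R γ) (response d k m (B *ᵥ z + e) R γ) (lamVal B) θ)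
    (j : Fin (k * 2 ^ (d / k))) : |θ j - trueVector z j| < 1 / 2 := by
  have hkd' : k ≤ d := Nat.le_of_dvd hd hkd
  have hbasic := hθ.basic_inequality hkd hk (by omega) hz
  obtain ⟨f, hf, hf1, hf2, hS⟩ := exists_trueSupport_eq (k := k) hkd hz
  set W := invNormSq B with hW
  have hW0 : 0 < W := invNormSq_pos hd hB
  set M : ℝ := ((m - k : ℕ) : ℝ) with hM
  have hMm : (m : ℝ) = M + k := by rw [hM, Nat.cast_sub (by omega)]; ring
  have hk1 : (1 : ℝ) ≤ k := by exact_mod_cast hk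
  have hkdr : (k : ℝ) ≤ d := by exact_mod_cast hkd'
  have hmr : 17 * (d : ℝ) ≤ m := by exact_mod_cast hm
  have hd1 : (1 : ℝ) ≤ d := hk1.trans hkdr
  have hd0 : (0 : ℝ) < d := by linarith
  have hM0 : 0 < M := by linarith
  set N : ℝ := ((d / k : ℕ) : ℝ) with hN
  have hNk : N * k = d := by
    rw [hN]
    exact_mod_cast Nat.div_mul_cancel hkd
  have hN1 : 1 ≤ d / k := Nat.div_pos hkd' hk
  have hN1r : 1 ≤ N := by
    rw [hN]
    exact_mod_cast hN1
  set h := gSparse d k *ᵥ θ - z with hh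
  set δ : Fin k → ℝ := fun b => 1 - (gPartite d k *ᵥ θ) b with hδ
  set a := l2norm (R *ᵥ e) with ha
  set r := l2norm (R *ᵥ (e - B *ᵥ h)) with hr
  set P := ∑ i, θ i - k with hP
  have hPδ : P = -∑ b, δ b := by
    simp [hP, hδ, Finset.sum_sub_distrib, ← sum_gPartite_mulVec]
  have hPq : P ^ 2 ≤ k * l2norm δ ^ 2 := by
    have := sq_sum_le_card_mul_sum_sq (s := Finset.univ) (f := δ)
    rw [hPδ, neg_sq, l2norm_sq, dotProduct]
    simpa [sq] using this
  have hν : 0 ≤ (∑ i, |θ i| - ∑ i, θ i) / 2 :=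
    div_nonneg (sub_nonneg.2 (Finset.sum_le_sum fun i _ => le_abs_self _)) (by norm_num)
  have ha2 : a ^ 2 ≤ 16 * M * l2norm e ^ 2 := by
    have := pow_le_pow_left₀ (l2norm_nonneg _) (hR e).2 2
    rwa [mul_pow, mul_pow, Real.sq_sqrt hM0.le, show (4 : ℝ) ^ 2 = 16 by norm_num] at this
  -- The unit is Y = M/(Wd). The constant comes from 16 · 1562500 = 5000², where 16 is the square of
  -- the upper bound on R.
  have hae : d * a ^ 2 ≤ M / (W * d) / 1562500 := by
    rw [le_div_iff₀ (by norm_num), le_div_iff₀ (by positivity)]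
    calc d * a ^ 2 * 1562500 * (W * d) = (1562500 * d ^ 2 * W) * a ^ 2 := by ring
      _ ≤ (1562500 * d ^ 2 * W) * (16 * M * l2norm e ^ 2) := by gcongr
      _ = M * (W * (5000 * d * l2norm e) ^ 2) := by ring
      _ ≤ M * 1 := by gcongr
      _ = M := mul_one M
  -- RBh is the difference of Re and R(e - Bh), so its norm is at most a + r. The lower bounds for R
  -- and B carry this over to h, and 450 = 2 · 15².
  have hH : d * (M / (W * d)) * l2norm h ^ 2 ≤ 450 * (r ^ 2 + a ^ 2) := by
    have e1 : R *ᵥ (B *ᵥ h) = R *ᵥ e - R *ᵥ (e - B *ᵥ h) := by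
      rw [← mulVec_sub, sub_sub_cancel]
    have e2 : l2norm (R *ᵥ (B *ᵥ h)) ≤ a + r := by
      rw [e1]
      exact l2norm_sub_le _ _
    have e3 : √M / 15 * l2norm (B *ᵥ h) ≤ a + r := (hR _).1.trans e2
    have e4 := pow_le_pow_left₀ (mul_nonneg (by positivity) (l2norm_nonneg _)) e3 2
    rw [mul_pow, div_pow, Real.sq_sqrt hM0.le] at e4
    have e5 := l2norm_sq_le_invNormSq_mul hB h
    calc d * (M / (W * d)) * l2norm h ^ 2 ≤ d * (M / (W * d)) * (W * l2norm (B *ᵥ h) ^ 2) := by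
          gcongr
      _ = 225 * (M / 15 ^ 2 * l2norm (B *ᵥ h) ^ 2) := by
          field_simp
          norm_num
      _ ≤ 225 * (a + r) ^ 2 := by gcongr
      _ ≤ 450 * (r ^ 2 + a ^ 2) := by nlinarith [sq_nonneg (a - r)]
  have hzz : z ⬝ᵥ z = d := by
    rw [dotProduct, Finset.sum_congr rfl fun i _ =>
      show z i * z i = 1 by rcases hz i with h | h <;> rw [h] <;> norm_num]
    simp
  have hZ : (z ⬝ᵥ h) ^ 2 ≤ d * l2norm h ^ 2 := by
    rw [← hzz, ← l2norm_sq, ← mul_pow, ← sq_abs]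
    exact pow_le_pow_left₀ (abs_nonneg _) (abs_dotProduct_le _ _) 2
  have hT := sum_abs_compl_le hkd hz θ hN1
  have hT' : ∑ i ∈ (trueSupport z)ᶜ, |θ i| ≤
      (N * P - z ⬝ᵥ h) / 2 + 2 * N * ((∑ i, |θ i| - ∑ i, θ i) / 2) := by
    refine hT.trans_eq ?_
    rw [hh, dotProduct_sub, hzz, hP, ← hNk]
    ring
  have hσ : 1 ≤ W * sigmaMax B ^ 2 := one_le_invNormSq_mul hd hB
  -- γ²k ≥ 300dMσ_max² ≥ 300dM/W, by `hσ`.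
  have hγ2 : 300 * d * (d * (M / (W * d))) ≤ γ ^ 2 * k := by
    have e1 := pow_le_pow_left₀ (mul_nonneg (mul_nonneg (by positivity) (sigmaMax_nonneg B))
      (Real.sqrt_nonneg _)) hγ 2
    rw [mul_pow, mul_pow, mul_pow, Real.sq_sqrt (by norm_num), Real.sq_sqrt (by positivity)] at e1
    calc 300 * d * (d * (M / (W * d))) = 300 * d * M / W * 1 := by
          field_simp
      _ ≤ 300 * d * M / W * (W * sigmaMax B ^ 2) := by gcongr
      _ = 10 ^ 2 * 3 * sigmaMax B ^ 2 * (d * M / k) * k := by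
          field_simp
          ring
      _ ≤ γ ^ 2 * k := by gcongr
  have hlam : m * lamVal B = m / (20 * (W * d)) := by
    rw [lamVal, ← hW]
    field_simp
  rw [hlam] at hbasic
  -- Here μ = mλ. Since m ≥ 17d ≥ 17k, M ≤ m ≤ (17/16)M, which places μ between Y/20 and 17Y/320.
  have hTq := mass_bound hd1 hk1 hkdr hNk hN1r (Y := M / (W * d)) (μ := m / (20 * (W * d)))
    (by positivity)
    (by
      rw [show 20 * ((m : ℝ) / (20 * (W * d))) = m / (W * d) by field_simp]
      gcongr
      linarith)
    (by
      rw [show 320 * ((m : ℝ) / (20 * (W * d))) = 16 * m / (W * d) by field_simp; ring,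
        show 17 * (M / (W * d)) = 17 * M / (W * d) by ring]
      exact div_le_div_of_nonneg_right (by linarith) (by positivity))
    hγ2 hPq hν (hbasic.trans_eq' (by rw [hP]; ring)) hae hH hZ hT'
  by_cases hj : j ∈ trueSupport z
  · obtain ⟨b, -, hb⟩ := Finset.mem_image.1 (hS ▸ hj)
    have h1 : (gPartite d k *ᵥ θ) b - θ j =
        ∑ i ∈ Finset.univ.erase j, gPartite d k b i * θ i := by
      rw [mulVec, dotProduct, ← Finset.add_sum_erase _ _ (Finset.mem_univ j), gPartite,
        if_pos (by rw [← hb, hf1])]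
      simp [gPartite]
    -- Block b has only one true column, so its remaining columns are all off the support.
    have h2 : |(gPartite d k *ᵥ θ) b - θ j| ≤ ∑ i ∈ (trueSupport z)ᶜ, |θ i| := by
      rw [h1, ← Finset.sum_subset (s₁ := (trueSupport z)ᶜ) ?_ ?_]
      · refine (Finset.abs_sum_le_sum_abs _ _).trans (Finset.sum_le_sum fun i _ => ?_)
        rw [abs_mul, gPartite]
        split_ifs <;> simp
      · intro i hi
        refine Finset.mem_erase.2 ⟨?_, Finset.mem_univ _⟩
        rintro rfl
        exact Finset.mem_compl.1 hi hj
      · intro i hi hi'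
        rw [Finset.mem_compl, not_not, hS] at hi'
        obtain ⟨b', -, hb'⟩ := Finset.mem_image.1 hi'
        rw [gPartite, if_neg, zero_mul]
        intro h
        rw [← hb', hf1] at h
        exact (Finset.mem_erase.1 hi).1 (by rw [← hb, ← hb', Fin.ext h])
    have h3 := abs_apply_le_l2norm δ b
    have h4 : θ j - trueVector z j = -δ b - ((gPartite d k *ᵥ θ) b - θ j) := by
      rw [trueVector, if_pos hj, hδ]
      ring
    rw [h4]
    have h5 := abs_sub (-δ b) ((gPartite d k *ᵥ θ) b - θ j)
    rw [abs_neg] at h5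
    linarith
  · rw [trueVector, if_neg hj, sub_zero]
    have := Finset.single_le_sum (f := fun i => |θ i|) (fun i _ => abs_nonneg _)
      (Finset.mem_compl.2 hj)
    have h0 := l2norm_nonneg δ
    linarith

end recovery

end BDDLasso
end

noncomputable section

namespace BDDLasso

/-! ### The reduction -/

/-! ### From coordinatewise closeness to the decoded vector. -/

section decoding
variable {d k : ℕ} {z : Fin d → ℝ}

/-- Entries exceed 1/2 on the true support and are below 1/2 in absolute value off it. Any choice of
k largest entries is therefore the support, and ties do not matter. -/
theorem decode_eq_of_close (hk : 0 < k) (hkd : k ∣ d) (hz : IsSign z)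
    {θ θTL : Fin (k * 2 ^ (d / k)) → ℝ} (h : ∀ j, |θ j - trueVector z j| < 1 / 2)
    (hθ : IsTruncation k θ θTL) : decode d k θTL = z := by
  obtain ⟨S, hcard, hS, hTL⟩ := hθ
  have h1 : ∀ j ∈ trueSupport z, |θ j - 1| < 1 / 2 := fun j hj => by
    simpa [trueVector, hj] using h j
  have h0 : ∀ j ∉ trueSupport z, |θ j| < 1 / 2 := fun j hj => by
    simpa [trueVector, hj] using h j
  have hsub : trueSupport z ⊆ S := by
    intro j hj
    by_contra hjS
    obtain ⟨i, hi, hi'⟩ : ∃ i ∈ S, i ∉ trueSupport z := by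
      by_contra! hc
      have := Finset.eq_of_subset_of_card_le hc (by rw [card_trueSupport hkd hz, hcard])
      exact hjS (this ▸ hj)
    have a1 := abs_lt.1 (h1 j hj)
    linarith [hS i hi j hjS, h0 i hi', le_abs_self (θ j)]
  have hSe : trueSupport z = S :=
    Finset.eq_of_subset_of_card_le hsub (by rw [card_trueSupport hkd hz, hcard])
  have hround : (fun j => (round (θTL j) : ℝ)) = trueVector z := by
    funext j
    rw [hTL, ← hSe, trueVector]
    split_ifs with hj
    · have a1 := abs_lt.1 (h1 j hj)
      have : round (θ j) = 1 := by
        rw [round_eq, Int.floor_eq_iff]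
        push_cast
        constructor <;> linarith
      rw [this, Int.cast_one]
    · simp
  rw [decode, hround, gSparse_mulVec_trueVector hk hkd hz]

/-- The sign of θ_j - 1/2 tells whether j is in the support, so `postProg` needs no thresholding. -/
theorem postOutput_eq_of_close (hk : 0 < k) (hd : 0 < d) (hkd : k ∣ d) (hz : IsSign z) (m : ℕ)
    {θ : Fin (k * 2 ^ (d / k)) → ℝ} (h : ∀ j, |θ j - trueVector z j| < 1 / 2) :
    postOutput postProg d k m θ = z := by
  rw [postOutput_postProg hk (Nat.le_of_dvd hd hkd)]
  convert gSparse_mulVec_trueVector hk hkd hz using 2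
  funext j
  have hj := abs_lt.1 (h j)
  rw [Real.sqrt_mul_self_eq_abs]
  rw [trueVector] at hj ⊢
  split_ifs at hj ⊢
  · rw [abs_of_pos (by linarith), div_self (by linarith)]
    norm_num
  · rw [abs_of_neg (by linarith), div_neg, div_self (by linarith)]
    norm_num

end decoding

/-! ### The noise level permitted by the bound on α. -/

section distance
variable {d : ℕ} (B : Matrix (Fin d) (Fin d) ℝ)

theorem lambdaBin_nonneg : 0 ≤ lambdaBin B := by
  refine Real.sInf_nonneg ?_
  rintro r ⟨z, z', -, -, -, rfl⟩
  exact l2norm_nonneg _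

/-- Flip one coordinate of the all-ones vector. Besides nonnegativity, this is all that is used
about the binary minimum distance. -/
theorem lambdaBin_le (hd : 0 < d) : lambdaBin B ≤ 2 * sigmaMax B := by
  set z : Fin d → ℝ := fun _ => 1 with hz
  set v : Fin d → ℝ := Pi.single ⟨0, hd⟩ 2 with hv
  have hn : l2norm v = 2 := by simp [hv, l2norm]
  have h : lambdaBin B ≤ l2norm (B *ᵥ z - B *ᵥ (z - v)) := by
    refine csInf_le ⟨0, ?_⟩ ⟨z, z - v, fun i => Or.inl rfl, fun i => ?_, fun h => ?_, rfl⟩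
    · rintro r ⟨z, z', -, -, -, rfl⟩
      exact l2norm_nonneg _
    · by_cases hi : i = ⟨0, hd⟩
      · right
        simp [hz, hv, hi]
        norm_num
      · left
        simp [hz, hv, hi]
    · have := congrFun h ⟨0, hd⟩
      simp only [hz, hv, Pi.sub_apply, Pi.single_eq_same] at this
      norm_num at this
  rw [← mulVec_sub, sub_sub_cancel] at h
  exact h.trans ((l2norm_mulVec_le B v).trans_eq (by rw [hn, mul_comm]))

/-- From ‖e‖ ≤ 2ασ_max the bound on α gives 5000d‖e‖ ≤ σ_min/d³, and `invNormSq` times σ_min² is at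
most d, so the product is even at most d⁻⁵. -/
theorem invNormSq_mul_sq_le_one {k : ℕ} {α E : ℝ} (hd : 0 < d) (hkd : k ≤ d) (hB : B.det ≠ 0)
    (hα : α ≤ 1 / 10000 * (k : ℝ) / ((d : ℝ) ^ 5 * cond B ^ 2)) (hE0 : 0 ≤ E)
    (hE : E ≤ α * lambdaBin B) : invNormSq B * (5000 * d * E) ^ 2 ≤ 1 := by
  have hmin := sigmaMin_pos B hd hB
  have hle := sigmaMin_le_sigmaMax B
  have hmax : 0 < sigmaMax B := hmin.trans_le hle
  have hW := invNormSq_pos hd hB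
  have hd1 : (1 : ℝ) ≤ d := by exact_mod_cast hd
  have hkd' : (k : ℝ) ≤ d := by exact_mod_cast hkd
  have h1 : 5000 * d * E ≤ sigmaMin B / d ^ 3 := by
    calc 5000 * d * E ≤ 5000 * d * (1 / 10000 * (k : ℝ) / ((d : ℝ) ^ 5 * cond B ^ 2) *
          (2 * sigmaMax B)) := by
          gcongr
          exact hE.trans (mul_le_mul hα (lambdaBin_le B hd) (lambdaBin_nonneg B) (by positivity))
      _ = sigmaMin B / d ^ 3 * ((k / d) * (sigmaMin B / sigmaMax B)) := by
          rw [cond]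
          field_simp
          ring
      _ ≤ sigmaMin B / d ^ 3 * 1 := by
          gcongr
          exact mul_le_one₀ (div_le_one_of_le₀ hkd' (by positivity)) (by positivity)
            (div_le_one_of_le₀ hle hmax.le)
      _ = _ := mul_one _
  calc invNormSq B * (5000 * d * E) ^ 2 ≤ invNormSq B * (sigmaMin B / d ^ 3) ^ 2 := by gcongr
    _ = invNormSq B * sigmaMin B ^ 2 / d ^ 6 := by ring
    _ ≤ d / d ^ 6 := by
        gcongr
        exact invNormSq_mul_le hB
    _ ≤ 1 := div_le_one_of_le₀ (le_self_pow₀ hd1 (by norm_num)) (by positivity)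

end distance

/-- Failure can occur only if R is ill conditioned. Since m - k ≥ 16d, the Gaussian estimate applies
with p = m - k. -/
theorem solvesViaLasso {d k m : ℕ} (hd : 0 < d) (hkd : k ∣ d) (hm : 17 * d ≤ m)
    {B : Matrix (Fin d) (Fin d) ℝ} (hB : B.det ≠ 0) {α : ℝ}
    (hα : α ≤ 1 / 10000 * (k : ℝ) / ((d : ℝ) ^ 5 * cond B ^ 2)) {T : ℕ → ℕ → ℕ} {τ : ℕ}
    (hτ : ∀ t ω θ, totalTime preProg postProg T d k m B t ω θ ≤ τ) {ε : ℝ}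
    (hε : Real.exp (-(1 / 2 * (m : ℝ))) ≤ ε) :
    SolvesViaLasso preProg postProg T d k m B α τ ε := by
  have hk : 0 < k := Nat.pos_of_dvd_of_pos hkd hd
  have hkd' : k ≤ d := Nat.le_of_dvd hd hkd
  have hM : ((m - k : ℕ) : ℝ) = (m : ℝ) - k := Nat.cast_sub (by omega)
  have hγ : 10 * √3 * sigmaMax B * √((d : ℝ) * (m - k : ℕ) / k) ≤ gammaVal k m B := by
    rw [gammaVal]
    gcongr
    exact sigmaMax_le_sigmaEst B hd
  refine ⟨gammaVal k m B, lamVal B, hM ▸ hγ, ?_, ?_,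
    fun t ω => ⟨preProg_holds hk hkd' B t ω, hτ t ω⟩, fun z e hz he => ?_⟩
  · rw [gammaVal, hM]
    calc _ ≤ 10 * √3 * (2 * sigmaMax B) * √((d : ℝ) * (m - k) / k) := by
          gcongr
          exact sigmaEst_le B hd
      _ = _ := by ring
  · have := invNormSq_pos hd hB
    rw [lamVal]
    positivity
  · have hE := invNormSq_mul_sq_le_one B hd hkd' hB hα (l2norm_nonneg e) he
    refine (measure_mono ?_).trans
      ((gaussianTape_not_wellConditioned hd (show 16 * d ≤ m - k by omega)).trans
        (ENNReal.ofReal_le_ofReal ((Real.exp_le_exp.2 ?_).trans hε)))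
    · intro ω hω hR
      refine hω fun θ hθ => ?_
      have h := hθ.abs_sub_trueVector_lt hkd hk hd hm hB hR hγ hz hE
      exact ⟨fun θTL => decode_eq_of_close hk hkd hz h, postOutput_eq_of_close hk hd hkd hz m h⟩
    -- k ≤ d ≤ m/17, so m - k ≥ m/2.
    · have h1 : (m : ℝ) ≥ 17 * d := by exact_mod_cast hm
      have h2 : (k : ℝ) ≤ d := by exact_mod_cast hkd'
      have h3 : (0 : ℝ) ≤ d := Nat.cast_nonneg d
      rw [hM]
      linarith

end BDDLasso

end

/-! ### The constants of the two regimes. -/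

theorem mainTheorem5 :
    ∃ pre post : BDDLasso.Cmd,
      (∃ C c : ℝ, ∃ a : ℕ, 0 < C ∧ 0 < c ∧
        ∀ d k m : ℕ, 0 < d → k ∣ d → 17 * d ≤ m →
        ∀ B : Matrix (Fin d) (Fin d) ℝ, B.det ≠ 0 →
        ∀ α : ℝ, α ≤ C * (k : ℝ) / ((d : ℝ) ^ 5 * BDDLasso.cond B ^ 2) →
        ∀ T : ℕ → ℕ → ℕ,
          BDDLasso.SolvesViaLasso pre post T d k m B α
            ((m + k * 2 ^ (d / k)) ^ a + T m (k * 2 ^ (d / k)))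
            (Real.exp (-(c * (m : ℝ))))) ∧
      (∃ C' c' : ℝ, ∃ a' : ℕ, 0 < C' ∧ 0 < c' ∧
        ∀ d k m : ℕ, 0 < d → d = 10 * k → m = 100 * d →
        ∀ B : Matrix (Fin d) (Fin d) ℝ, B.det ≠ 0 →
        ∀ α : ℝ, α ≤ C' / ((d : ℝ) ^ 4 * BDDLasso.cond B ^ 2) →
        ∀ T : ℕ → ℕ → ℕ,
          BDDLasso.SolvesViaLasso pre post T d k m B α
            (d ^ a' + T m (k * 2 ^ (d / k)))
            (Real.exp (-(c' * (d : ℝ))))) := by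
  obtain ⟨a, ha⟩ := BDDLasso.exists_time_le
  -- In the second regime k/d = 1/10 turns the first constant into 1/100000 over d⁴, m/2 = 50d gives
  -- the probability, and m + k 2^10 = 2024k ≤ d⁴ gives the exponent 4a.
  refine ⟨BDDLasso.preProg, BDDLasso.postProg, ⟨1 / 10000, 1 / 2, a, by norm_num, by norm_num,
    fun d k m hd hkd hm B hB α hα T => ?_⟩, ⟨1 / 100000, 50, 4 * a, by norm_num, by norm_num,
    fun d k m hd hdk hm B hB α hα T => ?_⟩⟩
  · have hk : 0 < k := Nat.pos_of_dvd_of_pos hkd hd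
    exact BDDLasso.solvesViaLasso hd hkd hm hB hα
      (fun t ω θ => ha d k m hk (Nat.le_of_dvd hd hkd) (by omega) (by omega) B t ω θ T) le_rfl
  · have hk : 0 < k := by omega
    have hdiv : d / k = 10 := by rw [hdk, Nat.mul_div_cancel _ hk]
    have hdr : (d : ℝ) = 10 * k := by exact_mod_cast hdk
    have hmr : (m : ℝ) = 100 * d := by exact_mod_cast hm
    have hkr : (0 : ℝ) < k := by exact_mod_cast hk
    refine BDDLasso.solvesViaLasso hd (hdk ▸ Dvd.intro_left 10 rfl) (by omega) hB
      (hα.trans_eq ?_) (fun t ω θ =>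
        (ha d k m hk (by omega) (by omega) (by omega) B t ω θ T).trans
          (Nat.add_le_add_right ?_ _)) (by rw [hmr]; apply le_of_eq; congr 1; ring)
    · rw [hdr]
      field_simp
      norm_num
    · rw [pow_mul, hdiv]
      refine Nat.pow_le_pow_left ?_ a
      calc m + k * 2 ^ 10 = 2024 * k := by omega
        _ ≤ 10 ^ 4 * k ^ 4 := Nat.mul_le_mul (by norm_num) (Nat.le_self_pow (by norm_num) k)
        _ = d ^ 4 := by rw [hdk, mul_pow]
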